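/- Let $p,q\ge 0$ be integers and consider the controlled ARMA$(p,q)$ model $$Y_t=\mu+\sum_{j=1}^p a_jY_{t-j}+bU_t+Z_t,\qquad Z_t=\sum_{j=0}^q\theta_j\epsilon_{t-j},\qquad \theta_0=1,\qquad t\ge 1,$$ with integrable initial values $Y_0,\dots,Y_{1-p}$ that do not depend on $b$, and i.i.d. noise $(\epsilon_t)_{t\in\mathbb Z}$ with mean $0$ and variance $\sigma^2<\infty$. Let $a=\sum_{j=1}^p a_j$. Assume the following. 1. (No unit root) All complex roots of $1-\sum_{j=1}^p a_jy^j$ lie outside the closed unit disc. 2. (Identification) The $p\times p$ Yule–Walker matrix $\big(\gamma(q+i-j)\big)_{1\le i,j\le p}$ is nonsingular, where $\gamma(k)=\sigma^2\sum_{n\ge 0}\psi_n\psi_{n+|k|}$ is the autocovariance function of the stationary ARMA$(p,q)$ process with these coefficients, and $\sum_n\psi_nz^n=\sum_{j=0}^q\theta_jz^j\,/\,(1-\sum_{j=1}^pa_jz^j)$. 3. (Design) The treatments $U_t\in\{-1,1\}$, $t\ge1$, are generated by an observation-agnostic design $\pi$ (the conditional probabilities of $U_t$ depend on the past only through $U_1,\dots,U_{t-1}$,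 and the treatments are independent of the noise and of the initial values). The limit $\xi_\pi=\lim_{t\to\infty}\mathbb E(U_t)$ exists, $\xi_\pi^2\ne1$, and $\frac1T\sum_{t=1}^TU_t\to\xi_\pi$ in probability. The average treatment effect is $\mathrm{ATE}=\lim_{T}\mathbb E_1[\frac1T\sum_{t\le T}Y_t]-\lim_T\mathbb E_{-1}[\frac1T\sum_{t\le T}Y_t]$, where $\mathbb E_{\pm1}$ is the expectation when $U_t=\pm1$ for all $t$; as part of the claim, both limits exist for every $b$. Its Yule–Walker estimator is $\widehat{\mathrm{ATE}}=2\hat b/(1-\sum_{j=1}^p\hat a_j)$, where $(\hat b,\hat\mu,\hat a_1,\dots,\hat a_p)$ solves the $p+2$ equations $$\sum_{t=p+q+1}^T W_t\Big(Y_t-\hat\mu-\sum_{j=1}^p\hat a_jY_{t-j}-\hat bU_t\Big)=0,\qquad W_t\in\{U_t,\,1,\,Y_{t-q-1},\dots,Y_{t-q-p}\}$$ (with $\hat b=\hat\mu=\hat a_j=0$ if the solution is not unique, and $x/0=0$). Keep $p,q,\mu,(a_j),(\theta_j)$, the noise, the initial values and the design fixed, and let $b$ vary. Then, jointly as $T\to\infty$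 and $\mathrm{ATE}\to0$ (at arbitrary relative rates), $$\lim_{\substack{T\to\infty\\ \mathrm{ATE}\to0}}\mathrm{MSE}\big(\sqrt T\,\widehat{\mathrm{ATE}}\big)=\lim_{T\to\infty}\frac{4}{(1-a)^2(1-\xi_\pi^2)^2\,T}\,\mathrm{Var}\Big[\sum_{t=1}^T(U_t-\xi_\pi)Z_t\Big],$$ in the sense that one side exists as a finite limit if and only if the other does, and then they are equal. Here the left-hand side is the asymptotic mean squared error $$\lim_{K\to\infty}\ \lim_{\substack{T\to\infty\\ \mathrm{ATE}\to0}}\mathbb E\Big[\min\big\{T(\widehat{\mathrm{ATE}}-\mathrm{ATE})^2,\,K\big\}\Big];$$ it is said to equal $v$ if this holds both with the inner limit read as a limit superior and with it read as a limit inferior. -/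

import Mathlib

open MeasureTheory ProbabilityTheory Filter Topology

noncomputable section

namespace ControlledARMA

/-- The parameters of a controlled ARMA(`p`, `q`) model other than the control coefficient `b`:
the intercept `μ`, the autoregressive coefficients (`a j` multiplies the lag `j + 1`) and the
moving-average coefficients `θ 0 = 1, θ 1, …, θ q`. -/
structure Params (p q : ℕ) where
  μ : ℝ
  a : Fin p → ℝ
  θ : Fin (q + 1) → ℝ
  θ_zero : θ 0 = 1

namespace Params

variable {p q : ℕ}

/-- The sum `a = a₁ + ⋯ + a_p` of the autoregressive coefficients. -/
def aSum (m : Params p q) : ℝ := ∑ j, m.a j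

/-- No unit root: all complex roots of `1 - ∑ a_j y^j` lie outside the unit circle. -/
def NoUnitRoot (m : Params p q) : Prop :=
  ∀ y : ℂ, 1 - ∑ j : Fin p, (m.a j : ℂ) * y ^ ((j : ℕ) + 1) = 0 → 1 < ‖y‖

/-- The residual `Z_t = ∑_{j=0}^q θ_j ε_{t-j}` along a noise path `e`. -/
def residual (m : Params p q) (e : ℤ → ℝ) (t : ℤ) : ℝ :=
  ∑ j : Fin (q + 1), m.θ j * e (t - (j : ℕ))

/-- The outcome path: `Y_t = μ + ∑ a_j Y_{t-j} + b U_t + Z_t` for `t ≥ 1`, with the pre-experiment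
values `Y_t = y0 t` for `t ≤ 0` (only `y0 0, …, y0 (1 - p)` are ever used). -/
def outcome (m : Params p q) (b : ℝ) (y0 u e : ℤ → ℝ) (t : ℤ) : ℝ :=
  if 0 < t then
    m.μ + ∑ j : Fin p, m.a j * outcome m b y0 u e (t - 1 - (j : ℕ)) + b * u t + m.residual e t
  else y0 t
termination_by t.toNat
decreasing_by omega

/-- The impulse response `ψ_n` of the ARMA filter: `ψ_n = θ_n + ∑_{j=1}^{min(n,p)} a_j ψ_{n-j}`,
where `θ_n = 0` for `n > q`. -/
def psi (m : Params p q) (n : ℕ) : ℝ :=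
  (if h : n < q + 1 then m.θ ⟨n, h⟩ else 0)
    + ∑ j : Fin p, if _h : (j : ℕ) < n then m.a j * psi m (n - 1 - (j : ℕ)) else 0
termination_by n
decreasing_by omega

/-- The autocovariance function `γ(k) = σ² ∑_n ψ_n ψ_{n+|k|}` of the stationary ARMA process with
noise variance `σ²`. -/
def autocov (m : Params p q) (σ : ℝ) (k : ℤ) : ℝ :=
  σ ^ 2 * ∑' n : ℕ, m.psi n * m.psi (n + k.natAbs)

/-- The `p × p` Yule–Walker matrix: its entries are the stationary covariances
of the instrument `Y_{t-q-1-i}` with the regressor `Y_{t-1-j}`. -/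
def yuleWalkerMatrix (m : Params p q) (σ : ℝ) : Matrix (Fin p) (Fin p) ℝ :=
  Matrix.of fun i j => m.autocov σ ((q : ℤ) + (i : ℕ) - (j : ℕ))

end Params

section Estimator

variable (p q : ℕ)

/-- The regressors `(U_t, 1, Y_{t-1}, …, Y_{t-p})`, whose coefficients are `(b, μ, a₁, …, a_p)`. -/
def regressor (y u : ℤ → ℝ) (t : ℤ) : Fin 2 ⊕ Fin p → ℝ :=
  Sum.elim ![u t, 1] fun j => y (t - 1 - (j : ℕ))

/-- The instruments `(U_t, 1, Y_{t-q-1}, …, Y_{t-q-p})`. -/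
def instrument (y u : ℤ → ℝ) (t : ℤ) : Fin 2 ⊕ Fin p → ℝ :=
  Sum.elim ![u t, 1] fun j => y (t - q - 1 - (j : ℕ))

/-- Sample moment `1/(T-p-q) ∑_{t=p+q+1}^T f t`. -/
def sampleMoment (T : ℕ) (f : ℤ → ℝ) : ℝ :=
  ((T : ℝ) - p - q)⁻¹ * ∑ t ∈ Finset.Icc ((p : ℤ) + q + 1) T, f t

/-- Matrix of the `p + 2` sample estimating equations. -/
def momentMatrix (T : ℕ) (y u : ℤ → ℝ) : Matrix (Fin 2 ⊕ Fin p) (Fin 2 ⊕ Fin p) ℝ :=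
  Matrix.of fun i j => sampleMoment p q T fun t => instrument p q y u t i * regressor p y u t j

/-- Left-hand sides of the `p + 2` sample estimating equations. -/
def momentVector (T : ℕ) (y u : ℤ → ℝ) : Fin 2 ⊕ Fin p → ℝ :=
  fun i => sampleMoment p q T fun t => instrument p q y u t i * y t

/-- The Yule–Walker estimator of `(b, μ, a₁, …, a_p)`: the solution of the sample estimating
equations (set to zero if these do not have a unique solution). -/
def yuleWalker (T : ℕ) (y u : ℤ → ℝ) : Fin 2 ⊕ Fin p → ℝ :=
  Matrix.mulVec (momentMatrix p q T y u)⁻¹ (momentVector p q T y u)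

/-- The estimator `2 b̂ / (1 - ∑ â_j)` of the average treatment effect. -/
def ateEstimator (T : ℕ) (y u : ℤ → ℝ) : ℝ :=
  2 * yuleWalker p q T y u (Sum.inl 0) / (1 - ∑ j : Fin p, yuleWalker p q T y u (Sum.inr j))

end Estimator

/-- An observation-agnostic design: `prob t h` is the probability of `U_{t+1} = 1` given the
treatment history `(U_1, …, U_t) = h`. -/
structure Design where
  prob : (t : ℕ) → (Fin t → ℝ) → ℝ
  prob_mem : ∀ t h, prob t h ∈ Set.Icc (0 : ℝ) 1

section Probability

variable {Ω : Type*} [MeasurableSpace Ω]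

/-- `ε` is a sequence of i.i.d. random variables with mean zero and variance `σ²`. -/
structure IsWhiteNoise (P : Measure Ω) (σ : ℝ) (ε : ℤ → Ω → ℝ) : Prop where
  measurable : ∀ t, Measurable (ε t)
  indep : iIndepFun ε P
  identDistrib : ∀ t, IdentDistrib (ε t) (ε 0) P P
  memLp : ∀ t, MemLp (ε t) 2 P
  mean_zero : ∀ t, ∫ ω, ε t ω ∂P = 0
  variance_eq : ∀ t, variance (ε t) P = σ ^ 2

/-- The treatments `U_1, U_2, …`, with values in `{-1, 1}`, are generated by the observation-agnostic
design `π`: each `U_{t+1}` is drawn from `π` given the previous treatments only, the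
randomization being independent of the noise and of the pre-experiment outcomes. -/
structure IsGeneratedBy (P : Measure Ω) (π : Design) (U ε y0 : ℤ → Ω → ℝ) : Prop where
  measurable : ∀ t, 1 ≤ t → Measurable (U t)
  values : ∀ t, 1 ≤ t → ∀ ω, U t ω = 1 ∨ U t ω = -1
  law : ∀ (t : ℕ) (h : Fin t → ℝ),
    P.real {ω | (∀ i : Fin t, U ((i : ℕ) + 1) ω = h i) ∧ U ((t : ℤ) + 1) ω = 1}
      = π.prob t h * P.real {ω | ∀ i : Fin t, U ((i : ℕ) + 1) ω = h i}
  indep : IndepFun (fun ω (n : ℕ) => U ((n : ℤ) + 1) ω)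
    (fun ω => ((fun t : ℤ => ε t ω), (fun t : ℤ => y0 t ω))) P

/-- The expected average outcome `E_c[T⁻¹ ∑_{t=1}^T Y_t]` when the treatment is always `c`. -/
def expectedAverage {p q : ℕ} (P : Measure Ω) (m : Params p q) (b : ℝ) (ε y0 : ℤ → Ω → ℝ)
    (c : ℝ) (T : ℕ) : ℝ :=
  ∫ ω, (T : ℝ)⁻¹ * ∑ t ∈ Finset.Icc (1 : ℤ) T,
    m.outcome b (fun s => y0 s ω) (fun _ => c) (fun s => ε s ω) t ∂P

/-- `τ` is the average treatment effect: the difference of the limits of the expected average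
outcomes under permanent treatment and under permanent control. -/
def IsATE {p q : ℕ} (P : Measure Ω) (m : Params p q) (b : ℝ) (ε y0 : ℤ → Ω → ℝ) (τ : ℝ) : Prop :=
  ∃ l₁ l₂ : ℝ, Tendsto (expectedAverage P m b ε y0 1) atTop (𝓝 l₁) ∧
    Tendsto (expectedAverage P m b ε y0 (-1)) atTop (𝓝 l₂) ∧ τ = l₁ - l₂

/-- The random outcome path `ω ↦ Y(ω)` observed in the experiment. -/
def observed {p q : ℕ} (m : Params p q) (b : ℝ) (y0 U ε : ℤ → Ω → ℝ) (ω : Ω) : ℤ → ℝ :=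
  m.outcome b (fun s => y0 s ω) (fun s => U s ω) (fun s => ε s ω)

/-- The normalized estimation error `√T (ATE-hat - τ)` after `T` periods. -/
def scaledError {p q : ℕ} (m : Params p q) (b τ : ℝ) (y0 U ε : ℤ → Ω → ℝ) (T : ℕ) (ω : Ω) : ℝ :=
  √(T : ℝ) * (ateEstimator p q T (observed m b y0 U ε ω) (fun s => U s ω) - τ)

/-- The family of errors `X i` has asymptotic mean squared error `v` along the filter `l`:
`lim_{K → ∞} lim_i E[min(X_i², K)] = v`, where the inner limit is to be read both as a limit
inferior and as a limit superior. (The truncation is the usual one for asymptotic risks: the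
untruncated second moment of a ratio estimator is infinite in general for every finite sample.) -/
def HasAsymptoticMSE {ι : Type*} (P : Measure Ω) (l : Filter ι) (X : ι → Ω → ℝ) (v : ℝ) : Prop :=
  ∀ δ : ℝ, 0 < δ → ∀ᶠ K : ℝ in atTop, ∀ᶠ i in l, |∫ ω, min (X i ω ^ 2) K ∂P - v| < δ

/-- `4 / ((1-a)² (1-ξ²)² T) · Var[∑_{t=1}^T (U_t - ξ) Z_t]`. -/
def normalizedVariance {p q : ℕ} (P : Measure Ω) (m : Params p q) (ξ : ℝ) (U ε : ℤ → Ω → ℝ)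
    (T : ℕ) : ℝ :=
  4 / ((1 - m.aSum) ^ 2 * (1 - ξ ^ 2) ^ 2 * T) *
    variance (fun ω => ∑ t ∈ Finset.Icc (1 : ℤ) T,
      (U t ω - ξ) * m.residual (fun s => ε s ω) t) P

end Probability

end ControlledARMA

end

/-!
The outcome has the explicit form `Y_t = mean + X_t + b * E_t + transient`, where `X` is the ARMA
noise obtained by filtering the noise with the impulse response `ψ`, `E` is the bounded effect of
the treatments, and the transient caused by the initial values has a summable profile
(`Params.outcome_eq`, `Params.abs_transient_le`). All this rests on the absolute summability of
`ψ` (`Params.summable_abs_psi`), which follows from factoring the autoregressive polynomial over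
`ℂ`. In particular the expected average outcome under the permanent treatment `c` converges to
`(μ + b * c) / (1 - a)`, so the average treatment effect is `2 * b / (1 - a)` and vanishes exactly
when `b` does (`isATE`).

Along any filter with `T → ∞` and `b → 0`, the moment matrix of the estimating equations converges
in probability to `ν νᵀ + diag(1 - ξ², 0, Γ)` with `ν = (ξ, 1, mean, …, mean)` and `Γ` the
Yule–Walker matrix (`tendsto_momentMatrix`). This combines the law of large numbers for the sample
autocovariances of `X` (`tendsto_sampleMoment_armaNoise`: `L¹` convergence of the sample moments of
the noise and dominated convergence in the double series over `ψ`), the orthogonality of noise and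
treatments, and the negligibility of `b * E` and of the transient. The limit is nonsingular, and
its first row minus `ξ` times its second row is `1 - ξ²` times the first unit vector.

The estimating equations evaluated at the true parameters (`score`) are of order `T^{-1/2}`, since
each instrument is, up to the transient, a function of the treatments and of the noise older than
the residual it multiplies; the sums `∑ V_t ε_{t-k}` with `V_t` depending on the treatments and on
the older noise have orthogonal terms (`integral_sq_weighted_sum`). Inverting the limiting
matrix shows that `√T (ATE-hat - ATE)` differs by a term vanishing in probability from
`T^{-1/2} ∑_{t ≤ T} 2 / ((1 - a)(1 - ξ²)) (U_t - ξ) Z_t` (`tendsto_scaledError_sub_leadingTerm`).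
The errors of the autoregressive coefficients enter only multiplied by `b` or by `T^{-1/2}`.

The second moment of this leading term is exactly the normalized variance
(`integral_sq_leadingTerm`). Its squares are uniformly integrable, because after truncating the
noise the sums have bounded fourth moments (`uniformlySqIntegrable_weighted_residual`); and for a
sequence with uniformly integrable squares the truncated mean squared error of anything
asymptotically equivalent to it has a limit exactly when its second moments do
(`hasAsymptoticMSE_iff_tendsto`).
-/

noncomputable section

namespace ControlledARMA

/-! ### Absolute summability of the impulse response -/

/-- If every element of `s` lies outside the closed unit disc, then `∏_{r ∈ s} (X - r)` has an
inverse power series with absolutely summable coefficients: each factor contributes a geometric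
series of ratio `1 / r`. -/
theorem exists_summable_inverse_prod (s : Multiset ℂ) (hs : ∀ r ∈ s, 1 < ‖r‖) :
    ∃ g : PowerSeries ℂ, (Summable fun n => ‖g.coeff n‖) ∧
      (((s.map fun r => Polynomial.X - Polynomial.C r).prod : Polynomial ℂ) : PowerSeries ℂ) * g
        = 1 := by
  induction s using Multiset.induction_on with
  | empty =>
    refine ⟨1, ?_, by simp⟩
    refine summable_of_ne_finset_zero (s := {0}) fun n hn => ?_
    simp only [Finset.mem_singleton] at hn
    simp [PowerSeries.coeff_one, hn]
  | cons r s ih =>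
    obtain ⟨g, hg, hg1⟩ := ih fun x hx => hs x (Multiset.mem_cons_of_mem hx)
    have hr : 1 < ‖r‖ := hs r (Multiset.mem_cons_self r s)
    have hr0 : r ≠ 0 := by
      intro h
      simp only [h, norm_zero] at hr
      linarith
    set k : PowerSeries ℂ := PowerSeries.mk fun n => -(r⁻¹) ^ (n + 1) with hk
    have hk1 : ((Polynomial.X - Polynomial.C r : Polynomial ℂ) : PowerSeries ℂ) * k = 1 := by
      ext n
      rw [Polynomial.coe_sub, Polynomial.coe_X, Polynomial.coe_C, sub_mul, map_sub,
        PowerSeries.coeff_C_mul]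
      cases n with
      | zero => simp [hk, hr0]
      | succ n =>
        rw [PowerSeries.coeff_succ_X_mul]
        simp only [hk, PowerSeries.coeff_mk, PowerSeries.coeff_one]
        rw [if_neg (by omega), pow_succ (r⁻¹) (n + 1)]
        field_simp
        ring
    refine ⟨k * g, ?_, ?_⟩
    · have hks : Summable fun n => ‖k.coeff n‖ := by
        simp only [hk, PowerSeries.coeff_mk, norm_neg, norm_pow, norm_inv]
        exact (summable_nat_add_iff (f := fun n => ‖r‖⁻¹ ^ n) 1).2
          (summable_geometric_of_lt_one (by positivity) (inv_lt_one_of_one_lt₀ hr))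
      exact (summable_norm_sum_mul_antidiagonal_of_summable_norm
        (f := fun n => k.coeff n) (g := fun n => g.coeff n) hks hg).congr
        fun n => by rw [PowerSeries.coeff_mul]
    · rw [Multiset.map_cons, Multiset.prod_cons, Polynomial.coe_mul]
      generalize (((s.map fun r => Polynomial.X - Polynomial.C r).prod : Polynomial ℂ) :
        PowerSeries ℂ) = A at hg1 ⊢
      rw [mul_mul_mul_comm, hk1, hg1, one_mul]

namespace Params

variable {p q : ℕ}

/-- The autoregressive polynomial `1 - ∑ a_j X^j`. -/
def arPoly (m : Params p q) : Polynomial ℂ :=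
  1 - ∑ j : Fin p, Polynomial.C (m.a j : ℂ) * Polynomial.X ^ ((j : ℕ) + 1)

/-- The moving-average polynomial `∑ θ_j X^j`. -/
def maPoly (m : Params p q) : Polynomial ℂ :=
  ∑ j : Fin (q + 1), Polynomial.C (m.θ j : ℂ) * Polynomial.X ^ (j : ℕ)

theorem maPoly_coeff (m : Params p q) (n : ℕ) :
    m.maPoly.coeff n = if h : n < q + 1 then (m.θ ⟨n, h⟩ : ℂ) else 0 := by
  simp only [maPoly, Polynomial.finsetSum_coeff, Polynomial.coeff_C_mul, Polynomial.coeff_X_pow]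
  split_ifs with h
  · rw [Finset.sum_eq_single ⟨n, h⟩]
    · simp
    · intro j _ hj
      have : n ≠ j := fun h' => hj (Fin.ext h'.symm)
      simp [this]
    · simp
  · refine Finset.sum_eq_zero fun j _ => ?_
    have : n ≠ j := by
      have := j.2
      omega
    simp [this]

/-- The recursion defining `ψ`, as the identity `(1 - ∑ a_j X^j) ψ(X) = θ(X)`. -/
theorem arPoly_mul_psi (m : Params p q) :
    (m.arPoly : PowerSeries ℂ) * PowerSeries.mk (fun n => (m.psi n : ℂ)) = m.maPoly := by
  ext n
  rw [Polynomial.coeff_coe, maPoly_coeff]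
  have h1 : (m.arPoly : PowerSeries ℂ) = 1 - ∑ j : Fin p,
      PowerSeries.C (m.a j : ℂ) * PowerSeries.X ^ ((j : ℕ) + 1) := by
    rw [arPoly, Polynomial.coe_sub, Polynomial.coe_one]
    congr 1
    have := map_sum (Polynomial.coeToPowerSeries.ringHom (R := ℂ))
      (fun j : Fin p => Polynomial.C (m.a j : ℂ) * Polynomial.X ^ ((j : ℕ) + 1)) Finset.univ
    simpa only [Polynomial.coeToPowerSeries.ringHom_apply, Polynomial.coe_mul, Polynomial.coe_C,
      Polynomial.coe_pow, Polynomial.coe_X] using this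
  rw [h1, sub_mul, one_mul, map_sub, Finset.sum_mul, map_sum, PowerSeries.coeff_mk, psi]
  have h2 : ∀ j : Fin p, PowerSeries.coeff n (PowerSeries.C (m.a j : ℂ) *
      PowerSeries.X ^ ((j : ℕ) + 1) * PowerSeries.mk (fun n => (m.psi n : ℂ)))
      = ((if _h : (j : ℕ) < n then m.a j * m.psi (n - 1 - (j : ℕ)) else 0 : ℝ) : ℂ) := by
    intro j
    rw [mul_assoc, PowerSeries.coeff_C_mul, PowerSeries.coeff_X_pow_mul', PowerSeries.coeff_mk]
    by_cases h : (j : ℕ) < n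
    · have : n - ((j : ℕ) + 1) = n - 1 - (j : ℕ) := by omega
      simp [h, Nat.succ_le_of_lt h, this]
    · have : ¬ ((j : ℕ) + 1 ≤ n) := by omega
      simp [h, this]
  simp only [h2]
  push_cast
  split_ifs <;> simp

theorem arPoly_eval (m : Params p q) (y : ℂ) :
    m.arPoly.eval y = 1 - ∑ j : Fin p, (m.a j : ℂ) * y ^ ((j : ℕ) + 1) := by
  simp [arPoly, Polynomial.eval_finsetSum]

/-- Without unit roots, `ψ = θ(X) / (1 - ∑ a_j X^j)` is absolutely summable, because the
reciprocal of the autoregressive polynomial is. -/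
theorem summable_abs_psi (m : Params p q) (hroot : m.NoUnitRoot) :
    Summable fun n => |m.psi n| := by
  have hne : m.arPoly ≠ 0 := by
    intro h
    have h1 := m.arPoly_eval 0
    rw [h] at h1
    simp at h1
  obtain ⟨g, hg, hg1⟩ := exists_summable_inverse_prod m.arPoly.roots (by
    intro r hr
    refine hroot r ?_
    rw [← arPoly_eval]
    exact (Polynomial.mem_roots hne).1 hr)
  set c := m.arPoly.leadingCoeff with hc
  have hc0 : c ≠ 0 := Polynomial.leadingCoeff_ne_zero.2 hne
  have hfac : (m.arPoly : PowerSeries ℂ) = PowerSeries.C c *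
      (((m.arPoly.roots.map fun r => Polynomial.X - Polynomial.C r).prod : Polynomial ℂ) :
        PowerSeries ℂ) := by
    rw [← Polynomial.coe_C, ← Polynomial.coe_mul,
      ← (IsAlgClosed.splits m.arPoly).eq_prod_roots]
  have hpsi : PowerSeries.mk (fun n => (m.psi n : ℂ)) =
      (m.maPoly : PowerSeries ℂ) * (PowerSeries.C c⁻¹ * g) := by
    rw [← arPoly_mul_psi, hfac]
    have : PowerSeries.C c * PowerSeries.C c⁻¹ = (1 : PowerSeries ℂ) := by
      rw [← map_mul, mul_inv_cancel₀ hc0, map_one]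
    generalize (((m.arPoly.roots.map fun r => Polynomial.X - Polynomial.C r).prod :
      Polynomial ℂ) : PowerSeries ℂ) = A at hg1 ⊢
    rw [mul_right_comm, mul_mul_mul_comm, this, hg1, one_mul, one_mul]
  have hsum : Summable fun n =>
      ‖((m.maPoly : PowerSeries ℂ) * (PowerSeries.C c⁻¹ * g)).coeff n‖ := by
    refine (summable_norm_sum_mul_antidiagonal_of_summable_norm
      (f := fun n => (m.maPoly : PowerSeries ℂ).coeff n)
      (g := fun n => (PowerSeries.C c⁻¹ * g).coeff n) ?_ ?_).congr
      fun n => by rw [PowerSeries.coeff_mul]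
    · refine summable_of_ne_finset_zero (s := Finset.range (q + 1)) fun n hn => ?_
      rw [Finset.mem_range] at hn
      rw [Polynomial.coeff_coe, maPoly_coeff, dif_neg hn, norm_zero]
    · simp only [PowerSeries.coeff_C_mul, norm_mul]
      exact hg.mul_left _
  rw [← hpsi] at hsum
  simpa [PowerSeries.coeff_mk] using hsum

theorem one_sub_aSum_ne_zero (m : Params p q) (hroot : m.NoUnitRoot) : 1 - m.aSum ≠ 0 := by
  intro h
  have h1 : (1 : ℂ) - ∑ j : Fin p, (m.a j : ℂ) * 1 ^ ((j : ℕ) + 1) = 0 := by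
    simp only [one_pow, mul_one]
    exact_mod_cast h
  simpa using hroot 1 h1

end Params

/-! ### Decomposition of the outcome path -/

/-- The sum `∑_{n < t + c} k_n e_{t-n}`: the filter with impulse response `k` applied to the part
of the path `e` after time `-c`. -/
def filt (k : ℕ → ℝ) (c : ℤ) (e : ℤ → ℝ) (t : ℤ) : ℝ :=
  ∑ n ∈ Finset.range (t + c).toNat, k n * e (t - n)

theorem filt_of_nonpos (k : ℕ → ℝ) {c t : ℤ} (h : t + c ≤ 0)
    (e : ℤ → ℝ) : filt k c e t = 0 := by
  simp [filt, Int.toNat_of_nonpos h]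

namespace Params

variable {p q : ℕ}

/-- Filtering by `ψ` solves the ARMA recursion as soon as the residual involves no value of the
path at or before time `-c`. -/
theorem filt_psi_eq (m : Params p q) (c : ℤ) (e : ℤ → ℝ) (t : ℤ) (h : (q : ℤ) < t + c) :
    filt m.psi c e t =
      ∑ j : Fin p, m.a j * filt m.psi c e (t - 1 - (j : ℕ)) + m.residual e t := by
  have hlen : q + 1 ≤ (t + c).toNat := by omega
  have h1 : filt m.psi c e t = ∑ n ∈ Finset.range (t + c).toNat,
        (if h : n < q + 1 then m.θ ⟨n, h⟩ else 0) * e (t - n) +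
      ∑ n ∈ Finset.range (t + c).toNat, ∑ j : Fin p,
        (if _h : (j : ℕ) < n then m.a j * m.psi (n - 1 - (j : ℕ)) else 0) * e (t - n) := by
    rw [filt, ← Finset.sum_add_distrib]
    refine Finset.sum_congr rfl fun n _ => ?_
    rw [psi, add_mul, Finset.sum_mul]
  have h2 : ∑ n ∈ Finset.range (t + c).toNat,
        (if h : n < q + 1 then m.θ ⟨n, h⟩ else 0) * e (t - n) = m.residual e t := by
    rw [residual, Finset.sum_fin_eq_sum_range,
      ← Finset.sum_subset (Finset.range_mono hlen)]
    · refine Finset.sum_congr rfl fun n hn => ?_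
      rw [Finset.mem_range] at hn
      simp [hn]
    · intro n _ hn
      rw [Finset.mem_range] at hn
      simp [hn]
  have h3 : ∀ j : Fin p, ∑ n ∈ Finset.range (t + c).toNat,
        (if _h : (j : ℕ) < n then m.a j * m.psi (n - 1 - (j : ℕ)) else 0) * e (t - n)
      = m.a j * filt m.psi c e (t - 1 - (j : ℕ)) := by
    intro j
    rw [filt, Finset.mul_sum]
    by_cases hj : (j : ℕ) + 1 ≤ (t + c).toNat
    · have hL : (t + c).toNat = (j : ℕ) + 1 + (t - 1 - (j : ℕ) + c).toNat := by omega
      rw [hL, Finset.sum_range_add, Finset.sum_eq_zero, zero_add]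
      · refine Finset.sum_congr rfl fun n _ => ?_
        rw [dif_pos (by omega)]
        have e1 : (j : ℕ) + 1 + n - 1 - (j : ℕ) = n := by omega
        have e2 : t - (((j : ℕ) + 1 + n : ℕ) : ℤ) = t - 1 - (j : ℕ) - n := by
          push_cast
          ring
        rw [e1, e2, mul_assoc]
      · intro n hn
        rw [Finset.mem_range] at hn
        rw [dif_neg (by omega), zero_mul]
    · rw [Finset.sum_eq_zero, Finset.sum_eq_zero]
      · intro n hn
        rw [Finset.mem_range] at hn
        omega
      · intro n hn
        rw [Finset.mem_range] at hn
        rw [dif_neg (by omega), zero_mul]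
  rw [h1, h2, Finset.sum_comm, Finset.sum_congr rfl fun j _ => h3 j, add_comm]

/-- The purely autoregressive model with the same coefficients `a_j`; its `psi` is the impulse
response `φ` of `1 / (1 - ∑ a_j X^j)`. -/
def arModel (m : Params p q) : Params p 0 where
  μ := 0
  a := m.a
  θ := fun _ => 1
  θ_zero := rfl

/-- The impulse response of the autoregressive recursion. -/
def phi (m : Params p q) : ℕ → ℝ := m.arModel.psi

theorem summable_abs_phi (m : Params p q) (hroot : m.NoUnitRoot) :
    Summable fun n => |m.phi n| :=
  m.arModel.summable_abs_psi hroot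

theorem filt_phi_eq (m : Params p q) (e : ℤ → ℝ) (t : ℤ) (h : 0 < t) :
    filt m.phi 0 e t = ∑ j : Fin p, m.a j * filt m.phi 0 e (t - 1 - (j : ℕ)) + e t := by
  rw [phi, filt_psi_eq m.arModel 0 e t (by simpa using h)]
  simp [residual, arModel]

/-- The stationary mean of the outcome under zero control coefficient. -/
def mean (m : Params p q) : ℝ := m.μ / (1 - m.aSum)

/-- The deviation of the initial values from the stationary mean and the truncated ARMA noise. -/
def initialGap (m : Params p q) (y0 e : ℤ → ℝ) (t : ℤ) : ℝ :=
  y0 t - m.mean - filt m.psi q e t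

/-- The forcing term which the initial gap contributes to the recursion at times `1, …, p`. -/
def initialForcing (m : Params p q) (y0 e : ℤ → ℝ) (t : ℤ) : ℝ :=
  ∑ j : Fin p, if t - 1 - (j : ℕ) ≤ 0 then m.a j * m.initialGap y0 e (t - 1 - (j : ℕ)) else 0

/-- The contribution of the initial values to the outcome. -/
def transient (m : Params p q) (y0 e : ℤ → ℝ) (t : ℤ) : ℝ :=
  if 0 < t then filt m.phi 0 (m.initialForcing y0 e) t else m.initialGap y0 e t

theorem transient_eq (m : Params p q) (y0 e : ℤ → ℝ) (t : ℤ) (h : 0 < t) :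
    m.transient y0 e t = ∑ j : Fin p, m.a j * m.transient y0 e (t - 1 - (j : ℕ)) := by
  rw [transient, if_pos h, filt_phi_eq _ _ _ h, initialForcing, ← Finset.sum_add_distrib]
  refine Finset.sum_congr rfl fun j _ => ?_
  rw [transient]
  by_cases h1 : t - 1 - (j : ℕ) ≤ 0
  · rw [if_pos h1, if_neg (by omega), filt_of_nonpos m.phi (t := t - 1 - (j : ℕ)) (by omega)]
    ring
  · rw [if_neg h1, if_pos (by omega), add_zero]

/-- The outcome is the sum of the stationary mean, ARMA noise, the filtered treatments and a
transient. -/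
theorem outcome_eq (m : Params p q) (hroot : m.NoUnitRoot) (b : ℝ) (y0 u e : ℤ → ℝ) (t : ℤ) :
    m.outcome b y0 u e t =
      m.mean + filt m.psi q e t + b * filt m.phi 0 u t + m.transient y0 e t := by
  induction hn : t.toNat using Nat.strong_induction_on generalizing t with
  | _ n ih =>
    rw [outcome]
    split_ifs with h
    · have ih' : ∀ j : Fin p, m.outcome b y0 u e (t - 1 - (j : ℕ)) =
          m.mean + filt m.psi q e (t - 1 - (j : ℕ)) + b * filt m.phi 0 u (t - 1 - (j : ℕ))
            + m.transient y0 e (t - 1 - (j : ℕ)) := fun j =>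
        ih (t - 1 - (j : ℕ)).toNat (by omega) _ rfl
      rw [Finset.sum_congr rfl fun j _ => by rw [ih' j], filt_psi_eq m q e t (by omega),
        filt_phi_eq m u t h, transient_eq m y0 e t h]
      have hmean : m.μ + ∑ j : Fin p, m.a j * m.mean = m.mean := by
        rw [← Finset.sum_mul]
        have := m.one_sub_aSum_ne_zero hroot
        change m.μ + m.aSum * m.mean = m.mean
        rw [mean]
        field_simp
        ring
      conv_rhs => rw [← hmean]
      simp only [mul_add, Finset.sum_add_distrib, Finset.mul_sum]
      have : ∀ j : Fin p, m.a j * (b * filt m.phi 0 u (t - 1 - (j : ℕ))) =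
        b * (m.a j * filt m.phi 0 u (t - 1 - (j : ℕ))) := fun j => by ring
      simp only [this]
      ring
    · rw [transient, if_neg h, initialGap, filt_of_nonpos m.phi (by omega)]
      ring

/-- A summable majorant of the transient, up to a factor depending on the initial values. For
`t ≤ k` the truncated index is `0`, which only enlarges the majorant. -/
def decay (m : Params p q) (t : ℤ) : ℝ :=
  ∑ k ∈ Finset.range p, |m.phi (t - 1 - k).toNat|

/-- The size of the initial forcing. -/
def initialSize (m : Params p q) (y0 e : ℤ → ℝ) : ℝ :=
  ∑ k ∈ Finset.range p, |m.initialForcing y0 e (k + 1)|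

theorem decay_nonneg (m : Params p q) (t : ℤ) : 0 ≤ m.decay t :=
  Finset.sum_nonneg fun _ _ => abs_nonneg _

theorem initialSize_nonneg (m : Params p q) (y0 e : ℤ → ℝ) : 0 ≤ m.initialSize y0 e :=
  Finset.sum_nonneg fun _ _ => abs_nonneg _

theorem summable_decay (m : Params p q) (hroot : m.NoUnitRoot) :
    Summable fun t : ℕ => m.decay t := by
  refine summable_sum fun k _ => ?_
  rw [← summable_nat_add_iff (k + 1)]
  refine (m.summable_abs_phi hroot).congr fun n => ?_
  congr 2
  push_cast
  omega

/-- The initial forcing vanishes after time `p`, so the transient decays like `φ`. -/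
theorem abs_transient_le (m : Params p q) (y0 e : ℤ → ℝ) (t : ℤ) (h : 0 < t) :
    |m.transient y0 e t| ≤ m.initialSize y0 e * m.decay t := by
  have hzero : ∀ s : ℤ, (p : ℤ) < s → m.initialForcing y0 e s = 0 := by
    intro s hs
    refine Finset.sum_eq_zero fun j _ => if_neg ?_
    have := j.2
    omega
  rw [transient, if_pos h, filt]
  calc |∑ n ∈ Finset.range (t + 0).toNat, m.phi n * m.initialForcing y0 e (t - n)|
      ≤ ∑ n ∈ Finset.range (t + 0).toNat, |m.phi n| * |m.initialForcing y0 e (t - n)| := by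
        refine (Finset.abs_sum_le_sum_abs _ _).trans_eq ?_
        simp only [abs_mul]
    _ = ∑ k ∈ Finset.range t.toNat, |m.phi (t - 1 - k).toNat| *
          |m.initialForcing y0 e (k + 1)| := by
        rw [add_zero, ← Finset.sum_range_reflect]
        refine Finset.sum_congr rfl fun k hk => ?_
        rw [Finset.mem_range] at hk
        have e1 : t.toNat - 1 - k = (t - 1 - k).toNat := by omega
        have e2 : t - ((t - 1 - k).toNat : ℤ) = k + 1 := by omega
        rw [e1, e2]
    _ ≤ ∑ k ∈ Finset.range p, |m.phi (t - 1 - k).toNat| * |m.initialForcing y0 e (k + 1)| := by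
        have hsub : Finset.range t.toNat ⊆ Finset.range (max t.toNat p) :=
          Finset.range_mono (le_max_left _ _)
        refine (Finset.sum_le_sum_of_subset_of_nonneg hsub fun _ _ _ => by positivity).trans_eq ?_
        symm
        refine Finset.sum_subset (Finset.range_mono (le_max_right _ _)) fun k _ hk => ?_
        rw [Finset.mem_range] at hk
        rw [hzero _ (by omega), abs_zero, mul_zero]
    _ ≤ m.initialSize y0 e * m.decay t := by
        rw [initialSize, decay, Finset.mul_sum]
        refine Finset.sum_le_sum fun k hk => ?_
        rw [mul_comm]
        refine mul_le_mul_of_nonneg_right ?_ (abs_nonneg _)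
        exact Finset.single_le_sum (f := fun k : ℕ => |m.initialForcing y0 e (k + 1)|)
          (fun _ _ => abs_nonneg _) hk

end Params

/-! ### Stochastic order calculus -/

section Calculus

variable {Ω ι : Type*} [MeasurableSpace Ω] {P : Measure Ω} {l : Filter ι}

/-- Stochastic boundedness (tightness) of the family `X` along the filter `l`. -/
def BoundedInProb (P : Measure Ω) (l : Filter ι) (X : ι → Ω → ℝ) : Prop :=
  ∀ δ : ℝ, 0 < δ → ∃ M : ℝ, ∀ᶠ i in l, P.real {ω | M < |X i ω|} ≤ δ

theorem measureReal_abs_ge_le {X : Ω → ℝ} (hX : Integrable X P) {c : ℝ} (hc : 0 < c) :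
    P.real {ω | c ≤ |X ω|} ≤ (∫ ω, |X ω| ∂P) / c := by
  rw [le_div_iff₀ hc, mul_comm]
  exact mul_meas_ge_le_integral_of_nonneg (Eventually.of_forall fun _ => abs_nonneg _) hX.abs c

variable [IsProbabilityMeasure P]

theorem tendstoInMeasure_iff_eventually {X : ι → Ω → ℝ} {Y : Ω → ℝ} :
    TendstoInMeasure P X l Y ↔
      ∀ c : ℝ, 0 < c → ∀ δ : ℝ, 0 < δ → ∀ᶠ i in l, P.real {ω | c ≤ |X i ω - Y ω|} ≤ δ := by
  rw [tendstoInMeasure_iff_measureReal_norm]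
  simp only [Real.norm_eq_abs]
  refine forall₂_congr fun c hc => ⟨fun h δ hδ => ?_, fun h => ?_⟩
  · exact (h.eventually (gt_mem_nhds hδ)).mono fun i hi => le_of_lt hi
  · rw [tendsto_order]
    refine ⟨fun a ha => Eventually.of_forall fun i => ha.trans_le measureReal_nonneg,
      fun a ha => ?_⟩
    exact (h (a / 2) (by positivity)).mono fun i hi => hi.trans_lt (by linarith)

/-- The continuous mapping theorem for convergence in probability to a constant vector. -/
theorem tendstoInMeasure_continuousAt {α : Type*} [Fintype α] {X : α → ι → Ω → ℝ} {x : α → ℝ}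
    (hX : ∀ a, TendstoInMeasure P (X a) l fun _ => x a) {F : (α → ℝ) → ℝ}
    (hF : ContinuousAt F x) :
    TendstoInMeasure P (fun i ω => F fun a => X a i ω) l fun _ => F x := by
  rw [tendstoInMeasure_iff_eventually]
  intro c hc δ hδ
  obtain ⟨η, hη, hη1⟩ := Metric.continuousAt_iff.1 hF c hc
  set n : ℝ := Fintype.card α + 1 with hn
  have hn0 : 0 < n := by positivity
  have hev : ∀ᶠ i in l, ∀ a, P.real {ω | η ≤ |X a i ω - x a|} ≤ δ / n := by
    rw [eventually_all]
    intro a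
    exact tendstoInMeasure_iff_eventually.1 (hX a) η hη _ (by positivity)
  refine hev.mono fun i hi => ?_
  have hsub : {ω | c ≤ |F (fun a => X a i ω) - F x|} ⊆ ⋃ a, {ω | η ≤ |X a i ω - x a|} := by
    intro ω hω
    by_contra hcon
    simp only [Set.mem_iUnion, Set.mem_ofPred_eq, not_exists, not_le] at hcon hω
    have hd : dist (fun a => X a i ω) x < η :=
      (dist_pi_lt_iff hη).2 fun a => by rw [Real.dist_eq]; exact hcon a
    have := hη1 hd
    rw [Real.dist_eq] at this
    linarith
  calc P.real {ω | c ≤ |F (fun a => X a i ω) - F x|}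
      ≤ P.real (⋃ a, {ω | η ≤ |X a i ω - x a|}) := measureReal_mono hsub
    _ ≤ ∑ a, P.real {ω | η ≤ |X a i ω - x a|} := measureReal_iUnion_fintype_le _
    _ ≤ ∑ _a : α, δ / n := Finset.sum_le_sum fun a _ => hi a
    _ ≤ δ := by
        rw [Finset.sum_const, nsmul_eq_mul, Finset.card_univ, ← mul_div_assoc, div_le_iff₀ hn0,
          hn]
        nlinarith

theorem _root_.MeasureTheory.TendstoInMeasure.comp₂ {X Y : ι → Ω → ℝ} {x y : ℝ}
    (hX : TendstoInMeasure P X l fun _ => x) (hY : TendstoInMeasure P Y l fun _ => y)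
    {F : ℝ → ℝ → ℝ} (hF : ContinuousAt (fun z : ℝ × ℝ => F z.1 z.2) (x, y)) :
    TendstoInMeasure P (fun i ω => F (X i ω) (Y i ω)) l fun _ => F x y := by
  have := tendstoInMeasure_continuousAt (P := P) (l := l) (X := ![X, Y]) (x := ![x, y])
    (fun a => by fin_cases a <;> simpa) (F := fun v => F (v 0) (v 1)) (by
      have h1 : ContinuousAt (fun v : Fin 2 → ℝ => (v 0, v 1)) ![x, y] := by fun_prop
      exact ContinuousAt.comp (g := fun z : ℝ × ℝ => F z.1 z.2)
        (f := fun v : Fin 2 → ℝ => (v 0, v 1)) (by simpa using hF) h1)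
  simpa using this

theorem _root_.MeasureTheory.TendstoInMeasure.add_const_limits {X Y : ι → Ω → ℝ} {x y : ℝ}
    (hX : TendstoInMeasure P X l fun _ => x) (hY : TendstoInMeasure P Y l fun _ => y) :
    TendstoInMeasure P (fun i ω => X i ω + Y i ω) l fun _ => x + y :=
  MeasureTheory.TendstoInMeasure.comp₂ hX hY (F := fun a b => a + b) (by fun_prop)

theorem _root_.MeasureTheory.TendstoInMeasure.mul_const_limits {X Y : ι → Ω → ℝ} {x y : ℝ}
    (hX : TendstoInMeasure P X l fun _ => x) (hY : TendstoInMeasure P Y l fun _ => y) :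
    TendstoInMeasure P (fun i ω => X i ω * Y i ω) l fun _ => x * y :=
  MeasureTheory.TendstoInMeasure.comp₂ hX hY (F := fun a b => a * b) (by fun_prop)

theorem tendstoInMeasure_of_tendsto_real {x : ι → ℝ} {c : ℝ} (h : Tendsto x l (𝓝 c)) :
    TendstoInMeasure P (fun i _ => x i) l fun _ => c := by
  rw [tendstoInMeasure_iff_eventually]
  intro r hr δ hδ
  refine (Metric.tendsto_nhds.1 h r hr).mono fun i hi => ?_
  rw [Real.dist_eq] at hi
  have : {ω : Ω | r ≤ |x i - c|} = ∅ := by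
    ext ω
    simpa using hi
  rw [this]
  simpa using hδ.le

theorem _root_.MeasureTheory.TendstoInMeasure.const_mul_zero {X : ι → Ω → ℝ} (a : ℝ)
    (hX : TendstoInMeasure P X l fun _ => 0) :
    TendstoInMeasure P (fun i ω => a * X i ω) l fun _ => 0 := by
  simpa using (tendstoInMeasure_of_tendsto_real (tendsto_const_nhds (x := a))).mul_const_limits hX

theorem _root_.MeasureTheory.TendstoInMeasure.add_zero_limits {X Y : ι → Ω → ℝ}
    (hX : TendstoInMeasure P X l fun _ => 0) (hY : TendstoInMeasure P Y l fun _ => 0) :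
    TendstoInMeasure P (fun i ω => X i ω + Y i ω) l fun _ => 0 := by
  simpa using hX.add_const_limits hY

theorem _root_.MeasureTheory.TendstoInMeasure.sum_zero_limits {α : Type*} {s : Finset α}
    {X : α → ι → Ω → ℝ}
    (hX : ∀ a ∈ s, TendstoInMeasure P (X a) l fun _ => 0) :
    TendstoInMeasure P (fun i ω => ∑ a ∈ s, X a i ω) l fun _ => 0 := by
  classical
  induction s using Finset.induction_on with
  | empty => simpa using tendstoInMeasure_of_tendsto_real (tendsto_const_nhds (x := (0 : ℝ)))
  | insert a s ha ih =>
    simp only [Finset.sum_insert ha]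
    exact (hX a (Finset.mem_insert_self a s)).add_zero_limits
      (ih fun x hx => hX x (Finset.mem_insert_of_mem hx))

theorem tendstoInMeasure_zero_of_abs_le {X Y : ι → Ω → ℝ}
    (hY : TendstoInMeasure P Y l fun _ => 0) (h : ∀ᶠ i in l, ∀ ω, |X i ω| ≤ |Y i ω|) :
    TendstoInMeasure P X l fun _ => 0 := by
  rw [tendstoInMeasure_iff_eventually] at hY ⊢
  intro c hc δ hδ
  filter_upwards [hY c hc δ hδ, h] with i hi hXY
  refine (measureReal_mono fun ω hω => ?_).trans hi
  simp only [sub_zero, Set.mem_ofPred_eq] at hω ⊢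
  exact hω.trans (hXY ω)

/-- Convergence in probability is not affected on events of vanishing probability. -/
theorem _root_.MeasureTheory.TendstoInMeasure.congr_of_event {X Y : ι → Ω → ℝ} {Z : Ω → ℝ}
    (hY : TendstoInMeasure P Y l Z) {B : ι → Set Ω}
    (hB : Tendsto (fun i => P.real (B i)) l (𝓝 0))
    (h : ∀ᶠ i in l, ∀ ω, ω ∉ B i → X i ω = Y i ω) :
    TendstoInMeasure P X l Z := by
  rw [tendstoInMeasure_iff_eventually] at hY ⊢
  intro c hc δ hδ
  filter_upwards [hY c hc (δ / 2) (by positivity), h,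
    hB.eventually (gt_mem_nhds (half_pos hδ))] with i hi hXY hBi
  calc P.real {ω | c ≤ |X i ω - Z ω|} ≤ P.real (B i ∪ {ω | c ≤ |Y i ω - Z ω|}) := by
        refine measureReal_mono fun ω hω => ?_
        by_cases hωB : ω ∈ B i
        · exact Or.inl hωB
        · right
          simpa [← hXY ω hωB] using hω
    _ ≤ P.real (B i) + P.real {ω | c ≤ |Y i ω - Z ω|} := measureReal_union_le _ _
    _ ≤ δ := by linarith

theorem _root_.MeasureTheory.TendstoInMeasure.boundedInProb {X : ι → Ω → ℝ} {x : ℝ}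
    (hX : TendstoInMeasure P X l fun _ => x) : BoundedInProb P l X := by
  intro δ hδ
  refine ⟨|x| + 1, (tendstoInMeasure_iff_eventually.1 hX 1 one_pos δ hδ).mono fun i hi => ?_⟩
  refine (measureReal_mono fun ω hω => ?_).trans hi
  simp only [Set.mem_ofPred_eq] at hω ⊢
  have := abs_sub_abs_le_abs_sub (X i ω) x
  linarith

theorem BoundedInProb.of_abs_le {X Y : ι → Ω → ℝ} (hY : BoundedInProb P l Y)
    (h : ∀ᶠ i in l, ∀ ω, |X i ω| ≤ |Y i ω|) : BoundedInProb P l X := by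
  intro δ hδ
  obtain ⟨M, hM⟩ := hY δ hδ
  refine ⟨M, ?_⟩
  filter_upwards [hM, h] with i hi hXY
  refine (measureReal_mono fun ω hω => ?_).trans hi
  exact lt_of_lt_of_le hω (hXY ω)

theorem BoundedInProb.add {X Y : ι → Ω → ℝ} (hX : BoundedInProb P l X)
    (hY : BoundedInProb P l Y) : BoundedInProb P l fun i ω => X i ω + Y i ω := by
  intro δ hδ
  obtain ⟨M, hM⟩ := hX (δ / 2) (half_pos hδ)
  obtain ⟨N, hN⟩ := hY (δ / 2) (half_pos hδ)
  refine ⟨M + N, ?_⟩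
  filter_upwards [hM, hN] with i hi hi'
  calc P.real {ω | M + N < |X i ω + Y i ω|}
      ≤ P.real ({ω | M < |X i ω|} ∪ {ω | N < |Y i ω|}) := by
        refine measureReal_mono fun ω hω => ?_
        by_contra hcon
        simp only [Set.mem_union, Set.mem_ofPred_eq, not_or, not_lt] at hcon hω
        have := abs_add_le (X i ω) (Y i ω)
        linarith [hcon.1, hcon.2]
    _ ≤ _ := measureReal_union_le _ _
    _ ≤ δ := by linarith

theorem BoundedInProb.mul {X Y : ι → Ω → ℝ} (hX : BoundedInProb P l X)
    (hY : BoundedInProb P l Y) : BoundedInProb P l fun i ω => X i ω * Y i ω := by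
  intro δ hδ
  obtain ⟨M, hM⟩ := hX (δ / 2) (half_pos hδ)
  obtain ⟨N, hN⟩ := hY (δ / 2) (half_pos hδ)
  refine ⟨|M| * |N|, ?_⟩
  filter_upwards [hM, hN] with i hi hi'
  calc P.real {ω | |M| * |N| < |X i ω * Y i ω|}
      ≤ P.real ({ω | M < |X i ω|} ∪ {ω | N < |Y i ω|}) := by
        refine measureReal_mono fun ω hω => ?_
        by_contra hcon
        simp only [Set.mem_union, Set.mem_ofPred_eq, not_or, not_lt] at hcon hω
        rw [abs_mul] at hω
        have := mul_le_mul (hcon.1.trans (le_abs_self M)) (hcon.2.trans (le_abs_self N))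
          (abs_nonneg _) (abs_nonneg _)
        linarith
    _ ≤ _ := measureReal_union_le _ _
    _ ≤ δ := by linarith

theorem BoundedInProb.sum {α : Type*} {s : Finset α} {X : α → ι → Ω → ℝ}
    (hX : ∀ a ∈ s, BoundedInProb P l (X a)) :
    BoundedInProb P l fun i ω => ∑ a ∈ s, X a i ω := by
  classical
  induction s using Finset.induction_on with
  | empty =>
    simpa using
      (tendstoInMeasure_of_tendsto_real (P := P) (l := l)
        (tendsto_const_nhds (x := (0 : ℝ)))).boundedInProb
  | insert a s ha ih =>
    simp only [Finset.sum_insert ha]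
    exact (hX a (Finset.mem_insert_self a s)).add
      (ih fun x hx => hX x (Finset.mem_insert_of_mem hx))

theorem boundedInProb_const (a : ℝ) : BoundedInProb P l fun _ _ => a :=
  (tendstoInMeasure_of_tendsto_real (tendsto_const_nhds (x := a))).boundedInProb

theorem BoundedInProb.mul_tendsto_zero {X Y : ι → Ω → ℝ} (hX : BoundedInProb P l X)
    (hY : TendstoInMeasure P Y l fun _ => 0) :
    TendstoInMeasure P (fun i ω => X i ω * Y i ω) l fun _ => 0 := by
  rw [tendstoInMeasure_iff_eventually] at hY ⊢
  intro c hc δ hδ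
  obtain ⟨M, hM⟩ := hX (δ / 2) (half_pos hδ)
  have hM0 : 0 < |M| + 1 := by positivity
  filter_upwards [hM, hY (c / (|M| + 1)) (by positivity) (δ / 2) (half_pos hδ)] with i hi hi'
  calc P.real {ω | c ≤ |X i ω * Y i ω - 0|}
      ≤ P.real ({ω | M < |X i ω|} ∪ {ω | c / (|M| + 1) ≤ |Y i ω - 0|}) := by
        refine measureReal_mono fun ω hω => ?_
        by_contra hcon
        simp only [Set.mem_union, Set.mem_ofPred_eq, not_or, not_lt, not_le, sub_zero] at hcon hω
        rw [abs_mul] at hω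
        have h1 : |X i ω| ≤ |M| + 1 := by linarith [hcon.1, le_abs_self M]
        have h2 : |X i ω| * |Y i ω| ≤ (|M| + 1) * |Y i ω| :=
          mul_le_mul_of_nonneg_right h1 (abs_nonneg _)
        have h3 := (lt_div_iff₀ hM0).1 hcon.2
        linarith
    _ ≤ _ := measureReal_union_le _ _
    _ ≤ δ := by linarith

/-- Markov's inequality: an `L¹`-bounded family is stochastically bounded. -/
theorem boundedInProb_of_integral_le {X : ι → Ω → ℝ} (C : ℝ)
    (hX : ∀ᶠ i in l, Integrable (X i) P ∧ ∫ ω, |X i ω| ∂P ≤ C) : BoundedInProb P l X := by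
  intro δ hδ
  have hM : 0 < (|C| + 1) / δ := by positivity
  refine ⟨(|C| + 1) / δ, hX.mono fun i hi => ?_⟩
  calc P.real {ω | (|C| + 1) / δ < |X i ω|} ≤ P.real {ω | (|C| + 1) / δ ≤ |X i ω|} :=
        measureReal_mono fun ω hω => by
          simp only [Set.mem_ofPred_eq] at hω ⊢
          exact hω.le
    _ ≤ _ := measureReal_abs_ge_le hi.1 hM
    _ ≤ (|C| + 1) / ((|C| + 1) / δ) := by
        refine div_le_div_of_nonneg_right ?_ hM.le
        linarith [hi.2, le_abs_self C]
    _ = δ := by field_simp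

theorem boundedInProb_of_integrable {X : Ω → ℝ} (hX : Integrable X P) :
    BoundedInProb P l fun _ => X :=
  boundedInProb_of_integral_le _ (Eventually.of_forall fun _ => ⟨hX, le_rfl⟩)

/-- Markov's inequality: convergence in `L¹` implies convergence in probability. -/
theorem tendstoInMeasure_of_integral_le {X : ι → Ω → ℝ} {C : ι → ℝ} (hC : Tendsto C l (𝓝 0))
    (hX : ∀ᶠ i in l, Integrable (X i) P ∧ ∫ ω, |X i ω| ∂P ≤ C i) :
    TendstoInMeasure P X l fun _ => 0 := by
  rw [tendstoInMeasure_iff_eventually]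
  intro c hc δ hδ
  filter_upwards [hX, hC.eventually (gt_mem_nhds (mul_pos hδ hc))] with i hi hCi
  simp only [sub_zero]
  refine (measureReal_abs_ge_le hi.1 hc).trans ?_
  rw [div_le_iff₀ hc]
  linarith [hi.2]

end Calculus

/-! ### Sums of noise with predictable weights -/

/-- Independence of `m₁ ⊔ m₂` and `m₃` by successive independence: the intersections of events of
`m₁` and `m₂` form a π-system generating `m₁ ⊔ m₂`. -/
theorem indep_sup_left {Ω : Type*} {m₁ m₂ m₃ : MeasurableSpace Ω} [mΩ : MeasurableSpace Ω]
    {P : Measure Ω} [IsProbabilityMeasure P] (h₁ : m₁ ≤ mΩ) (h₂ : m₂ ≤ mΩ) (h₃ : m₃ ≤ mΩ)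
    (h : Indep m₁ (m₂ ⊔ m₃) P) (h' : Indep m₂ m₃ P) : Indep (m₁ ⊔ m₂) m₃ P := by
  set π : Set (Set Ω) :=
    {s | ∃ u v, MeasurableSet[m₁] u ∧ MeasurableSet[m₂] v ∧ s = u ∩ v} with hπ
  have hgen : m₁ ⊔ m₂ = MeasurableSpace.generateFrom π := by
    refine le_antisymm (sup_le ?_ ?_) (MeasurableSpace.generateFrom_le ?_)
    · intro u hu
      exact MeasurableSpace.measurableSet_generateFrom
        ⟨u, Set.univ, hu, MeasurableSet.univ, by simp⟩
    · intro v hv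
      exact MeasurableSpace.measurableSet_generateFrom
        ⟨Set.univ, v, MeasurableSet.univ, hv, by simp⟩
    · rintro s ⟨u, v, hu, hv, rfl⟩
      have h1 : m₁ ≤ m₁ ⊔ m₂ := le_sup_left
      have h2 : m₂ ≤ m₁ ⊔ m₂ := le_sup_right
      exact @MeasurableSet.inter _ (m₁ ⊔ m₂) _ _ (h1 u hu) (h2 v hv)
  refine IndepSets.indep (sup_le h₁ h₂) h₃ (p1 := π) (p2 := {s | MeasurableSet[m₃] s})
    ?_ (@MeasurableSpace.isPiSystem_measurableSet _ m₃) hgen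
    (@MeasurableSpace.generateFrom_measurableSet _ m₃).symm ?_
  · rintro s ⟨u, v, hu, hv, rfl⟩ s' ⟨u', v', hu', hv', rfl⟩ _
    exact ⟨u ∩ u', v ∩ v', @MeasurableSet.inter _ m₁ _ _ hu hu',
      @MeasurableSet.inter _ m₂ _ _ hv hv', Set.inter_inter_inter_comm _ _ _ _⟩
  · rw [IndepSets_iff]
    rintro s w ⟨u, v, hu, hv, rfl⟩ hw
    have hle2 : m₂ ≤ m₂ ⊔ m₃ := le_sup_left
    have hle3 : m₃ ≤ m₂ ⊔ m₃ := le_sup_right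
    have hw' : MeasurableSet[m₃] w := hw
    rw [Set.inter_assoc, (Indep_iff _ _ _).1 h u (v ∩ w) hu
        (@MeasurableSet.inter _ (m₂ ⊔ m₃) _ _ (hle2 v hv) (hle3 w hw')),
      (Indep_iff _ _ _).1 h' v w hv hw', (Indep_iff _ _ _).1 h u v hu (hle2 v hv), mul_assoc]

section Noise

variable {Ω : Type*}

/-- The σ-algebra generated by the treatments `U_1, U_2, …`. -/
abbrev treatmentInfo (U : ℤ → Ω → ℝ) : MeasurableSpace Ω :=
  MeasurableSpace.comap (fun ω (n : ℕ) => U ((n : ℤ) + 1) ω) inferInstance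

/-- The σ-algebra generated by all treatments and by the noise strictly before time `r`. -/
abbrev infoBefore (U ε : ℤ → Ω → ℝ) (r : ℤ) : MeasurableSpace Ω :=
  treatmentInfo U ⊔ ⨆ s ∈ Set.Iio r, MeasurableSpace.comap (ε s) inferInstance

theorem treatmentInfo_le_infoBefore (U ε : ℤ → Ω → ℝ) (r : ℤ) :
    treatmentInfo U ≤ infoBefore U ε r := le_sup_left

theorem infoBefore_mono (U ε : ℤ → Ω → ℝ) {r s : ℤ} (h : r ≤ s) :
    infoBefore U ε r ≤ infoBefore U ε s :=
  sup_le_sup le_rfl (biSup_mono fun _ hi => lt_of_lt_of_le hi h)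

theorem measurable_treatment_info (U : ℤ → Ω → ℝ) {t : ℤ} (ht : 1 ≤ t) :
    Measurable[treatmentInfo U] (U t) := by
  have h1 : Measurable[treatmentInfo U] fun ω (n : ℕ) => U ((n : ℤ) + 1) ω :=
    comap_measurable _
  have h2 := (measurable_pi_apply (t - 1).toNat).comp h1
  have h3 : (((t - 1).toNat : ℕ) : ℤ) + 1 = t := by omega
  simpa only [Function.comp_def, h3] using h2

theorem measurable_noise_info (U ε : ℤ → Ω → ℝ) {s r : ℤ} (h : s < r) :
    Measurable[infoBefore U ε r] (ε s) := by
  have h1 : MeasurableSpace.comap (ε s) inferInstance ≤ infoBefore U ε r :=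
    le_sup_of_le_right (le_iSup₂_of_le s h le_rfl)
  exact (comap_measurable (ε s)).mono h1 le_rfl

variable [mΩ : MeasurableSpace Ω] {P : Measure Ω} {σ : ℝ} {ε y0 U : ℤ → Ω → ℝ} {π : Design}

theorem treatmentInfo_le (hU : IsGeneratedBy P π U ε y0) : treatmentInfo U ≤ mΩ := by
  rw [treatmentInfo, ← measurable_iff_comap_le]
  exact measurable_pi_lambda _ fun n => hU.measurable _ (by omega)

theorem infoBefore_le (hε : IsWhiteNoise P σ ε) (hU : IsGeneratedBy P π U ε y0) (r : ℤ) :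
    infoBefore U ε r ≤ mΩ :=
  sup_le (treatmentInfo_le hU) (iSup₂_le fun s _ => (hε.measurable s).comap_le)

/-- A mean-zero, square integrable function of a single noise variable. -/
structure NoiseFunction (P : Measure Ω) (ε : ℤ → Ω → ℝ) (g : ℝ → ℝ) : Prop where
  measurable : Measurable g
  memLp : MemLp (fun ω => g (ε 0 ω)) 2 P
  mean_zero : ∫ ω, g (ε 0 ω) ∂P = 0

theorem IsWhiteNoise.noiseFunction_id (hε : IsWhiteNoise P σ ε) : NoiseFunction P ε id :=
  ⟨measurable_id, hε.memLp 0, hε.mean_zero 0⟩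

theorem integral_comp_noise (hε : IsWhiteNoise P σ ε) {g : ℝ → ℝ} (hg : Measurable g) (r : ℤ) :
    ∫ ω, g (ε r ω) ∂P = ∫ ω, g (ε 0 ω) ∂P :=
  ((hε.identDistrib r).comp hg).integral_eq

theorem NoiseFunction.memLp_at (hε : IsWhiteNoise P σ ε) {g : ℝ → ℝ} (hg : NoiseFunction P ε g)
    (r : ℤ) : MemLp (fun ω => g (ε r ω)) 2 P :=
  ((hε.identDistrib r).comp hg.measurable).symm.memLp_snd hg.memLp

variable [IsProbabilityMeasure P]

/-- The noise at time `r` is independent of the treatments and the earlier noise. -/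
theorem indep_infoBefore (hε : IsWhiteNoise P σ ε) (hU : IsGeneratedBy P π U ε y0) (r : ℤ) :
    Indep (infoBefore U ε r) (MeasurableSpace.comap (ε r) inferInstance) P := by
  refine indep_sup_left (treatmentInfo_le hU)
    (iSup₂_le fun s _ => (hε.measurable s).comap_le) (hε.measurable r).comap_le ?_ ?_
  · refine indep_of_indep_of_le_right hU.indep ?_
    have hle : ∀ s, MeasurableSpace.comap (ε s) inferInstance ≤
        MeasurableSpace.comap (fun ω => ((fun t : ℤ => ε t ω), (fun t : ℤ => y0 t ω)))
          inferInstance := by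
      intro s
      rw [← measurable_iff_comap_le]
      exact ((measurable_pi_apply (X := fun _ : ℤ => ℝ) s).comp measurable_fst).comp
        (comap_measurable fun ω => ((fun t : ℤ => ε t ω), (fun t : ℤ => y0 t ω)))
    exact sup_le (iSup₂_le fun s _ => hle s) (hle r)
  · have := indep_iSup_of_disjoint (fun s => (hε.measurable s).comap_le) hε.indep
      (S := Set.Iio r) (T := {r}) (by simp)
    simpa using this

theorem indepFun_past (hε : IsWhiteNoise P σ ε) (hU : IsGeneratedBy P π U ε y0) {r : ℤ}
    {V : Ω → ℝ} (hV : Measurable[infoBefore U ε r] V) {g : ℝ → ℝ} (hg : Measurable g) :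
    IndepFun V (fun ω => g (ε r ω)) P := by
  have h : IndepFun V (ε r) P := by
    rw [IndepFun_iff_Indep]
    exact indep_of_indep_of_le_left (indep_infoBefore hε hU r) (measurable_iff_comap_le.1 hV)
  exact h.comp measurable_id hg

theorem integral_sq_noise (hε : IsWhiteNoise P σ ε) (r : ℤ) : ∫ ω, ε r ω ^ 2 ∂P = σ ^ 2 := by
  have h := variance_eq_sub (hε.memLp r)
  rw [hε.variance_eq r, hε.mean_zero r] at h
  simpa using h.symm

/-- Sums of noise terms with predictable weights, where the weight at time `t` only depends on
the treatments and on the noise before time `t - k`, have orthogonal terms. -/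
theorem integral_sq_weighted_sum (hε : IsWhiteNoise P σ ε) (hU : IsGeneratedBy P π U ε y0)
    {g : ℝ → ℝ} (hg : NoiseFunction P ε g) (k : ℤ) (s : Finset ℤ) {V : ℤ → Ω → ℝ}
    (hVm : ∀ t ∈ s, Measurable[infoBefore U ε (t - k)] (V t))
    (hV2 : ∀ t ∈ s, MemLp (V t) 2 P) :
    MemLp (fun ω => ∑ t ∈ s, V t ω * g (ε (t - k) ω)) 2 P ∧
      ∫ ω, (∑ t ∈ s, V t ω * g (ε (t - k) ω)) ^ 2 ∂P =
        (∫ ω, g (ε 0 ω) ^ 2 ∂P) * ∑ t ∈ s, ∫ ω, V t ω ^ 2 ∂P := by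
  induction s using Finset.induction_on_max with
  | empty => simp
  | insert a s has ih =>
    have ha : a ∉ s := fun h => lt_irrefl _ (has a h)
    obtain ⟨ih1, ih2⟩ := ih (fun t ht => hVm t (Finset.mem_insert_of_mem ht))
      (fun t ht => hV2 t (Finset.mem_insert_of_mem ht))
    have hVa := hVm a (Finset.mem_insert_self a s)
    have hVa2 := hV2 a (Finset.mem_insert_self a s)
    simp only [Finset.sum_insert ha]
    set S : Ω → ℝ := fun ω => ∑ t ∈ s, V t ω * g (ε (t - k) ω) with hS
    have hSm : Measurable[infoBefore U ε (a - k)] S := by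
      refine Finset.measurable_fun_sum s fun t ht => Measurable.mul ?_ ?_
      · exact (hVm t (Finset.mem_insert_of_mem ht)).mono
          (infoBefore_mono U ε (by have := has t ht; omega)) le_rfl
      · exact hg.measurable.comp (measurable_noise_info U ε (by have := has t ht; omega))
    have hη := hg.memLp_at hε (a - k)
    have hsq : Measurable fun x : ℝ => g x ^ 2 := hg.measurable.pow_const 2
    have hI1 : IndepFun (fun ω => V a ω ^ 2) (fun ω => g (ε (a - k) ω) ^ 2) P :=
      indepFun_past hε hU (hVa.pow_const 2) hsq
    have hI2 : IndepFun (fun ω => S ω * V a ω) (fun ω => g (ε (a - k) ω)) P :=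
      indepFun_past hε hU (hSm.mul hVa) hg.measurable
    have hint1 : Integrable (fun ω => V a ω ^ 2 * g (ε (a - k) ω) ^ 2) P :=
      hI1.integrable_mul hVa2.integrable_sq hη.integrable_sq
    have hint2 : Integrable (fun ω => S ω * V a ω * g (ε (a - k) ω)) P :=
      hI2.integrable_mul (ih1.integrable_mul hVa2) (hη.integrable (by norm_num))
    have hint3 : Integrable (fun ω => 2 * (S ω * V a ω * g (ε (a - k) ω)) + S ω ^ 2) P :=
      (hint2.const_mul 2).add ih1.integrable_sq
    have hle := infoBefore_le hε hU (a - k)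
    have hmem : MemLp (fun ω => V a ω * g (ε (a - k) ω)) 2 P := by
      rw [memLp_two_iff_integrable_sq]
      · simpa only [mul_pow] using hint1
      · exact ((hVa.mono hle le_rfl).mul
          (hg.measurable.comp (hε.measurable _))).aestronglyMeasurable
    refine ⟨hmem.add ih1, ?_⟩
    have hexp : ∀ ω, (V a ω * g (ε (a - k) ω) + S ω) ^ 2 =
        V a ω ^ 2 * g (ε (a - k) ω) ^ 2 + (2 * (S ω * V a ω * g (ε (a - k) ω)) + S ω ^ 2) :=
      fun ω => by ring
    rw [integral_congr_ae (Eventually.of_forall hexp),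
      integral_add hint1 hint3,
      integral_add (hint2.const_mul 2) ih1.integrable_sq, integral_const_mul, ih2,
      hI1.integral_fun_mul_eq_mul_integral hVa2.integrable_sq.aestronglyMeasurable
        hη.integrable_sq.aestronglyMeasurable,
      hI2.integral_fun_mul_eq_mul_integral (ih1.integrable_mul hVa2).aestronglyMeasurable
        hη.aestronglyMeasurable, integral_comp_noise hε hsq, integral_comp_noise hε hg.measurable,
      hg.mean_zero]
    ring

theorem integral_abs_le_sqrt {X : Ω → ℝ} (hX : MemLp X 2 P) :
    ∫ ω, |X ω| ∂P ≤ √(∫ ω, X ω ^ 2 ∂P) := by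
  refine Real.le_sqrt_of_sq_le ?_
  have h := variance_nonneg |X| P
  rw [variance_eq_sub hX.abs] at h
  simp only [Pi.pow_apply, Pi.abs_apply, sq_abs] at h
  linarith

/-- The fourth moment of a sum of bounded noise terms with bounded predictable weights is at most
quadratic in the number of terms. -/
theorem integral_pow_four_weighted_sum_le (hε : IsWhiteNoise P σ ε)
    (hU : IsGeneratedBy P π U ε y0) {g : ℝ → ℝ} (hg : NoiseFunction P ε g) {M : ℝ}
    (hgM : ∀ x, |g x| ≤ M) (k : ℤ) (s : Finset ℤ) {V : ℤ → Ω → ℝ}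
    (hVm : ∀ t ∈ s, Measurable[infoBefore U ε (t - k)] (V t)) {B : ℝ} (hB0 : 0 ≤ B)
    (hB : ∀ t ∈ s, ∀ ω, |V t ω| ≤ B) :
    ∫ ω, (∑ t ∈ s, V t ω * g (ε (t - k) ω)) ^ 4 ∂P ≤ 8 * (B * M) ^ 4 * (s.card : ℝ) ^ 2 := by
  have hM0 : 0 ≤ M := (abs_nonneg _).trans (hgM 0)
  set D := B * M with hD
  have hD0 : 0 ≤ D := mul_nonneg hB0 hM0
  induction s using Finset.induction_on_max with
  | empty => simp
  | insert a s has ih =>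
    have ha : a ∉ s := fun h => lt_irrefl _ (has a h)
    have hVm' : ∀ t ∈ s, Measurable[infoBefore U ε (t - k)] (V t) := fun t ht =>
      hVm t (Finset.mem_insert_of_mem ht)
    have hB' : ∀ t ∈ s, ∀ ω, |V t ω| ≤ B := fun t ht => hB t (Finset.mem_insert_of_mem ht)
    have ih := ih hVm' hB'
    have hVa := hVm a (Finset.mem_insert_self a s)
    have hVaB := hB a (Finset.mem_insert_self a s)
    simp only [Finset.sum_insert ha]
    set S : Ω → ℝ := fun ω => ∑ t ∈ s, V t ω * g (ε (t - k) ω) with hS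
    have hSm : Measurable[infoBefore U ε (a - k)] S := by
      refine Finset.measurable_fun_sum s fun t ht => Measurable.mul ?_ ?_
      · exact (hVm' t ht).mono (infoBefore_mono U ε (by have := has t ht; omega)) le_rfl
      · exact hg.measurable.comp (measurable_noise_info U ε (by have := has t ht; omega))
    have hle := infoBefore_le hε hU (a - k)
    have hSm' : Measurable S := hSm.mono hle le_rfl
    have hVa' : Measurable (V a) := hVa.mono hle le_rfl
    have hηm : Measurable fun ω => g (ε (a - k) ω) := hg.measurable.comp (hε.measurable _)
    have hterm : ∀ t ∈ s, ∀ ω, |V t ω * g (ε (t - k) ω)| ≤ D := fun t ht ω => by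
      rw [abs_mul]
      exact mul_le_mul (hB' t ht ω) (hgM _) (abs_nonneg _) hB0
    have hx : ∀ ω, |V a ω * g (ε (a - k) ω)| ≤ D := fun ω => by
      rw [abs_mul]
      exact mul_le_mul (hVaB ω) (hgM _) (abs_nonneg _) hB0
    have hSb : ∀ ω, |S ω| ≤ s.card * D := fun ω => by
      refine (Finset.abs_sum_le_sum_abs _ _).trans ?_
      refine (Finset.sum_le_sum fun t ht => hterm t ht ω).trans_eq ?_
      rw [Finset.sum_const, nsmul_eq_mul]
    have hSL : ∀ n : ℕ, Integrable (fun ω => S ω ^ n) P := fun n =>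
      Integrable.of_bound (hSm'.pow_const n).aestronglyMeasurable ((s.card * D) ^ n)
        (Eventually.of_forall fun ω => by
          rw [Real.norm_eq_abs, abs_pow]
          exact pow_le_pow_left₀ (abs_nonneg _) (hSb ω) n)
    have hV2 : ∀ t ∈ s, MemLp (V t) 2 P := fun t ht =>
      MemLp.of_bound ((hVm' t ht).mono (infoBefore_le hε hU _) le_rfl).aestronglyMeasurable B
        (Eventually.of_forall fun ω => hB' t ht ω)
    have hS2 : ∫ ω, S ω ^ 2 ∂P ≤ s.card * D ^ 2 := by
      rw [(integral_sq_weighted_sum hε hU hg k s hVm' hV2).2]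
      have h1 : ∫ ω, g (ε 0 ω) ^ 2 ∂P ≤ M ^ 2 := by
        have := integral_mono (μ := P) (hg.memLp.integrable_sq) (integrable_const (M ^ 2))
          fun ω => sq_le_sq' (neg_le_of_abs_le (hgM _)) (le_of_abs_le (hgM _))
        simpa using this
      have h2 : ∑ t ∈ s, ∫ ω, V t ω ^ 2 ∂P ≤ s.card * B ^ 2 := by
        rw [← nsmul_eq_mul]
        refine Finset.sum_le_card_nsmul _ _ _ fun t ht => ?_
        have := integral_mono (μ := P) ((hV2 t ht).integrable_sq) (integrable_const (B ^ 2))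
          fun ω => sq_le_sq' (neg_le_of_abs_le (hB' t ht ω)) (le_of_abs_le (hB' t ht ω))
        simpa using this
      calc _ ≤ M ^ 2 * (s.card * B ^ 2) := mul_le_mul h1 h2
            (Finset.sum_nonneg fun t _ => integral_nonneg fun ω => sq_nonneg _) (sq_nonneg _)
        _ = s.card * D ^ 2 := by rw [hD]; ring
    have hI : IndepFun (fun ω => S ω ^ 3 * V a ω) (fun ω => g (ε (a - k) ω)) P :=
      indepFun_past hε hU ((hSm.pow_const 3).mul hVa) hg.measurable
    have hcross : ∫ ω, S ω ^ 3 * V a ω * g (ε (a - k) ω) ∂P = 0 := by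
      rw [hI.integral_fun_mul_eq_mul_integral
          ((hSm'.pow_const 3).mul hVa').aestronglyMeasurable hηm.aestronglyMeasurable,
        integral_comp_noise hε hg.measurable, hg.mean_zero, mul_zero]
    have hcrossI : Integrable (fun ω => S ω ^ 3 * V a ω * g (ε (a - k) ω)) P := by
      refine Integrable.of_bound
        (((hSm'.pow_const 3).mul hVa').mul hηm).aestronglyMeasurable ((s.card * D) ^ 3 * D)
        (Eventually.of_forall fun ω => ?_)
      rw [Real.norm_eq_abs, mul_assoc, abs_mul, abs_pow]
      exact mul_le_mul (pow_le_pow_left₀ (abs_nonneg _) (hSb ω) 3) (hx ω) (abs_nonneg _)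
        (by positivity)
    -- `4 S x³ ≤ 2 (S² x² + x⁴)` absorbs the odd term which does not vanish
    have hpt : ∀ ω, (V a ω * g (ε (a - k) ω) + S ω) ^ 4 ≤
        S ω ^ 4 + (4 * (S ω ^ 3 * V a ω * g (ε (a - k) ω)) +
          (8 * D ^ 2 * S ω ^ 2 + 3 * D ^ 4)) := by
      intro ω
      set x := V a ω * g (ε (a - k) ω) with hxdef
      have hx2 : x ^ 2 ≤ D ^ 2 := sq_le_sq' (neg_le_of_abs_le (hx ω)) (le_of_abs_le (hx ω))
      have hx4 : x ^ 4 ≤ D ^ 4 := by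
        nlinarith [sq_nonneg x, sq_nonneg D]
      have h1 : S ω ^ 2 * x ^ 2 ≤ S ω ^ 2 * D ^ 2 := mul_le_mul_of_nonneg_left hx2 (sq_nonneg _)
      have h2 : 4 * (S ω * x ^ 3) ≤ 2 * (S ω ^ 2 * x ^ 2 + x ^ 4) := by
        nlinarith [sq_nonneg (x * (S ω - x))]
      have h3 : (x + S ω) ^ 4 = S ω ^ 4 + 4 * (S ω ^ 3 * x) + 6 * (S ω ^ 2 * x ^ 2) +
          4 * (S ω * x ^ 3) + x ^ 4 := by ring
      have h4 : S ω ^ 3 * V a ω * g (ε (a - k) ω) = S ω ^ 3 * x := by rw [hxdef]; ring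
      rw [h3, h4]
      linarith
    have hint1 : Integrable (fun ω => 8 * D ^ 2 * S ω ^ 2 + 3 * D ^ 4) P :=
      ((hSL 2).const_mul (8 * D ^ 2)).add (integrable_const _)
    have hint2 : Integrable (fun ω => 4 * (S ω ^ 3 * V a ω * g (ε (a - k) ω)) +
        (8 * D ^ 2 * S ω ^ 2 + 3 * D ^ 4)) P := (hcrossI.const_mul 4).add hint1
    calc ∫ ω, (V a ω * g (ε (a - k) ω) + S ω) ^ 4 ∂P
        ≤ ∫ ω, S ω ^ 4 + (4 * (S ω ^ 3 * V a ω * g (ε (a - k) ω)) +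
          (8 * D ^ 2 * S ω ^ 2 + 3 * D ^ 4)) ∂P :=
          integral_mono_of_nonneg (Eventually.of_forall fun ω => by positivity)
            ((hSL 4).add hint2)
            (Eventually.of_forall hpt)
      _ = ∫ ω, S ω ^ 4 ∂P + (8 * D ^ 2 * ∫ ω, S ω ^ 2 ∂P + 3 * D ^ 4) := by
          rw [integral_add (hSL 4) hint2, integral_add (hcrossI.const_mul 4) hint1,
            integral_add ((hSL 2).const_mul (8 * D ^ 2)) (integrable_const _),
            integral_const_mul, integral_const_mul, hcross]
          simp
      _ ≤ 8 * D ^ 4 * (s.card : ℝ) ^ 2 + (8 * D ^ 2 * (s.card * D ^ 2) + 3 * D ^ 4) := by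
          gcongr
      _ ≤ 8 * D ^ 4 * ((insert a s).card : ℝ) ^ 2 := by
          rw [Finset.card_insert_of_notMem ha]
          push_cast
          have : 0 ≤ D ^ 4 * (s.card : ℝ) := by positivity
          nlinarith [pow_nonneg hD0 4]

end Noise

/-! ### Uniform integrability and the asymptotic mean squared error -/

section UniformIntegrability

variable {Ω ι : Type*} [mΩ : MeasurableSpace Ω] {P : Measure Ω}

/-- The squares of the family `Y` are uniformly integrable, expressed through the expected excess
of `Y i ^ 2` over a high level `K`. -/
structure UniformlySqIntegrable (P : Measure Ω) (Y : ι → Ω → ℝ) : Prop where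
  memLp : ∀ i, MemLp (Y i) 2 P
  excess : ∀ δ : ℝ, 0 < δ → ∃ K₀ : ℝ, ∀ K, K₀ ≤ K → ∀ i,
    ∫ ω, max (Y i ω ^ 2 - K) 0 ∂P ≤ δ

variable [IsProbabilityMeasure P]

theorem integrable_excess {X : Ω → ℝ} (hX : MemLp X 2 P) (K : ℝ) :
    Integrable (fun ω => max (X ω ^ 2 - K) 0) P :=
  (hX.integrable_sq.sub (integrable_const K)).sup (integrable_const 0)

theorem max_add_sq_sub_le (x y K : ℝ) :
    max ((x + y) ^ 2 - K) 0 ≤ 2 * max (x ^ 2 - K / 4) 0 + 2 * max (y ^ 2 - K / 4) 0 := by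
  have h1 := le_max_left (x ^ 2 - K / 4) 0
  have h2 := le_max_left (y ^ 2 - K / 4) 0
  have h3 := le_max_right (x ^ 2 - K / 4) 0
  have h4 := le_max_right (y ^ 2 - K / 4) 0
  refine max_le ?_ (by positivity)
  nlinarith [sq_nonneg (x - y)]

theorem integral_excess_add_le {X Y : Ω → ℝ} (hX : MemLp X 2 P) (hY : MemLp Y 2 P) (K : ℝ) :
    ∫ ω, max ((X ω + Y ω) ^ 2 - K) 0 ∂P ≤
      2 * ∫ ω, max (X ω ^ 2 - K / 4) 0 ∂P + 2 * ∫ ω, max (Y ω ^ 2 - K / 4) 0 ∂P := by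
  rw [← integral_const_mul, ← integral_const_mul,
    ← integral_add ((integrable_excess hX _).const_mul 2) ((integrable_excess hY _).const_mul 2)]
  exact integral_mono (integrable_excess (hX.add hY) K)
    (((integrable_excess hX _).const_mul 2).add ((integrable_excess hY _).const_mul 2))
    fun ω => max_add_sq_sub_le _ _ _

theorem UniformlySqIntegrable.add {X Y : ι → Ω → ℝ} (hX : UniformlySqIntegrable P X)
    (hY : UniformlySqIntegrable P Y) : UniformlySqIntegrable P fun i ω => X i ω + Y i ω := by
  refine ⟨fun i => (hX.memLp i).add (hY.memLp i), fun δ hδ => ?_⟩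
  obtain ⟨K₁, h₁⟩ := hX.excess (δ / 4) (by positivity)
  obtain ⟨K₂, h₂⟩ := hY.excess (δ / 4) (by positivity)
  refine ⟨4 * max K₁ K₂, fun K hK i => ?_⟩
  have hK1 : K₁ ≤ K / 4 := by linarith [le_max_left K₁ K₂]
  have hK2 : K₂ ≤ K / 4 := by linarith [le_max_right K₁ K₂]
  have := integral_excess_add_le (hX.memLp i) (hY.memLp i) K
  linarith [h₁ _ hK1 i, h₂ _ hK2 i]

theorem UniformlySqIntegrable.sum {α : Type*} {s : Finset α} {X : α → ι → Ω → ℝ}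
    (hX : ∀ a ∈ s, UniformlySqIntegrable P (X a)) :
    UniformlySqIntegrable P fun i ω => ∑ a ∈ s, X a i ω := by
  classical
  induction s using Finset.induction_on with
  | empty =>
    refine ⟨fun i => by simp, fun δ hδ => ⟨0, fun K hK i => ?_⟩⟩
    simp [hK, hδ.le]
  | insert a s ha ih =>
    simp only [Finset.sum_insert ha]
    exact (hX a (Finset.mem_insert_self a s)).add
      (ih fun x hx => hX x (Finset.mem_insert_of_mem hx))

theorem abs_min_sq_sub_min_sq_le (x y : ℝ) {K : ℝ} (hK : 0 ≤ K) :
    |min (x ^ 2) K - min (y ^ 2) K| ≤ 2 * √K * |x - y| := by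
  have h : ∀ z : ℝ, min (z ^ 2) K = min |z| √K ^ 2 := by
    intro z
    rcases le_total |z| √K with hz | hz
    · rw [min_eq_left hz, sq_abs, min_eq_left]
      rw [← sq_abs]
      exact (Real.le_sqrt (abs_nonneg z) hK).1 hz
    · rw [min_eq_right hz, Real.sq_sqrt hK, min_eq_right]
      rw [← sq_abs]
      exact (Real.sqrt_le_left (abs_nonneg z)).1 hz
  have h1 : |min |x| √K - min |y| √K| ≤ |x - y| := by
    refine (abs_min_sub_min_le_max _ _ _ _).trans ?_
    rw [sub_self, abs_zero, max_eq_left (abs_nonneg _)]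
    exact abs_abs_sub_abs_le_abs_sub x y
  have h2 : |min |x| √K + min |y| √K| ≤ 2 * √K := by
    rw [abs_of_nonneg (by positivity)]
    linarith [min_le_right |x| √K, min_le_right |y| √K]
  rw [h x, h y, sq_sub_sq, abs_mul]
  exact mul_le_mul h2 h1 (abs_nonneg _) (by positivity)

theorem integrable_min_sq {X : Ω → ℝ} (hX : AEStronglyMeasurable X P) {K : ℝ} (hK : 0 ≤ K) :
    Integrable (fun ω => min (X ω ^ 2) K) P :=
  Integrable.of_bound ((hX.pow 2).inf aestronglyMeasurable_const) K
    (Eventually.of_forall fun ω => by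
      rw [Real.norm_of_nonneg (le_min (sq_nonneg _) hK)]
      exact min_le_right _ _)

/-- Truncated second moments are continuous for convergence in probability, without tightness. -/
theorem tendsto_integral_min_sq_sub {l : Filter ι} {X Y : ι → Ω → ℝ}
    (hX : ∀ i, Measurable (X i)) (hY : ∀ i, Measurable (Y i))
    (h : TendstoInMeasure P (fun i ω => X i ω - Y i ω) l fun _ => 0) {K : ℝ} (hK : 0 < K) :
    Tendsto (fun i => ∫ ω, min (X i ω ^ 2) K ∂P - ∫ ω, min (Y i ω ^ 2) K ∂P) l (𝓝 0) := by
  rw [Metric.tendsto_nhds]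
  intro δ hδ
  have hs : 0 < √K := Real.sqrt_pos.2 hK
  have hc : 0 < δ / (8 * √K) := by positivity
  filter_upwards [tendstoInMeasure_iff_eventually.1 h _ hc (δ / (4 * K)) (by positivity)] with i hi
  simp only [sub_zero] at hi
  set s := {ω | δ / (8 * √K) ≤ |X i ω - Y i ω|} with hsdef
  have hsm : MeasurableSet s := measurableSet_le measurable_const ((hX i).sub (hY i)).abs
  have hXI := integrable_min_sq (P := P) (hX i).aestronglyMeasurable hK.le
  have hYI := integrable_min_sq (P := P) (hY i).aestronglyMeasurable hK.le
  have hind : Integrable (s.indicator fun _ => K) P := (integrable_const K).indicator hsm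
  rw [Real.dist_eq, sub_zero, ← integral_sub hXI hYI]
  have hbound : ∀ ω, |min (X i ω ^ 2) K - min (Y i ω ^ 2) K| ≤
      δ / 4 + s.indicator (fun _ => K) ω := by
    intro ω
    by_cases hω : ω ∈ s
    · rw [Set.indicator_of_mem hω]
      have h1 : 0 ≤ min (X i ω ^ 2) K := le_min (sq_nonneg _) hK.le
      have h2 : 0 ≤ min (Y i ω ^ 2) K := le_min (sq_nonneg _) hK.le
      have h3 := min_le_right (X i ω ^ 2) K
      have h4 := min_le_right (Y i ω ^ 2) K
      rw [abs_le]
      constructor <;> linarith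
    · rw [Set.indicator_of_notMem hω, add_zero]
      simp only [hsdef, Set.mem_ofPred_eq, not_le] at hω
      refine (abs_min_sq_sub_min_sq_le _ _ hK.le).trans ?_
      calc 2 * √K * |X i ω - Y i ω| ≤ 2 * √K * (δ / (8 * √K)) := by gcongr
        _ = δ / 4 := by field_simp; norm_num
  calc |∫ ω, min (X i ω ^ 2) K - min (Y i ω ^ 2) K ∂P|
      ≤ ∫ ω, |min (X i ω ^ 2) K - min (Y i ω ^ 2) K| ∂P := abs_integral_le_integral_abs
    _ ≤ ∫ ω, δ / 4 + s.indicator (fun _ => K) ω ∂P :=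
        integral_mono (hXI.sub hYI).abs ((integrable_const _).add hind) hbound
    _ = δ / 4 + P.real s * K := by
        rw [integral_add (integrable_const _) hind, integral_indicator_const _ hsm]
        simp
    _ ≤ δ / 4 + δ / (4 * K) * K := by gcongr
    _ = δ / 2 := by field_simp; norm_num
    _ < δ := by linarith

/-- If `X i` is asymptotically equivalent to `Y (T i)` and the squares of `Y` are uniformly
integrable, then the asymptotic mean squared error of `X` is the limit of the second moments of
`Y`. That `T` maps `l` onto `atTop` is what allows to return from `l` to the plain limit. -/
theorem hasAsymptoticMSE_iff_tendsto {l : Filter ι} {X : ι → Ω → ℝ} {Y : ℕ → Ω → ℝ} {T : ι → ℕ}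
    (hT : map T l = atTop) (hX : ∀ i, Measurable (X i)) (hYm : ∀ n, Measurable (Y n))
    (hY : UniformlySqIntegrable P Y)
    (h : TendstoInMeasure P (fun i ω => X i ω - Y (T i) ω) l fun _ => 0) (v : ℝ) :
    HasAsymptoticMSE P l X v ↔ Tendsto (fun n => ∫ ω, Y n ω ^ 2 ∂P) atTop (𝓝 v) := by
  have hclose : ∀ K : ℝ, 0 < K → ∀ δ : ℝ, 0 < δ → ∀ᶠ i in l,
      |∫ ω, min (X i ω ^ 2) K ∂P - ∫ ω, min (Y (T i) ω ^ 2) K ∂P| < δ := by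
    intro K hK δ hδ
    have := Metric.tendsto_nhds.1
      (tendsto_integral_min_sq_sub hX (fun i => hYm (T i)) h hK) δ hδ
    simpa only [Real.dist_eq, sub_zero] using this
  have hexcess : ∀ K : ℝ, 0 ≤ K → ∀ n, ∫ ω, Y n ω ^ 2 ∂P =
      ∫ ω, min (Y n ω ^ 2) K ∂P + ∫ ω, max (Y n ω ^ 2 - K) 0 ∂P := by
    intro K hK n
    rw [← integral_add (integrable_min_sq (hYm n).aestronglyMeasurable hK)
      (integrable_excess (hY.memLp n) K)]
    refine integral_congr_ae (Eventually.of_forall fun ω => ?_)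
    rcases le_total (Y n ω ^ 2) K with h' | h'
    · simp [h']
    · simp [h']
  have hpos : ∀ K n, 0 ≤ ∫ ω, max (Y n ω ^ 2 - K) 0 ∂P := fun K n =>
    integral_nonneg fun ω => le_max_right _ _
  constructor
  · intro hv
    rw [Metric.tendsto_nhds]
    intro δ hδ
    obtain ⟨K₀, hK₀⟩ := hY.excess (δ / 3) (by positivity)
    obtain ⟨K, hKv, hKK, hK0⟩ := ((hv (δ / 3) (by positivity)).and
      ((eventually_ge_atTop K₀).and (eventually_gt_atTop 0))).exists
    rw [← hT, eventually_map]
    filter_upwards [hKv, hclose K hK0 (δ / 3) (by positivity)] with i h1 h2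
    rw [Real.dist_eq, hexcess K hK0.le]
    have h3 := hK₀ K hKK (T i)
    have h4 := hpos K (T i)
    rw [abs_lt] at h1 h2 ⊢
    constructor <;> linarith [h1.1, h1.2, h2.1, h2.2]
  · intro hv δ hδ
    obtain ⟨K₀, hK₀⟩ := hY.excess (δ / 3) (by positivity)
    filter_upwards [eventually_ge_atTop K₀, eventually_gt_atTop 0] with K hKK hK0
    have hv' := Metric.tendsto_nhds.1 hv (δ / 3) (by positivity)
    rw [← hT, eventually_map] at hv'
    filter_upwards [hv', hclose K hK0 (δ / 3) (by positivity)] with i h1 h2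
    rw [Real.dist_eq, hexcess K hK0.le] at h1
    have h3 := hK₀ K hKK (T i)
    have h4 := hpos K (T i)
    rw [abs_lt] at h1 h2 ⊢
    constructor <;> linarith [h1.1, h1.2, h2.1, h2.2]

end UniformIntegrability

/-! ### Uniform integrability of normalized sums of noise -/

section WeightedNoise

variable {Ω : Type*} [mΩ : MeasurableSpace Ω] {P : Measure Ω} [IsProbabilityMeasure P] {σ : ℝ}
  {ε y0 U : ℤ → Ω → ℝ} {π : Design}

/-- The noise splits into a bounded part and a part of small variance, both centered. -/
theorem exists_bounded_add_small (hε : IsWhiteNoise P σ ε) {η : ℝ} (hη : 0 < η) :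
    ∃ g h : ℝ → ℝ, ∃ M : ℝ, NoiseFunction P ε g ∧ NoiseFunction P ε h ∧ (∀ x, |g x| ≤ M) ∧
      (∀ x, x = g x + h x) ∧ ∫ ω, h (ε 0 ω) ^ 2 ∂P ≤ η := by
  -- truncation at level `n`, to be recentered by the mean `c` of the truncated noise
  set τ : ℕ → ℝ → ℝ := fun n => (Set.Icc (-(n : ℝ)) n).indicator id with hτ
  have hτm : ∀ n, Measurable (τ n) := fun n => measurable_id.indicator measurableSet_Icc
  have hτb : ∀ n x, |τ n x| ≤ n := by
    intro n x
    by_cases hx : x ∈ Set.Icc (-(n : ℝ)) n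
    · simp only [hτ, Set.indicator_of_mem hx]
      exact abs_le.2 hx
    · simp [hτ, Set.indicator_of_notMem hx]
  have hτx : ∀ n x, |x - τ n x| ≤ |x| := by
    intro n x
    by_cases hx : x ∈ Set.Icc (-(n : ℝ)) n
    · simp [hτ, Set.indicator_of_mem hx]
    · simp [hτ, Set.indicator_of_notMem hx]
  have hεm := hε.measurable 0
  have hτL : ∀ n, MemLp (fun ω => τ n (ε 0 ω)) 2 P := fun n =>
    MemLp.of_bound ((hτm n).comp hεm).aestronglyMeasurable n
      (Eventually.of_forall fun ω => hτb n _)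
  have hlim : Tendsto (fun n : ℕ => ∫ ω, (ε 0 ω - τ n (ε 0 ω)) ^ 2 ∂P) atTop (𝓝 0) := by
    have h0 : (0 : ℝ) = ∫ _ω, (0 : ℝ) ∂P := by simp
    rw [h0]
    refine tendsto_integral_of_dominated_convergence (fun ω => ε 0 ω ^ 2) (fun n =>
      ((hεm.sub ((hτm n).comp hεm)).pow_const 2).aestronglyMeasurable)
      (hε.memLp 0).integrable_sq (fun n => Eventually.of_forall fun ω => ?_)
      (Eventually.of_forall fun ω => ?_)
    · rw [Real.norm_of_nonneg (sq_nonneg _)]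
      exact sq_le_sq.2 (hτx n _)
    · refine tendsto_const_nhds.congr' ?_
      filter_upwards [eventually_ge_atTop ⌈|ε 0 ω|⌉₊] with n hn
      have hx : ε 0 ω ∈ Set.Icc (-(n : ℝ)) n := abs_le.1 (Nat.ceil_le.1 hn)
      simp [hτ, Set.indicator_of_mem hx]
  obtain ⟨n, hn⟩ := (hlim.eventually (gt_mem_nhds hη)).exists
  set c := ∫ ω, τ n (ε 0 ω) ∂P with hc
  have hτI : Integrable (fun ω => τ n (ε 0 ω)) P := (hτL n).integrable (by norm_num)
  have hεI : Integrable (ε 0) P := (hε.memLp 0).integrable (by norm_num)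
  refine ⟨fun x => τ n x - c, fun x => x - τ n x + c, n + |c|, ⟨?_, ?_, ?_⟩, ⟨?_, ?_, ?_⟩,
    fun x => ?_, fun x => by ring, ?_⟩
  · exact (hτm n).sub_const c
  · exact (hτL n).sub (memLp_const c)
  · rw [integral_sub hτI (integrable_const c)]
    simp [hc]
  · exact (measurable_id.sub (hτm n)).add_const c
  · exact ((hε.memLp 0).sub (hτL n)).add (memLp_const c)
  · rw [integral_add (f := fun ω => ε 0 ω - τ n (ε 0 ω)) (hεI.sub hτI) (integrable_const c),
      integral_sub hεI hτI, hε.mean_zero 0]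
    simp [hc]
  · exact (abs_sub _ _).trans (add_le_add_left (hτb n x) _)
  · -- the second moment of the tail exceeds its variance
    have hmem : MemLp (fun ω => ε 0 ω - τ n (ε 0 ω)) 2 P := (hε.memLp 0).sub (hτL n)
    have hv : ∫ ω, (ε 0 ω - τ n (ε 0 ω) + c) ^ 2 ∂P =
        ∫ ω, (ε 0 ω - τ n (ε 0 ω)) ^ 2 ∂P - c ^ 2 := by
      have hI0 : Integrable (fun ω => ε 0 ω - τ n (ε 0 ω)) P := hεI.sub hτI
      have hI1 : Integrable (fun ω => 2 * c * (ε 0 ω - τ n (ε 0 ω)) + c ^ 2) P :=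
        (hI0.const_mul (2 * c)).add (integrable_const _)
      have hexp : ∀ ω, (ε 0 ω - τ n (ε 0 ω) + c) ^ 2 =
          (ε 0 ω - τ n (ε 0 ω)) ^ 2 + (2 * c * (ε 0 ω - τ n (ε 0 ω)) + c ^ 2) := fun ω => by ring
      rw [integral_congr_ae (Eventually.of_forall hexp), integral_add hmem.integrable_sq hI1,
        integral_add (hI0.const_mul (2 * c)) (integrable_const _),
        integral_const_mul, integral_sub hεI hτI, hε.mean_zero 0, ← hc]
      simp only [integral_const, probReal_univ, smul_eq_mul, one_mul]
      ring
    rw [hv]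
    nlinarith [sq_nonneg c]

/-- Normalized sums of noise terms with bounded weights depending on the treatments have uniformly
integrable squares: up to a part of small variance they have bounded fourth moments. -/
theorem uniformlySqIntegrable_weighted_noise (hε : IsWhiteNoise P σ ε)
    (hU : IsGeneratedBy P π U ε y0) {w : ℤ → Ω → ℝ}
    (hw : ∀ t, 1 ≤ t → Measurable[treatmentInfo U] (w t)) {B : ℝ} (hB0 : 0 ≤ B)
    (hB : ∀ t, 1 ≤ t → ∀ ω, |w t ω| ≤ B) (k : ℤ) :
    UniformlySqIntegrable P fun (T : ℕ) ω =>
      (√(T : ℝ))⁻¹ * ∑ t ∈ Finset.Icc (1 : ℤ) T, w t ω * ε (t - k) ω := by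
  have hVm : ∀ T : ℕ, ∀ t ∈ Finset.Icc (1 : ℤ) T, Measurable[infoBefore U ε (t - k)] (w t) :=
    fun T t ht => (hw t (Finset.mem_Icc.1 ht).1).mono (treatmentInfo_le_infoBefore U ε _) le_rfl
  have hVb : ∀ T : ℕ, ∀ t ∈ Finset.Icc (1 : ℤ) T, ∀ ω, |w t ω| ≤ B :=
    fun T t ht => hB t (Finset.mem_Icc.1 ht).1
  have hV2 : ∀ T : ℕ, ∀ t ∈ Finset.Icc (1 : ℤ) T, MemLp (w t) 2 P := fun T t ht =>
    MemLp.of_bound ((hVm T t ht).mono (infoBefore_le hε hU _) le_rfl).aestronglyMeasurable B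
      (Eventually.of_forall fun ω => hVb T t ht ω)
  have hcard : ∀ T : ℕ, ((Finset.Icc (1 : ℤ) T).card : ℝ) = T := fun T => by
    rw [Int.card_Icc]
    norm_num
  refine ⟨fun T => ?_, fun δ hδ => ?_⟩
  · exact (integral_sq_weighted_sum hε hU hε.noiseFunction_id k _ (hVm T) (hV2 T)).1.const_mul _
  obtain ⟨g, h, M, hg, hh, hgM, hgh, hη⟩ :=
    exists_bounded_add_small (P := P) hε (η := δ / (4 * (B ^ 2 + 1))) (by positivity)
  have hM0 : 0 ≤ M := (abs_nonneg _).trans (hgM 0)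
  refine ⟨128 * (B * M) ^ 4 / δ + 1, fun K hK T => ?_⟩
  have hK0 : 0 < K := lt_of_lt_of_le (by positivity) hK
  set A : Ω → ℝ := fun ω => (√(T : ℝ))⁻¹ * ∑ t ∈ Finset.Icc (1 : ℤ) T, w t ω * g (ε (t - k) ω)
    with hA
  set C : Ω → ℝ := fun ω => (√(T : ℝ))⁻¹ * ∑ t ∈ Finset.Icc (1 : ℤ) T, w t ω * h (ε (t - k) ω)
    with hC
  have hsplit : ∀ ω, (√(T : ℝ))⁻¹ * ∑ t ∈ Finset.Icc (1 : ℤ) T, w t ω * ε (t - k) ω =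
      A ω + C ω := by
    intro ω
    simp only [hA, hC]
    rw [← mul_add, ← Finset.sum_add_distrib]
    congr 1
    refine Finset.sum_congr rfl fun t _ => ?_
    rw [← mul_add, ← hgh]
  have hAL : MemLp A 2 P :=
    (integral_sq_weighted_sum hε hU hg k _ (hVm T) (hV2 T)).1.const_mul _
  have hCs := integral_sq_weighted_sum hε hU hh k _ (hVm T) (hV2 T)
  have hCL : MemLp C 2 P := hCs.1.const_mul _
  simp only [hsplit]
  refine (integral_excess_add_le hAL hCL K).trans ?_
  have hTsq : ((√(T : ℝ))⁻¹) ^ 2 = (T : ℝ)⁻¹ := by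
    rw [inv_pow, Real.sq_sqrt (Nat.cast_nonneg T)]
  have hC2 : ∫ ω, max (C ω ^ 2 - K / 4) 0 ∂P ≤ δ / 4 := by
    calc ∫ ω, max (C ω ^ 2 - K / 4) 0 ∂P ≤ ∫ ω, C ω ^ 2 ∂P :=
          integral_mono (integrable_excess hCL _) hCL.integrable_sq fun ω =>
            max_le (by linarith) (sq_nonneg _)
      _ = (T : ℝ)⁻¹ * ((∫ ω, h (ε 0 ω) ^ 2 ∂P) *
            ∑ t ∈ Finset.Icc (1 : ℤ) T, ∫ ω, w t ω ^ 2 ∂P) := by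
          simp only [hC, mul_pow, hTsq]
          rw [integral_const_mul, hCs.2]
      _ ≤ (T : ℝ)⁻¹ * (δ / (4 * (B ^ 2 + 1)) * (T * B ^ 2)) := by
          refine mul_le_mul_of_nonneg_left (mul_le_mul hη ?_
            (Finset.sum_nonneg fun t _ => integral_nonneg fun ω => sq_nonneg _)
            (by positivity)) (by positivity)
          · rw [← hcard T, ← nsmul_eq_mul]
            refine Finset.sum_le_card_nsmul _ _ _ fun t ht => ?_
            have := integral_mono (μ := P) ((hV2 T t ht).integrable_sq) (integrable_const (B ^ 2))
              fun ω => sq_le_sq' (neg_le_of_abs_le (hVb T t ht ω)) (le_of_abs_le (hVb T t ht ω))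
            simpa using this
      _ = ((T : ℝ)⁻¹ * T) * (δ / 4 * (B ^ 2 / (B ^ 2 + 1))) := by field_simp
      _ ≤ 1 * (δ / 4 * 1) := by
          gcongr
          · exact inv_mul_le_one
          · rw [div_le_one (by positivity)]
            linarith
      _ = δ / 4 := by ring
  have hA2 : ∫ ω, max (A ω ^ 2 - K / 4) 0 ∂P ≤ δ / 4 := by
    -- the excess over a high level is controlled by the fourth moment
    have hpt : ∀ ω, max (A ω ^ 2 - K / 4) 0 ≤ 4 / K * A ω ^ 4 := by
      intro ω
      refine max_le ?_ (by positivity)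
      rw [div_mul_eq_mul_div, le_div_iff₀ hK0]
      nlinarith [sq_nonneg (2 * A ω ^ 2 - K / 2), sq_nonneg (A ω)]
    have hAb : ∀ ω, |A ω| ≤ (√(T : ℝ))⁻¹ * (T * (B * M)) := by
      intro ω
      rw [hA, abs_mul, abs_of_nonneg (by positivity : 0 ≤ (√(T : ℝ))⁻¹)]
      refine mul_le_mul_of_nonneg_left ?_ (by positivity)
      refine (Finset.abs_sum_le_sum_abs _ _).trans ?_
      rw [← hcard T, ← nsmul_eq_mul]
      refine Finset.sum_le_card_nsmul _ _ _ fun t ht => ?_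
      rw [abs_mul]
      exact mul_le_mul (hVb T t ht ω) (hgM _) (abs_nonneg _) hB0
    have hA4 : Integrable (fun ω => A ω ^ 4) P := by
      refine Integrable.of_bound (hAL.aestronglyMeasurable.pow 4)
        (((√(T : ℝ))⁻¹ * (T * (B * M))) ^ 4) (Eventually.of_forall fun ω => ?_)
      rw [Real.norm_eq_abs, abs_pow]
      exact pow_le_pow_left₀ (abs_nonneg _) (hAb ω) 4
    calc ∫ ω, max (A ω ^ 2 - K / 4) 0 ∂P ≤ ∫ ω, 4 / K * A ω ^ 4 ∂P :=
          integral_mono (integrable_excess hAL _) (hA4.const_mul _) hpt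
      _ = 4 / K * ((T : ℝ)⁻¹ ^ 2 *
            ∫ ω, (∑ t ∈ Finset.Icc (1 : ℤ) T, w t ω * g (ε (t - k) ω)) ^ 4 ∂P) := by
          have h4 : ((√(T : ℝ))⁻¹) ^ 4 = (T : ℝ)⁻¹ ^ 2 := by
            rw [← hTsq]
            ring
          rw [integral_const_mul]
          simp only [hA, mul_pow, h4]
          rw [integral_const_mul]
      _ ≤ 4 / K * ((T : ℝ)⁻¹ ^ 2 * (8 * (B * M) ^ 4 * (T : ℝ) ^ 2)) := by
          gcongr
          have := integral_pow_four_weighted_sum_le hε hU hg hgM k _ (hVm T) hB0 (hVb T)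
          rwa [hcard T] at this
      _ = 32 * (B * M) ^ 4 / K * ((T : ℝ)⁻¹ * T) ^ 2 := by ring
      _ ≤ 32 * (B * M) ^ 4 / K * 1 ^ 2 := by
          gcongr
          exact inv_mul_le_one
      _ ≤ δ / 4 := by
          rw [one_pow, mul_one, div_le_iff₀ hK0]
          have : 128 * (B * M) ^ 4 / δ ≤ K := by linarith
          rw [div_le_iff₀ hδ] at this
          linarith
  linarith

/-- The squares of `T^{-1/2} ∑_{t ≤ T} w_t Z_t` are uniformly integrable. -/
theorem uniformlySqIntegrable_weighted_residual {p q : ℕ} (m : Params p q)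
    (hε : IsWhiteNoise P σ ε) (hU : IsGeneratedBy P π U ε y0) {w : ℤ → Ω → ℝ}
    (hw : ∀ t, 1 ≤ t → Measurable[treatmentInfo U] (w t)) {B : ℝ} (hB0 : 0 ≤ B)
    (hB : ∀ t, 1 ≤ t → ∀ ω, |w t ω| ≤ B) :
    UniformlySqIntegrable P fun (T : ℕ) ω =>
      (√(T : ℝ))⁻¹ * ∑ t ∈ Finset.Icc (1 : ℤ) T, w t ω * m.residual (fun s => ε s ω) t := by
  have h := UniformlySqIntegrable.sum (P := P) (s := (Finset.univ : Finset (Fin (q + 1))))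
    (X := fun j (T : ℕ) ω => (√(T : ℝ))⁻¹ * ∑ t ∈ Finset.Icc (1 : ℤ) T,
      (m.θ j * w t ω) * ε (t - (j : ℕ)) ω) fun j _ =>
      uniformlySqIntegrable_weighted_noise hε hU (fun t ht => (hw t ht).const_mul (m.θ j))
        (B := |m.θ j| * B) (by positivity) (fun t ht ω => by
          rw [abs_mul]
          exact mul_le_mul_of_nonneg_left (hB t ht ω) (abs_nonneg _)) _
  convert h using 3 with T ω
  rw [← Finset.mul_sum, Finset.sum_comm]
  congr 1
  refine Finset.sum_congr rfl fun t _ => ?_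
  rw [Params.residual, Finset.mul_sum]
  exact Finset.sum_congr rfl fun j _ => by ring

end WeightedNoise

/-! ### Laws of large numbers for the sample moments -/

section SampleMoment

variable {p q : ℕ}

theorem sampleMoment_add (T : ℕ) (f g : ℤ → ℝ) :
    sampleMoment p q T (fun t => f t + g t) = sampleMoment p q T f + sampleMoment p q T g := by
  simp only [sampleMoment, Finset.sum_add_distrib, mul_add]

theorem sampleMoment_const_mul (T : ℕ) (c : ℝ) (f : ℤ → ℝ) :
    sampleMoment p q T (fun t => c * f t) = c * sampleMoment p q T f := by
  simp only [sampleMoment, ← Finset.mul_sum]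
  ring

theorem sampleMoment_sum {α : Type*} (s : Finset α) (T : ℕ) (f : α → ℤ → ℝ) :
    sampleMoment p q T (fun t => ∑ a ∈ s, f a t) = ∑ a ∈ s, sampleMoment p q T (f a) := by
  simp only [sampleMoment, ← Finset.mul_sum]
  rw [Finset.sum_comm]

theorem sampleMoment_congr {T : ℕ} {f g : ℤ → ℝ}
    (h : ∀ t ∈ Finset.Icc ((p : ℤ) + q + 1) T, f t = g t) :
    sampleMoment p q T f = sampleMoment p q T g := by
  rw [sampleMoment, sampleMoment, Finset.sum_congr rfl h]

/-- With `T = n + p + q` periods, the sample moments are averages of `n` terms. -/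
theorem sampleMoment_add_lag (n : ℕ) (f : ℤ → ℝ) :
    sampleMoment p q (n + (p + q)) f =
      (n : ℝ)⁻¹ * ∑ i ∈ Finset.range n, f ((i : ℤ) + (p + q + 1)) := by
  rw [sampleMoment]
  congr 1
  · push_cast
    congr 1
    ring
  · symm
    refine Finset.sum_bij' (fun i _ => (i : ℤ) + (p + q + 1))
      (fun t _ => (t - (p + q + 1)).toNat) ?_ ?_ ?_ ?_ ?_
    · intro i hi
      rw [Finset.mem_range] at hi
      rw [Finset.mem_Icc]
      push_cast
      omega
    · intro t ht
      rw [Finset.mem_Icc] at ht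
      push_cast at ht
      rw [Finset.mem_range]
      omega
    · intro i _
      omega
    · intro t ht
      rw [Finset.mem_Icc] at ht
      push_cast at ht
      omega
    · intro i _
      rfl

theorem card_sampleIndex (n : ℕ) :
    ((Finset.Icc ((p : ℤ) + q + 1) ((n + (p + q) : ℕ) : ℤ)).card : ℝ) = n := by
  rw [Int.card_Icc]
  push_cast
  congr 1
  omega

theorem sampleMoment_one {n : ℕ} (hn : 0 < n) :
    sampleMoment p q (n + (p + q)) (fun _ => 1) = 1 := by
  rw [sampleMoment_add_lag]
  have : (n : ℝ) ≠ 0 := by positivity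
  simp [this]

theorem sq_sum_mul_le {α : Type*} (s : Finset α) (c x : α → ℝ) :
    (∑ a ∈ s, c a * x a) ^ 2 ≤ (∑ a ∈ s, |c a|) * ∑ a ∈ s, |c a| * x a ^ 2 :=
  Finset.sum_sq_le_sum_mul_sum_of_sq_le_mul s (fun a _ => abs_nonneg _)
    (fun a _ => by positivity) fun a _ => by
      rw [mul_pow, ← sq_abs (c a)]
      exact le_of_eq (by ring)

/-- The Cauchy–Schwarz inequality for sample moments. -/
theorem abs_sampleMoment_mul_le (n : ℕ) (f g : ℤ → ℝ) :
    |sampleMoment p q (n + (p + q)) fun t => f t * g t| ≤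
      √(sampleMoment p q (n + (p + q)) fun t => f t ^ 2) *
        √(sampleMoment p q (n + (p + q)) fun t => g t ^ 2) := by
  have hN : (0 : ℝ) ≤ ((n + (p + q) : ℕ) : ℝ) - p - q := by
    push_cast
    linarith [Nat.cast_nonneg (α := ℝ) n]
  simp only [sampleMoment]
  set s := Finset.Icc ((p : ℤ) + q + 1) ((n + (p + q) : ℕ) : ℤ)
  set c := (((n + (p + q) : ℕ) : ℝ) - p - q)⁻¹
  have hc : 0 ≤ c := inv_nonneg.2 hN
  rw [← Real.sqrt_mul (mul_nonneg hc (Finset.sum_nonneg fun _ _ => sq_nonneg _))]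
  refine Real.abs_le_sqrt ?_
  rw [mul_pow]
  calc c ^ 2 * (∑ t ∈ s, f t * g t) ^ 2 ≤ c ^ 2 * ((∑ t ∈ s, f t ^ 2) * ∑ t ∈ s, g t ^ 2) :=
        mul_le_mul_of_nonneg_left (Finset.sum_mul_sq_le_sq_mul_sq s f g) (sq_nonneg c)
    _ = _ := by ring

end SampleMoment

section CutNoise

variable {Ω : Type*} {p q : ℕ}

/-- The noise path set to zero at and before time `-q`, which makes filtered paths finite sums of
any sufficient length. -/
def cutNoise (q : ℕ) (e : ℤ → ℝ) (s : ℤ) : ℝ := if -(q : ℤ) < s then e s else 0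

theorem filt_eq_sum_cutNoise (κ : ℕ → ℝ) (e : ℤ → ℝ) (t : ℤ) {L : ℕ} (hL : t + q ≤ L) :
    filt κ q e t = ∑ n ∈ Finset.range L, κ n * cutNoise q e (t - n) := by
  have h1 : filt κ q e t = ∑ n ∈ Finset.range (t + q).toNat, κ n * cutNoise q e (t - n) := by
    refine Finset.sum_congr rfl fun n hn => ?_
    rw [Finset.mem_range] at hn
    rw [cutNoise, if_pos (by omega)]
  rw [h1]
  refine Finset.sum_subset (Finset.range_mono (by omega)) fun n _ hn => ?_
  rw [Finset.mem_range] at hn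
  rw [cutNoise, if_neg (by omega), mul_zero]

theorem measurable_cutNoise (U ε : ℤ → Ω → ℝ) {s r : ℤ} (h : s < r) :
    Measurable[infoBefore U ε r] fun ω => cutNoise q (fun r => ε r ω) s := by
  unfold cutNoise
  split_ifs
  · exact measurable_noise_info U ε h
  · exact measurable_const

/-- The product moments of the noise at lags `k` and `k'`. -/
def noiseMoment (p q : ℕ) (ε : ℤ → Ω → ℝ) (T k k' : ℕ) (ω : Ω) : ℝ :=
  sampleMoment p q T fun t =>
    cutNoise q (fun r => ε r ω) (t - k) * cutNoise q (fun r => ε r ω) (t - k')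

/-- The limit of the product moments of the noise. -/
def noiseCov (σ : ℝ) (k k' : ℕ) : ℝ := if k = k' then σ ^ 2 else 0

variable [mΩ : MeasurableSpace Ω] {P : Measure Ω} {σ : ℝ} {ε : ℤ → Ω → ℝ}

theorem memLp_cutNoise (hε : IsWhiteNoise P σ ε) (s : ℤ) :
    MemLp (fun ω => cutNoise q (fun r => ε r ω) s) 2 P := by
  unfold cutNoise
  split_ifs
  · exact hε.memLp s
  · exact MemLp.zero'

theorem integrable_cutNoise_mul (hε : IsWhiteNoise P σ ε) (s r : ℤ) :
    Integrable (fun ω => cutNoise q (fun r => ε r ω) s * cutNoise q (fun r => ε r ω) r) P :=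
  (memLp_cutNoise hε s).integrable_mul (memLp_cutNoise hε r)

theorem integrable_noiseMoment (hε : IsWhiteNoise P σ ε) (T k k' : ℕ) :
    Integrable (noiseMoment p q ε T k k') P := by
  unfold noiseMoment sampleMoment
  exact (integrable_finsetSum _ fun t _ => integrable_cutNoise_mul hε _ _).const_mul _

end CutNoise

section Laws

variable {Ω : Type*} [mΩ : MeasurableSpace Ω] {P : Measure Ω} [IsProbabilityMeasure P] {σ : ℝ}
  {ε y0 U : ℤ → Ω → ℝ} {π : Design} {p q : ℕ}

theorem integral_abs_weighted_sum_le (hε : IsWhiteNoise P σ ε) (hU : IsGeneratedBy P π U ε y0)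
    (k : ℤ) (s : Finset ℤ) {V : ℤ → Ω → ℝ}
    (hVm : ∀ t ∈ s, Measurable[infoBefore U ε (t - k)] (V t))
    (hV2 : ∀ t ∈ s, MemLp (V t) 2 P) {B : ℝ} (hB : ∀ t ∈ s, ∫ ω, V t ω ^ 2 ∂P ≤ B) :
    Integrable (fun ω => ∑ t ∈ s, V t ω * ε (t - k) ω) P ∧
      ∫ ω, |∑ t ∈ s, V t ω * ε (t - k) ω| ∂P ≤ √(σ ^ 2 * (s.card * B)) := by
  obtain ⟨h1, h2⟩ := integral_sq_weighted_sum hε hU hε.noiseFunction_id k s hVm hV2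
  simp only [id] at h1 h2
  refine ⟨h1.integrable (by norm_num), (integral_abs_le_sqrt h1).trans (Real.sqrt_le_sqrt ?_)⟩
  rw [h2, integral_sq_noise hε]
  refine mul_le_mul_of_nonneg_left ?_ (sq_nonneg _)
  rw [← nsmul_eq_mul]
  exact Finset.sum_le_card_nsmul _ _ _ hB

theorem integral_abs_sampleMoment_weighted_le (hε : IsWhiteNoise P σ ε)
    (hU : IsGeneratedBy P π U ε y0) (k : ℤ) {n : ℕ} {V : ℤ → Ω → ℝ}
    (hVm : ∀ t, (p : ℤ) + q + 1 ≤ t → Measurable[infoBefore U ε (t - k)] (V t))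
    (hV2 : ∀ t, (p : ℤ) + q + 1 ≤ t → MemLp (V t) 2 P) {B : ℝ}
    (hB : ∀ t, (p : ℤ) + q + 1 ≤ t → ∫ ω, V t ω ^ 2 ∂P ≤ B) :
    Integrable (fun ω => sampleMoment p q (n + (p + q)) fun t => V t ω * ε (t - k) ω) P ∧
      ∫ ω, |sampleMoment p q (n + (p + q)) fun t => V t ω * ε (t - k) ω| ∂P
        ≤ √(σ ^ 2 * B) * (√(n : ℝ))⁻¹ := by
  obtain ⟨h1, h2⟩ := integral_abs_weighted_sum_le hε hU k
    (Finset.Icc ((p : ℤ) + q + 1) ((n + (p + q) : ℕ) : ℤ))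
    (fun t ht => hVm t (Finset.mem_Icc.1 ht).1) (fun t ht => hV2 t (Finset.mem_Icc.1 ht).1)
    (fun t ht => hB t (Finset.mem_Icc.1 ht).1)
  have hN : ((n + (p + q) : ℕ) : ℝ) - p - q = n := by
    push_cast
    ring
  simp only [sampleMoment, hN]
  refine ⟨h1.const_mul _, ?_⟩
  simp only [abs_mul, abs_inv, Nat.abs_cast]
  rw [integral_const_mul]
  rw [card_sampleIndex] at h2
  have h3 : √(σ ^ 2 * (n * B)) = √(n : ℝ) * √(σ ^ 2 * B) := by
    rw [← Real.sqrt_mul (Nat.cast_nonneg n)]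
    congr 1
    ring
  calc (n : ℝ)⁻¹ * _ ≤ (n : ℝ)⁻¹ * (√(n : ℝ) * √(σ ^ 2 * B)) := by
        rw [← h3]
        exact mul_le_mul_of_nonneg_left h2 (by positivity)
    _ = √(σ ^ 2 * B) * (√(n : ℝ))⁻¹ := by
        rcases Nat.eq_zero_or_pos n with rfl | hn
        · simp
        · have : 0 < √(n : ℝ) := Real.sqrt_pos.2 (by exact_mod_cast hn)
          have h4 : (n : ℝ)⁻¹ = (√(n : ℝ))⁻¹ * (√(n : ℝ))⁻¹ := by
            rw [← mul_inv, Real.mul_self_sqrt (Nat.cast_nonneg n)]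
          rw [h4]
          field_simp

theorem integral_sq_cutNoise_le (hε : IsWhiteNoise P σ ε) (s : ℤ) :
    ∫ ω, cutNoise q (fun r => ε r ω) s ^ 2 ∂P ≤ σ ^ 2 := by
  unfold cutNoise
  split_ifs
  · exact (integral_sq_noise hε s).le
  · simpa using sq_nonneg σ

theorem integral_abs_noiseMoment_sub_le (hε : IsWhiteNoise P σ ε) (n k k' : ℕ) :
    ∫ ω, |noiseMoment p q ε (n + (p + q)) k k' ω - noiseCov σ k k'| ∂P ≤ 2 * σ ^ 2 := by
  have hI := integrable_noiseMoment (p := p) (q := q) hε (n + (p + q)) k k'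
  have hprod : ∀ s r : ℤ,
      ∫ ω, |cutNoise q (fun r => ε r ω) s * cutNoise q (fun r => ε r ω) r| ∂P ≤ σ ^ 2 := by
    intro s r
    have hs := (memLp_cutNoise (q := q) hε s).integrable_sq
    have hr := (memLp_cutNoise (q := q) hε r).integrable_sq
    calc _ ≤ ∫ ω, 1 / 2 * (cutNoise q (fun r => ε r ω) s ^ 2) +
          1 / 2 * (cutNoise q (fun r => ε r ω) r ^ 2) ∂P := by
          refine integral_mono (integrable_cutNoise_mul hε s r).abs
            ((hs.const_mul _).add (hr.const_mul _)) fun ω => ?_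
          dsimp only
          rw [abs_mul, ← sq_abs (cutNoise q (fun r => ε r ω) s),
            ← sq_abs (cutNoise q (fun r => ε r ω) r)]
          nlinarith [sq_nonneg (|cutNoise q (fun r => ε r ω) s| -
            |cutNoise q (fun r => ε r ω) r|)]
      _ ≤ σ ^ 2 := by
          rw [integral_add (hs.const_mul _) (hr.const_mul _), integral_const_mul,
            integral_const_mul]
          linarith [integral_sq_cutNoise_le (q := q) hε s, integral_sq_cutNoise_le (q := q) hε r]
  have h1 : ∫ ω, |noiseMoment p q ε (n + (p + q)) k k' ω| ∂P ≤ σ ^ 2 := by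
    calc _ ≤ ∫ ω, (n : ℝ)⁻¹ * ∑ i ∈ Finset.range n,
          |cutNoise q (fun r => ε r ω) ((i : ℤ) + (p + q + 1) - k) *
            cutNoise q (fun r => ε r ω) ((i : ℤ) + (p + q + 1) - k')| ∂P := by
          refine integral_mono hI.abs ((integrable_finsetSum _ fun i _ =>
            (integrable_cutNoise_mul hε _ _).abs).const_mul _) fun ω => ?_
          dsimp only
          rw [noiseMoment, sampleMoment_add_lag, abs_mul, abs_inv, Nat.abs_cast]
          exact mul_le_mul_of_nonneg_left (Finset.abs_sum_le_sum_abs _ _) (by positivity)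
      _ ≤ (n : ℝ)⁻¹ * (n * σ ^ 2) := by
          rw [integral_const_mul,
            integral_finsetSum _ fun i _ => (integrable_cutNoise_mul hε _ _).abs]
          refine mul_le_mul_of_nonneg_left ?_ (by positivity)
          refine (Finset.sum_le_card_nsmul _ _ _ fun i _ => hprod _ _).trans_eq ?_
          rw [Finset.card_range, nsmul_eq_mul]
      _ = ((n : ℝ)⁻¹ * n) * σ ^ 2 := by ring
      _ ≤ 1 * σ ^ 2 := mul_le_mul_of_nonneg_right inv_mul_le_one (sq_nonneg _)
      _ = σ ^ 2 := one_mul _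
  have h2 : |noiseCov σ k k'| ≤ σ ^ 2 := by
    unfold noiseCov
    split_ifs
    · rw [abs_of_nonneg (sq_nonneg _)]
    · simpa using sq_nonneg σ
  calc _ ≤ ∫ ω, |noiseMoment p q ε (n + (p + q)) k k' ω| + σ ^ 2 ∂P :=
        integral_mono (hI.sub (integrable_const _)).abs (hI.abs.add (integrable_const _))
          fun ω => (abs_sub _ _).trans (by dsimp only; linarith)
    _ ≤ 2 * σ ^ 2 := by
        rw [integral_add hI.abs (integrable_const _)]
        simp only [integral_const, probReal_univ, smul_eq_mul, one_mul]
        linarith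

theorem tendsto_inv_sqrt_nat : Tendsto (fun n : ℕ => (√(n : ℝ))⁻¹) atTop (𝓝 0) :=
  tendsto_inv_atTop_zero.comp (Real.tendsto_sqrt_atTop.comp tendsto_natCast_atTop_atTop)

/-- Noise terms at different lags are asymptotically uncorrelated. -/
theorem tendsto_noiseMoment_of_lt (hε : IsWhiteNoise P σ ε) (hU : IsGeneratedBy P π U ε y0)
    {k k' : ℕ} (hk : k < k') :
    Tendsto (fun n : ℕ => ∫ ω, |noiseMoment p q ε (n + (p + q)) k k' ω| ∂P) atTop (𝓝 0) := by
  refine squeeze_zero (fun n => integral_nonneg fun ω => abs_nonneg _) (fun n => ?_)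
    (by simpa using tendsto_inv_sqrt_nat.const_mul (√(σ ^ 2 * σ ^ 2)))
  have h := integral_abs_sampleMoment_weighted_le (p := p) (q := q) hε hU (k : ℤ) (n := n)
    (V := fun t ω => (if -(q : ℤ) < t - k then 1 else 0) * cutNoise q (fun r => ε r ω) (t - k'))
    (fun t _ => (measurable_cutNoise U ε (by omega)).const_mul _)
    (fun t _ => (memLp_cutNoise hε _).const_mul _) (B := σ ^ 2) (fun t _ => by
      split_ifs
      · simpa using integral_sq_cutNoise_le hε _
      · simpa using sq_nonneg σ)
  refine le_trans (le_of_eq ?_) h.2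
  refine integral_congr_ae (Eventually.of_forall fun ω => ?_)
  simp only [noiseMoment]
  congr 2
  funext t
  rw [cutNoise]
  split_ifs <;> ring

/-- The law of large numbers for the squared noise, in `L¹`. -/
theorem tendsto_noiseMoment_self (hε : IsWhiteNoise P σ ε) (k : ℕ) :
    Tendsto (fun n : ℕ => ∫ ω, |noiseMoment p q ε (n + (p + q)) k k ω - σ ^ 2| ∂P)
      atTop (𝓝 0) := by
  set X : ℕ → Ω → ℝ := fun i ω => ε ((i : ℤ) + (p + q + 1) - k) ω ^ 2 with hX
  have hXI : ∀ i, Integrable (X i) P := fun i => (hε.memLp _).integrable_sq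
  have hX0 : ∫ ω, X 0 ω ∂P = σ ^ 2 := integral_sq_noise hε _
  have hlaw := strong_law_Lp (μ := P) (p := 1) le_rfl (by norm_num) X
    (memLp_one_iff_integrable.2 (hXI 0)) (fun i j hij => by
      refine IndepFun.comp (φ := fun x : ℝ => x ^ 2) (ψ := fun x : ℝ => x ^ 2)
        (hε.indep.indepFun (fun h => hij ?_)) (by fun_prop) (by fun_prop)
      omega) (fun i => by
        have h := (hε.identDistrib ((i : ℤ) + (p + q + 1) - k)).trans
          (hε.identDistrib (((0 : ℕ) : ℤ) + (p + q + 1) - k)).symm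
        exact h.comp (u := fun x : ℝ => x ^ 2) (by fun_prop))
  have hlaw' : Tendsto (fun n : ℕ => ∫ ω, |(n : ℝ)⁻¹ * ∑ i ∈ Finset.range n, X i ω - σ ^ 2| ∂P)
      atTop (𝓝 0) := by
    have h := (ENNReal.tendsto_toReal ENNReal.zero_ne_top).comp hlaw
    rw [ENNReal.toReal_zero] at h
    refine h.congr fun n => ?_
    simp only [Function.comp_apply, hX0, smul_eq_mul]
    rw [eLpNorm_one_eq_lintegral_enorm, ← integral_norm_eq_lintegral_enorm]
    · rfl
    · exact (((integrable_finsetSum _ fun i _ => hXI i).const_mul _).sub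
        (integrable_const _)).aestronglyMeasurable
  -- cutting the noise affects at most `k` summands
  have hcut : ∀ n : ℕ, ∀ ω, |noiseMoment p q ε (n + (p + q)) k k ω - σ ^ 2| ≤
      |(n : ℝ)⁻¹ * ∑ i ∈ Finset.range n, X i ω - σ ^ 2| +
        (n : ℝ)⁻¹ * ∑ i ∈ Finset.range k, X i ω := by
    intro n ω
    have h1 : noiseMoment p q ε (n + (p + q)) k k ω = (n : ℝ)⁻¹ * ∑ i ∈ Finset.range n, X i ω -
        (n : ℝ)⁻¹ * ∑ i ∈ Finset.range n, (if i < k then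
          (if -(q : ℤ) < (i : ℤ) + (p + q + 1) - k then 0 else X i ω) else 0) := by
      rw [noiseMoment, sampleMoment_add_lag, ← mul_sub, ← Finset.sum_sub_distrib]
      congr 1
      refine Finset.sum_congr rfl fun i _ => ?_
      simp only [cutNoise, hX]
      split_ifs
      · ring
      · ring
      · ring
      · omega
    have hX0' : ∀ i, 0 ≤ X i ω := fun i => sq_nonneg _
    have h2 : ∑ i ∈ Finset.range n, (if i < k then
        (if -(q : ℤ) < (i : ℤ) + (p + q + 1) - k then 0 else X i ω) else 0) ≤
        ∑ i ∈ Finset.range k, X i ω := by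
      calc _ ≤ ∑ i ∈ Finset.range n, (if i < k then X i ω else 0) := by
            refine Finset.sum_le_sum fun i _ => ?_
            split_ifs
            · exact hX0' i
            · exact le_rfl
            · exact le_rfl
        _ = ∑ i ∈ (Finset.range n).filter (· < k), X i ω := (Finset.sum_filter _ _).symm
        _ ≤ _ := Finset.sum_le_sum_of_subset_of_nonneg (fun i hi => by
              rw [Finset.mem_range]
              exact (Finset.mem_filter.1 hi).2) fun i _ _ => hX0' i
    have h3 : 0 ≤ ∑ i ∈ Finset.range n, (if i < k then
        (if -(q : ℤ) < (i : ℤ) + (p + q + 1) - k then 0 else X i ω) else 0) := by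
      refine Finset.sum_nonneg fun i _ => ?_
      split_ifs
      · exact le_rfl
      · exact hX0' i
      · exact le_rfl
    rw [h1, sub_right_comm]
    refine (abs_sub _ _).trans (add_le_add_right ?_ _)
    rw [abs_of_nonneg (mul_nonneg (by positivity) h3)]
    exact mul_le_mul_of_nonneg_left h2 (by positivity)
  have hsum : ∀ m : ℕ, Integrable (fun ω => ∑ i ∈ Finset.range m, X i ω) P := fun m =>
    integrable_finsetSum _ fun i _ => hXI i
  refine squeeze_zero (fun n => integral_nonneg fun ω => abs_nonneg _)
    (g := fun n : ℕ => ∫ ω, |(n : ℝ)⁻¹ * ∑ i ∈ Finset.range n, X i ω - σ ^ 2| ∂P +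
      (n : ℝ)⁻¹ * ∫ ω, ∑ i ∈ Finset.range k, X i ω ∂P) (fun n => ?_) ?_
  · rw [← integral_const_mul, ← integral_add]
    · exact integral_mono ((integrable_noiseMoment hε _ _ _).sub (integrable_const _)).abs
        ((((hsum n).const_mul _).sub (integrable_const _)).abs.add ((hsum k).const_mul _))
        (hcut n)
    · exact (((hsum n).const_mul _).sub (integrable_const _)).abs
    · exact (hsum k).const_mul _
  · simpa using hlaw'.add ((tendsto_inv_atTop_zero.comp tendsto_natCast_atTop_atTop).mul_const
      (∫ ω, ∑ i ∈ Finset.range k, X i ω ∂P))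

theorem tendsto_noiseMoment (hε : IsWhiteNoise P σ ε) (hU : IsGeneratedBy P π U ε y0)
    (k k' : ℕ) :
    Tendsto (fun n : ℕ => ∫ ω, |noiseMoment p q ε (n + (p + q)) k k' ω - noiseCov σ k k'| ∂P)
      atTop (𝓝 0) := by
  rcases lt_trichotomy k k' with h | rfl | h
  · simpa [noiseCov, h.ne] using tendsto_noiseMoment_of_lt hε hU h
  · simpa [noiseCov] using tendsto_noiseMoment_self hε k
  · have hsymm : ∀ T ω, noiseMoment p q ε T k k' ω = noiseMoment p q ε T k' k ω := by
      intro T ω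
      simp only [noiseMoment, mul_comm]
    simpa [noiseCov, h.ne', hsymm] using tendsto_noiseMoment_of_lt (p := p) (q := q) hε hU h

end Laws

/-! ### Sample moments of the filtered noise -/

/-- The ARMA noise driven by the noise after time `-q`. -/
def armaNoise {Ω : Type*} {p q : ℕ} (m : Params p q) (ε : ℤ → Ω → ℝ) (t : ℤ) (ω : Ω) : ℝ :=
  filt m.psi q (fun s => ε s ω) t

theorem measurable_armaNoise {Ω : Type*} {p q : ℕ} (m : Params p q) (U ε : ℤ → Ω → ℝ)
    {t r : ℤ} (h : t < r) : Measurable[infoBefore U ε r] (armaNoise m ε t) := by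
  unfold armaNoise filt
  exact Finset.measurable_fun_sum _ fun n _ =>
    (measurable_noise_info U ε (by omega)).const_mul _

section ArmaNoise

variable {Ω : Type*} [mΩ : MeasurableSpace Ω] {P : Measure Ω} {σ : ℝ}
  {ε y0 U : ℤ → Ω → ℝ} {π : Design} {p q : ℕ}

theorem memLp_armaNoise (m : Params p q) (hε : IsWhiteNoise P σ ε) (t : ℤ) :
    MemLp (armaNoise m ε t) 2 P := by
  unfold armaNoise filt
  exact memLp_finsetSum _ fun n _ => (hε.memLp _).const_mul _

variable [IsProbabilityMeasure P]

theorem integral_armaNoise (m : Params p q) (hε : IsWhiteNoise P σ ε) (t : ℤ) :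
    ∫ ω, armaNoise m ε t ω ∂P = 0 := by
  unfold armaNoise filt
  rw [integral_finsetSum _ fun n _ => ((hε.memLp _).integrable (by norm_num)).const_mul _]
  refine Finset.sum_eq_zero fun n _ => ?_
  rw [integral_const_mul, hε.mean_zero, mul_zero]

/-- The total variation `∑ |ψ_n|` of the impulse response. -/
def Params.psiNorm (m : Params p q) : ℝ := ∑' n, |m.psi n|

theorem psiNorm_nonneg (m : Params p q) : 0 ≤ m.psiNorm := tsum_nonneg fun _ => abs_nonneg _

theorem sum_abs_psi_le (m : Params p q) (hroot : m.NoUnitRoot) (s : Finset ℕ) :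
    ∑ n ∈ s, |m.psi n| ≤ m.psiNorm :=
  (m.summable_abs_psi hroot).sum_le_tsum s fun _ _ => abs_nonneg _

theorem integral_sq_armaNoise_le (m : Params p q) (hroot : m.NoUnitRoot)
    (hε : IsWhiteNoise P σ ε) (t : ℤ) :
    ∫ ω, armaNoise m ε t ω ^ 2 ∂P ≤ m.psiNorm ^ 2 * σ ^ 2 := by
  set s := Finset.range (t + q).toNat with hs
  have hI : Integrable (fun ω => ∑ n ∈ s, |m.psi n| * ε (t - n) ω ^ 2) P :=
    integrable_finsetSum _ fun n _ => (hε.memLp _).integrable_sq.const_mul _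
  calc ∫ ω, armaNoise m ε t ω ^ 2 ∂P
      ≤ ∫ ω, (∑ n ∈ s, |m.psi n|) * ∑ n ∈ s, |m.psi n| * ε (t - n) ω ^ 2 ∂P :=
        integral_mono (memLp_armaNoise m hε t).integrable_sq (hI.const_mul _)
          fun ω => sq_sum_mul_le s m.psi fun n => ε (t - n) ω
    _ = (∑ n ∈ s, |m.psi n|) * ((∑ n ∈ s, |m.psi n|) * σ ^ 2) := by
        rw [integral_const_mul,
          integral_finsetSum _ fun n _ => (hε.memLp _).integrable_sq.const_mul _]
        congr 1
        rw [Finset.sum_mul]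
        refine Finset.sum_congr rfl fun n _ => ?_
        rw [integral_const_mul, integral_sq_noise hε]
    _ ≤ m.psiNorm * (m.psiNorm * σ ^ 2) := by
        have h := sum_abs_psi_le m hroot s
        have h0 : 0 ≤ ∑ n ∈ s, |m.psi n| := Finset.sum_nonneg fun _ _ => abs_nonneg _
        have := psiNorm_nonneg m
        gcongr
    _ = _ := by ring

/-- The sample covariance of the ARMA noise with a bounded function of the treatments vanishes. -/
theorem integral_abs_sampleMoment_mul_armaNoise_le (m : Params p q) (hroot : m.NoUnitRoot)
    (hε : IsWhiteNoise P σ ε) (hU : IsGeneratedBy P π U ε y0) {w : ℤ → Ω → ℝ}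
    (hw : ∀ t, 1 ≤ t → Measurable[treatmentInfo U] (w t)) {B : ℝ} (hB0 : 0 ≤ B)
    (hB : ∀ t, 1 ≤ t → ∀ ω, |w t ω| ≤ B) (h n : ℕ) :
    Integrable (fun ω => sampleMoment p q (n + (p + q)) fun t => w t ω * armaNoise m ε (t - h) ω) P
      ∧ ∫ ω, |sampleMoment p q (n + (p + q)) fun t => w t ω * armaNoise m ε (t - h) ω| ∂P ≤
        m.psiNorm * (√(σ ^ 2 * B ^ 2) * (√(n : ℝ))⁻¹) := by
  set V : ℕ → ℤ → Ω → ℝ := fun k t ω =>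
    w t ω * (if -(q : ℤ) < t - h - k then 1 else 0) with hV
  set L := n + (p + q) + q with hL
  have hVw : ∀ k t ω, 1 ≤ t → |V k t ω| ≤ B := by
    intro k t ω ht
    simp only [hV]
    split_ifs
    · simpa using hB t ht ω
    · simpa using hB0
  have hVm : ∀ k t, 1 ≤ t → Measurable[treatmentInfo U] (V k t) := fun k t ht =>
    (hw t ht).mul_const _
  have hexp : ∀ ω, (sampleMoment p q (n + (p + q)) fun t => w t ω * armaNoise m ε (t - h) ω) =
      ∑ k ∈ Finset.range L, m.psi k *
        sampleMoment p q (n + (p + q)) fun t => V k t ω * ε (t - ((h + k : ℕ) : ℤ)) ω := by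
    intro ω
    simp only [← sampleMoment_const_mul]
    rw [← sampleMoment_sum]
    refine sampleMoment_congr fun t ht => ?_
    rw [Finset.mem_Icc] at ht
    rw [armaNoise, filt_eq_sum_cutNoise _ _ _ (L := L) (by omega), Finset.mul_sum]
    refine Finset.sum_congr rfl fun k _ => ?_
    simp only [cutNoise, hV]
    have : t - ((h + k : ℕ) : ℤ) = t - h - k := by push_cast; ring
    rw [this]
    split_ifs <;> ring
  have hterm : ∀ k, _ := fun k : ℕ =>
    integral_abs_sampleMoment_weighted_le (p := p) (q := q) hε hU ((h + k : ℕ) : ℤ) (n := n)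
      (V := V k) (fun t ht => (hVm k t (by omega)).mono (treatmentInfo_le_infoBefore U ε _) le_rfl)
      (fun t ht => MemLp.of_bound
        ((hVm k t (by omega)).mono (treatmentInfo_le hU) le_rfl).aestronglyMeasurable B
        (Eventually.of_forall fun ω => hVw k t ω (by omega)))
      (B := B ^ 2) (fun t ht => by
        have hm : MemLp (V k t) 2 P := MemLp.of_bound
          ((hVm k t (by omega)).mono (treatmentInfo_le hU) le_rfl).aestronglyMeasurable B
          (Eventually.of_forall fun ω => hVw k t ω (by omega))
        have := integral_mono (μ := P) hm.integrable_sq (integrable_const (B ^ 2)) fun ω =>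
          sq_le_sq' (neg_le_of_abs_le (hVw k t ω (by omega)))
            (le_of_abs_le (hVw k t ω (by omega)))
        simpa using this)
  simp only [hexp]
  refine ⟨integrable_finsetSum _ fun k _ => (hterm k).1.const_mul _, ?_⟩
  calc _ ≤ ∫ ω, ∑ k ∈ Finset.range L, |m.psi k| * |sampleMoment p q (n + (p + q)) fun t =>
          V k t ω * ε (t - ((h + k : ℕ) : ℤ)) ω| ∂P := by
        refine integral_mono (integrable_finsetSum _ fun k _ => (hterm k).1.const_mul _).abs
          (integrable_finsetSum _ fun k _ => (hterm k).1.abs.const_mul _) fun ω => ?_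
        refine (Finset.abs_sum_le_sum_abs _ _).trans_eq ?_
        simp only [abs_mul]
    _ = ∑ k ∈ Finset.range L, |m.psi k| * ∫ ω, |sampleMoment p q (n + (p + q)) fun t =>
          V k t ω * ε (t - ((h + k : ℕ) : ℤ)) ω| ∂P := by
        rw [integral_finsetSum _ fun k _ => (hterm k).1.abs.const_mul _]
        simp only [integral_const_mul]
    _ ≤ ∑ k ∈ Finset.range L, |m.psi k| * (√(σ ^ 2 * B ^ 2) * (√(n : ℝ))⁻¹) :=
        Finset.sum_le_sum fun k _ => mul_le_mul_of_nonneg_left (hterm k).2 (abs_nonneg _)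
    _ ≤ _ := by
        rw [← Finset.sum_mul]
        exact mul_le_mul_of_nonneg_right (sum_abs_psi_le m hroot _) (by positivity)

/-- Sample covariances of the residual with predictable weights are of order `n^{-1/2}`. -/
theorem integral_abs_sampleMoment_mul_residual_le (m : Params p q) (hε : IsWhiteNoise P σ ε)
    (hU : IsGeneratedBy P π U ε y0) {V : ℤ → Ω → ℝ}
    (hVm : ∀ t, (p : ℤ) + q + 1 ≤ t → Measurable[infoBefore U ε (t - q)] (V t))
    (hV2 : ∀ t, (p : ℤ) + q + 1 ≤ t → MemLp (V t) 2 P) {B : ℝ}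
    (hB : ∀ t, (p : ℤ) + q + 1 ≤ t → ∫ ω, V t ω ^ 2 ∂P ≤ B) (n : ℕ) :
    Integrable (fun ω => sampleMoment p q (n + (p + q)) fun t =>
        V t ω * m.residual (fun s => ε s ω) t) P ∧
      ∫ ω, |sampleMoment p q (n + (p + q)) fun t => V t ω * m.residual (fun s => ε s ω) t| ∂P ≤
        (∑ j, |m.θ j|) * (√(σ ^ 2 * B) * (√(n : ℝ))⁻¹) := by
  have hexp : ∀ ω, (sampleMoment p q (n + (p + q)) fun t =>
      V t ω * m.residual (fun s => ε s ω) t) = ∑ j : Fin (q + 1), m.θ j *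
        sampleMoment p q (n + (p + q)) fun t => V t ω * ε (t - ((j : ℕ) : ℤ)) ω := by
    intro ω
    simp only [← sampleMoment_const_mul]
    rw [← sampleMoment_sum]
    refine sampleMoment_congr fun t _ => ?_
    rw [Params.residual, Finset.mul_sum]
    exact Finset.sum_congr rfl fun j _ => by ring
  have hterm : ∀ j : Fin (q + 1), _ := fun j =>
    integral_abs_sampleMoment_weighted_le (p := p) (q := q) hε hU ((j : ℕ) : ℤ) (n := n)
      (V := V) (fun t ht => (hVm t ht).mono
        (infoBefore_mono U ε (by have := j.2; omega)) le_rfl) hV2 hB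
  simp only [hexp]
  refine ⟨integrable_finsetSum _ fun j _ => (hterm j).1.const_mul _, ?_⟩
  calc _ ≤ ∫ ω, ∑ j : Fin (q + 1), |m.θ j| * |sampleMoment p q (n + (p + q)) fun t =>
          V t ω * ε (t - ((j : ℕ) : ℤ)) ω| ∂P := by
        refine integral_mono (integrable_finsetSum _ fun j _ => (hterm j).1.const_mul _).abs
          (integrable_finsetSum _ fun j _ => (hterm j).1.abs.const_mul _) fun ω => ?_
        refine (Finset.abs_sum_le_sum_abs _ _).trans_eq ?_
        simp only [abs_mul]
    _ = ∑ j : Fin (q + 1), |m.θ j| * ∫ ω, |sampleMoment p q (n + (p + q)) fun t =>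
          V t ω * ε (t - ((j : ℕ) : ℤ)) ω| ∂P := by
        rw [integral_finsetSum _ fun j _ => (hterm j).1.abs.const_mul _]
        simp only [integral_const_mul]
    _ ≤ _ := by
        rw [Finset.sum_mul]
        exact Finset.sum_le_sum fun j _ => mul_le_mul_of_nonneg_left (hterm j).2 (abs_nonneg _)

/-- The autocovariance at lag `h - h'` as a double series over the impulse response, in which only
the pairs hitting the same noise variable contribute. -/
theorem Params.hasSum_autocov (m : Params p q) (hroot : m.NoUnitRoot)
    (σ : ℝ) (h h' : ℕ) :
    HasSum (fun x : ℕ × ℕ => m.psi x.1 * m.psi x.2 * noiseCov σ (h + x.1) (h' + x.2))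
      (m.autocov σ ((h : ℤ) - h')) := by
  have hsum : Summable fun x : ℕ × ℕ => |m.psi x.1| * |m.psi x.2| :=
    (m.summable_abs_psi hroot).mul_of_nonneg (m.summable_abs_psi hroot)
      (fun _ => abs_nonneg _) fun _ => abs_nonneg _
  -- the case `h ≤ h'`, up to exchanging the two variables
  have key : ∀ d : ℕ, HasSum (fun x : ℕ × ℕ =>
      m.psi x.1 * m.psi x.2 * (if x.1 = x.2 + d then σ ^ 2 else 0))
      (σ ^ 2 * ∑' n, m.psi n * m.psi (n + d)) := by
    intro d
    have hinj : Function.Injective fun n : ℕ => (n + d, n) := fun a b hab => (Prod.ext_iff.1 hab).2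
    rw [← hinj.hasSum_iff]
    · have hs : Summable fun n : ℕ => m.psi n * m.psi (n + d) := by
        have h1 := hsum.comp_injective hinj
        refine Summable.of_abs (h1.congr fun n => ?_)
        simp [abs_mul, mul_comm]
      refine (hs.hasSum.mul_left (σ ^ 2)).congr_fun ?_
      intro n
      simp only [Function.comp_apply, if_true]
      ring
    · rintro ⟨a, b⟩ hab
      rw [if_neg, mul_zero]
      rintro hab'
      exact hab ⟨b, by simp only at hab' ⊢; rw [hab']⟩
  rw [Params.autocov]
  rcases le_total h h' with hle | hle
  · obtain ⟨d, rfl⟩ := Nat.exists_eq_add_of_le hle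
    have e1 : ((h : ℤ) - ((h + d : ℕ) : ℤ)).natAbs = d := by omega
    rw [e1]
    refine (key d).congr_fun fun x => ?_
    have : h + x.1 = h + d + x.2 ↔ x.1 = x.2 + d := by omega
    simp only [noiseCov, this]
  · obtain ⟨d, rfl⟩ := Nat.exists_eq_add_of_le hle
    have e1 : (((h' + d : ℕ) : ℤ) - (h' : ℤ)).natAbs = d := by omega
    rw [e1]
    have hk := (Equiv.prodComm ℕ ℕ).hasSum_iff.2 (key d)
    refine hk.congr_fun fun x => ?_
    have : h' + d + x.1 = h' + x.2 ↔ x.2 = x.1 + d := by omega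
    simp only [noiseCov, this, Function.comp_apply, Equiv.prodComm_apply, Prod.fst_swap,
      Prod.snd_swap, mul_comm (m.psi x.1)]
    congr

/-- The sample autocovariances of the ARMA noise converge in `L¹`, by dominated convergence in the
double series over the impulse response. -/
theorem tendsto_sampleMoment_armaNoise (m : Params p q) (hroot : m.NoUnitRoot)
    (hε : IsWhiteNoise P σ ε) (hU : IsGeneratedBy P π U ε y0) (h h' : ℕ) :
    Tendsto (fun n : ℕ => ∫ ω, |(sampleMoment p q (n + (p + q)) fun t =>
        armaNoise m ε (t - h) ω * armaNoise m ε (t - h') ω) - m.autocov σ ((h : ℤ) - h')| ∂P)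
      atTop (𝓝 0) := by
  set a : ℕ → ℕ × ℕ → ℝ := fun n x =>
    ∫ ω, |noiseMoment p q ε (n + (p + q)) (h + x.1) (h' + x.2) ω
      - noiseCov σ (h + x.1) (h' + x.2)| ∂P with ha
  have ha0 : ∀ n x, 0 ≤ a n x := fun n x => integral_nonneg fun ω => abs_nonneg _
  have hsum : Summable fun x : ℕ × ℕ => |m.psi x.1| * |m.psi x.2| :=
    (m.summable_abs_psi hroot).mul_of_nonneg (m.summable_abs_psi hroot)
      (fun _ => abs_nonneg _) fun _ => abs_nonneg _
  have hbd : ∀ n x, |m.psi x.1| * |m.psi x.2| * a n x ≤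
      |m.psi x.1| * |m.psi x.2| * (2 * σ ^ 2) := fun n x =>
    mul_le_mul_of_nonneg_left (integral_abs_noiseMoment_sub_le hε n _ _) (by positivity)
  have hlim1 : Tendsto (fun n => ∑' x : ℕ × ℕ, |m.psi x.1| * |m.psi x.2| * a n x) atTop (𝓝 0) := by
    have h0 : (0 : ℝ) = ∑' _x : ℕ × ℕ, (0 : ℝ) := by simp
    rw [h0]
    refine tendsto_tsum_of_dominated_convergence (hsum.mul_right (2 * σ ^ 2)) (fun x => ?_)
      (Eventually.of_forall fun n x => ?_)
    · simpa using (tendsto_noiseMoment (p := p) (q := q) hε hU (h + x.1) (h' + x.2)).const_mul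
        (|m.psi x.1| * |m.psi x.2|)
    · rw [Real.norm_of_nonneg (mul_nonneg (by positivity) (ha0 n x))]
      exact hbd n x
  set s : ℕ → Finset (ℕ × ℕ) := fun n =>
    Finset.range (n + (p + q) + q) ×ˢ Finset.range (n + (p + q) + q) with hs
  have hslim : Tendsto s atTop atTop := by
    refine tendsto_atTop_finset_of_monotone (fun a b hab => ?_) fun x => ?_
    · exact Finset.product_subset_product (Finset.range_mono (by omega))
        (Finset.range_mono (by omega))
    · refine ⟨x.1 + x.2 + 1, ?_⟩
      simp only [hs, Finset.mem_product, Finset.mem_range]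
      omega
  have hlim2 : Tendsto (fun n => |∑ x ∈ s n, m.psi x.1 * m.psi x.2 *
      noiseCov σ (h + x.1) (h' + x.2) - m.autocov σ ((h : ℤ) - h')|) atTop (𝓝 0) := by
    have h1 := (m.hasSum_autocov hroot σ h h').comp hslim
    have h2 := (h1.sub_const (m.autocov σ ((h : ℤ) - h'))).abs
    simpa using h2
  have hexp : ∀ n ω, (sampleMoment p q (n + (p + q)) fun t =>
      armaNoise m ε (t - h) ω * armaNoise m ε (t - h') ω) = ∑ x ∈ s n, m.psi x.1 * m.psi x.2 *
        noiseMoment p q ε (n + (p + q)) (h + x.1) (h' + x.2) ω := by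
    intro n ω
    simp only [noiseMoment, ← sampleMoment_const_mul]
    rw [← sampleMoment_sum]
    refine sampleMoment_congr fun t ht => ?_
    rw [Finset.mem_Icc] at ht
    rw [armaNoise, armaNoise, filt_eq_sum_cutNoise _ _ _ (L := n + (p + q) + q) (by omega),
      filt_eq_sum_cutNoise _ _ (t - h') (L := n + (p + q) + q) (by omega), Finset.sum_mul_sum,
      ← Finset.sum_product']
    refine Finset.sum_congr rfl fun x _ => ?_
    have e1 : t - ((h + x.1 : ℕ) : ℤ) = t - h - x.1 := by push_cast; ring
    have e2 : t - ((h' + x.2 : ℕ) : ℤ) = t - h' - x.2 := by push_cast; ring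
    rw [e1, e2]
    ring
  refine squeeze_zero (fun n => integral_nonneg fun ω => abs_nonneg _) (fun n => ?_)
    (by simpa using hlim1.add hlim2)
  have hI : ∀ x : ℕ × ℕ, Integrable (fun ω => |m.psi x.1| * |m.psi x.2| *
      |noiseMoment p q ε (n + (p + q)) (h + x.1) (h' + x.2) ω
        - noiseCov σ (h + x.1) (h' + x.2)|) P := fun x =>
    ((integrable_noiseMoment hε _ _ _).sub (integrable_const _)).abs.const_mul _
  simp only [hexp]
  calc _ ≤ ∫ ω, ∑ x ∈ s n, |m.psi x.1| * |m.psi x.2| *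
          |noiseMoment p q ε (n + (p + q)) (h + x.1) (h' + x.2) ω
            - noiseCov σ (h + x.1) (h' + x.2)| + |∑ x ∈ s n, m.psi x.1 * m.psi x.2 *
      noiseCov σ (h + x.1) (h' + x.2) - m.autocov σ ((h : ℤ) - h')| ∂P := by
        refine integral_mono ((integrable_finsetSum _ fun x _ =>
          (integrable_noiseMoment hε _ _ _).const_mul _).sub (integrable_const _)).abs
          ((integrable_finsetSum _ fun x _ => hI x).add (integrable_const _)) fun ω => ?_
        dsimp only
        refine (abs_sub_le _ (∑ x ∈ s n, m.psi x.1 * m.psi x.2 *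
          noiseCov σ (h + x.1) (h' + x.2)) _).trans (add_le_add_left ?_ _)
        rw [← Finset.sum_sub_distrib]
        refine (Finset.abs_sum_le_sum_abs _ _).trans_eq ?_
        refine Finset.sum_congr rfl fun x _ => ?_
        rw [← mul_sub, abs_mul, abs_mul]
    _ = ∑ x ∈ s n, |m.psi x.1| * |m.psi x.2| * a n x + |∑ x ∈ s n, m.psi x.1 * m.psi x.2 *
          noiseCov σ (h + x.1) (h' + x.2) - m.autocov σ ((h : ℤ) - h')| := by
        rw [integral_add (integrable_finsetSum _ fun x _ => hI x) (integrable_const _),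
          integral_finsetSum _ fun x _ => hI x]
        simp only [integral_const_mul, integral_const, probReal_univ, one_smul, ha]
    _ ≤ _ := by
        refine add_le_add_left ?_ _
        refine Summable.sum_le_tsum _ (fun x _ => mul_nonneg (by positivity) (ha0 n x)) ?_
        exact Summable.of_nonneg_of_le (fun x => mul_nonneg (by positivity) (ha0 n x)) (hbd n)
          (hsum.mul_right _)

end ArmaNoise

/-! ### Limits of the empirical moments of the outcome -/

section Limits

variable {Ω ι : Type*} {σ ξ : ℝ}
  {ε y0 U : ℤ → Ω → ℝ} {π : Design} {p q : ℕ} {l : Filter ι} {n : ι → ℕ} {b : ι → ℝ}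

/-- The sample moments over the times after `p + q`, in terms of averages over all times. -/
theorem sampleMoment_eq_average {N : ℕ} (hN : 0 < N) (f : ℤ → ℝ) :
    sampleMoment p q (N + (p + q)) f =
      (1 + ((p + q : ℕ) : ℝ) * (N : ℝ)⁻¹) * (((N + (p + q) : ℕ) : ℝ)⁻¹ *
        ∑ t ∈ Finset.Icc (1 : ℤ) ((N + (p + q) : ℕ) : ℤ), f t)
      - (N : ℝ)⁻¹ * ∑ t ∈ Finset.Icc (1 : ℤ) ((p + q : ℕ) : ℤ), f t := by
  have hsplit : ∑ t ∈ Finset.Icc (1 : ℤ) ((N + (p + q) : ℕ) : ℤ), f t =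
      ∑ t ∈ Finset.Icc (1 : ℤ) ((p + q : ℕ) : ℤ), f t +
        ∑ t ∈ Finset.Icc ((p : ℤ) + q + 1) ((N + (p + q) : ℕ) : ℤ), f t := by
    rw [← Finset.sum_union]
    · congr 1
      ext t
      simp only [Finset.mem_union, Finset.mem_Icc]
      push_cast
      omega
    · rw [Finset.disjoint_left]
      intro t h1 h2
      rw [Finset.mem_Icc] at h1 h2
      push_cast at h1 h2
      omega
  have hN' : (N : ℝ) ≠ 0 := by positivity
  have hNT : ((N + (p + q) : ℕ) : ℝ) ≠ 0 := by positivity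
  have h1 : (1 + ((p + q : ℕ) : ℝ) * (N : ℝ)⁻¹) * ((N + (p + q) : ℕ) : ℝ)⁻¹ = (N : ℝ)⁻¹ := by
    push_cast at hNT ⊢
    field_simp
  have h2 : ((N + (p + q) : ℕ) : ℝ) - p - q = N := by
    push_cast
    ring
  rw [sampleMoment, h2, ← mul_assoc, h1, hsplit]
  ring

/-- The cumulative effect of the treatments on the outcome, per unit of the control coefficient. -/
def treatmentEffect (m : Params p q) (U : ℤ → Ω → ℝ) (t : ℤ) (ω : Ω) : ℝ :=
  filt m.phi 0 (fun s => U s ω) t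

/-- The total variation `∑ |φ_n|` of the autoregressive impulse response. -/
def Params.phiNorm (m : Params p q) : ℝ := ∑' n, |m.phi n|

theorem measurable_treatmentEffect (m : Params p q) (U : ℤ → Ω → ℝ) (t : ℤ) :
    Measurable[treatmentInfo U] (treatmentEffect m U t) := by
  unfold treatmentEffect filt
  refine Finset.measurable_fun_sum _ fun k hk => ?_
  rw [Finset.mem_range] at hk
  exact (measurable_treatment_info U (by omega)).const_mul _

/-- The transient part of the outcome along the random path. -/
def transientEffect (m : Params p q) (y0 ε : ℤ → Ω → ℝ) (t : ℤ) (ω : Ω) : ℝ :=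
  m.transient (fun s => y0 s ω) (fun s => ε s ω) t

/-- The random size of the transient. -/
def transientSize (m : Params p q) (y0 ε : ℤ → Ω → ℝ) (ω : Ω) : ℝ :=
  m.initialSize (fun s => y0 s ω) (fun s => ε s ω)

theorem transientSize_nonneg (m : Params p q) (y0 ε : ℤ → Ω → ℝ) (ω : Ω) :
    0 ≤ transientSize m y0 ε ω := m.initialSize_nonneg _ _

theorem observed_eq (m : Params p q) (hroot : m.NoUnitRoot) (b : ℝ) (t : ℤ) (ω : Ω) :
    observed m b y0 U ε ω t = m.mean + armaNoise m ε t ω +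
      (b * treatmentEffect m U t ω + transientEffect m y0 ε t ω) := by
  rw [observed, Params.outcome_eq m hroot, add_assoc]
  rfl

variable [mΩ : MeasurableSpace Ω] {P : Measure Ω}

theorem abs_treatment (hU : IsGeneratedBy P π U ε y0) {t : ℤ} (ht : 1 ≤ t) (ω : Ω) :
    |U t ω| = 1 := by
  rcases hU.values t ht ω with h | h <;> simp [h]

theorem abs_treatmentEffect_le (m : Params p q) (hroot : m.NoUnitRoot)
    (hU : IsGeneratedBy P π U ε y0) (t : ℤ) (ω : Ω) : |treatmentEffect m U t ω| ≤ m.phiNorm := by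
  unfold treatmentEffect filt
  refine (Finset.abs_sum_le_sum_abs _ _).trans ?_
  refine le_trans (Finset.sum_le_sum fun k hk => ?_)
    ((m.summable_abs_phi hroot).sum_le_tsum (Finset.range (t + 0).toNat) fun _ _ => abs_nonneg _)
  rw [Finset.mem_range] at hk
  rw [abs_mul, abs_treatment hU (by omega), mul_one]

variable [IsProbabilityMeasure P]

theorem integrable_transientSize (m : Params p q) (hε : IsWhiteNoise P σ ε)
    (hy0 : ∀ t, Integrable (y0 t) P) : Integrable (transientSize m y0 ε) P := by
  unfold transientSize Params.initialSize Params.initialForcing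
  refine integrable_finsetSum _ fun k _ => Integrable.abs ?_
  refine integrable_finsetSum _ fun j _ => ?_
  split_ifs
  · exact (((hy0 _).sub (integrable_const _)).sub
      ((memLp_armaNoise m hε _).integrable (by norm_num))).const_mul _
  · exact integrable_zero _ _ _

/-- The total mass of the decay profile of the transient. -/
def Params.decayNorm (m : Params p q) : ℝ := ∑' t : ℕ, m.decay t

theorem decayNorm_nonneg (m : Params p q) : 0 ≤ m.decayNorm := tsum_nonneg fun _ => m.decay_nonneg _

/-- Over any window of positive times the decay profile has mass at most `decayNorm`. -/
theorem sum_decay_le (m : Params p q) (hroot : m.NoUnitRoot) (N : ℕ) {c : ℤ} (hc : 0 ≤ c) :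
    ∑ i ∈ Finset.range N, m.decay ((i : ℤ) + c) ≤ m.decayNorm := by
  obtain ⟨d, rfl⟩ := Int.eq_ofNat_of_zero_le hc
  have h1 : ∑ i ∈ Finset.range N, m.decay ((i : ℤ) + d) =
      ∑ t ∈ (Finset.range N).map (addRightEmbedding d), m.decay ((t : ℕ) : ℤ) := by
    rw [Finset.sum_map]
    simp
  rw [h1]
  exact (m.summable_decay hroot).sum_le_tsum _ fun _ _ => m.decay_nonneg _

theorem tendsto_inv_natCast (hn : Tendsto n l atTop) :
    Tendsto (fun i => ((n i : ℝ))⁻¹) l (𝓝 0) :=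
  tendsto_inv_atTop_zero.comp (tendsto_natCast_atTop_atTop.comp hn)

/-- The mean squared size of the part of the outcome due to the treatments and the initial values
vanishes as the control coefficient does. -/
theorem tendsto_sampleMoment_effect_sq (m : Params p q) (hroot : m.NoUnitRoot)
    (hε : IsWhiteNoise P σ ε) (hU : IsGeneratedBy P π U ε y0) (hy0 : ∀ t, Integrable (y0 t) P)
    (hn : Tendsto n l atTop) (hb : Tendsto b l (𝓝 0)) {h : ℕ} (hh : h ≤ p + q) :
    TendstoInMeasure P (fun i ω => sampleMoment p q (n i + (p + q)) fun t =>
      (b i * treatmentEffect m U (t - h) ω + transientEffect m y0 ε (t - h) ω) ^ 2) l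
      fun _ => 0 := by
  have hbound : ∀ i ω, |sampleMoment p q (n i + (p + q)) fun t =>
      (b i * treatmentEffect m U (t - h) ω + transientEffect m y0 ε (t - h) ω) ^ 2| ≤
      |2 * (b i ^ 2 * m.phiNorm ^ 2) +
        transientSize m y0 ε ω ^ 2 * (2 * m.decayNorm ^ 2 * ((n i : ℝ))⁻¹)| := by
    intro i ω
    have hM := transientSize_nonneg m y0 ε ω
    have hK := decayNorm_nonneg m
    rw [sampleMoment_add_lag, abs_of_nonneg (by positivity), abs_of_nonneg (by positivity)]
    have hterm : ∀ k ∈ Finset.range (n i), (b i * treatmentEffect m U ((k : ℤ) + (p + q + 1) - h) ω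
        + transientEffect m y0 ε ((k : ℤ) + (p + q + 1) - h) ω) ^ 2 ≤
        2 * (b i ^ 2 * m.phiNorm ^ 2) + 2 * transientSize m y0 ε ω ^ 2 * m.decayNorm *
          m.decay ((k : ℤ) + (p + q + 1 - h)) := by
      intro k _
      rw [add_sub_assoc]
      set t : ℤ := (k : ℤ) + (p + q + 1 - h) with ht
      have h1 : treatmentEffect m U t ω ^ 2 ≤ m.phiNorm ^ 2 := by
        have := abs_treatmentEffect_le m hroot hU t ω
        exact sq_le_sq' (neg_le_of_abs_le this) (le_of_abs_le this)
      have h2 : transientEffect m y0 ε t ω ^ 2 ≤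
          transientSize m y0 ε ω ^ 2 * (m.decayNorm * m.decay t) := by
        have h3 : |transientEffect m y0 ε t ω| ≤ transientSize m y0 ε ω * m.decay t :=
          m.abs_transient_le _ _ t (by omega)
        have h4 : m.decay t ≤ m.decayNorm := by
          have := sum_decay_le m hroot 1 (c := t) (by omega)
          simpa using this
        rw [← sq_abs]
        calc |transientEffect m y0 ε t ω| ^ 2 ≤ (transientSize m y0 ε ω * m.decay t) ^ 2 :=
              pow_le_pow_left₀ (abs_nonneg _) h3 2
          _ = transientSize m y0 ε ω ^ 2 * (m.decay t * m.decay t) := by ring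
          _ ≤ _ := by
              have := m.decay_nonneg t
              gcongr
      have h5 : b i ^ 2 * treatmentEffect m U t ω ^ 2 ≤ b i ^ 2 * m.phiNorm ^ 2 :=
        mul_le_mul_of_nonneg_left h1 (sq_nonneg _)
      nlinarith [sq_nonneg (b i * treatmentEffect m U t ω - transientEffect m y0 ε t ω)]
    calc _ ≤ ((n i : ℝ))⁻¹ * ∑ k ∈ Finset.range (n i), (2 * (b i ^ 2 * m.phiNorm ^ 2) +
          2 * transientSize m y0 ε ω ^ 2 * m.decayNorm * m.decay ((k : ℤ) + (p + q + 1 - h))) :=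
          mul_le_mul_of_nonneg_left (Finset.sum_le_sum hterm) (by positivity)
      _ = ((n i : ℝ)⁻¹ * n i) * (2 * (b i ^ 2 * m.phiNorm ^ 2)) + ((n i : ℝ))⁻¹ *
          (2 * transientSize m y0 ε ω ^ 2 * m.decayNorm) *
            ∑ k ∈ Finset.range (n i), m.decay ((k : ℤ) + (p + q + 1 - h)) := by
          rw [Finset.sum_add_distrib, Finset.sum_const, Finset.card_range, nsmul_eq_mul,
            ← Finset.mul_sum]
          ring
      _ ≤ 1 * (2 * (b i ^ 2 * m.phiNorm ^ 2)) + ((n i : ℝ))⁻¹ *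
          (2 * transientSize m y0 ε ω ^ 2 * m.decayNorm) * m.decayNorm := by
          have := sum_decay_le m hroot (n i) (c := (p + q + 1 - h : ℤ)) (by omega)
          gcongr
          exact inv_mul_le_one
      _ = _ := by ring
  refine tendstoInMeasure_zero_of_abs_le ?_ (Eventually.of_forall hbound)
  refine TendstoInMeasure.add_zero_limits ?_ (BoundedInProb.mul_tendsto_zero ?_ ?_)
  · refine tendstoInMeasure_of_tendsto_real ?_
    simpa using ((hb.pow 2).mul_const (m.phiNorm ^ 2)).const_mul 2
  · have := boundedInProb_of_integrable (l := l) (integrable_transientSize m hε hy0)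
    simpa only [pow_two] using this.mul this
  · refine tendstoInMeasure_of_tendsto_real ?_
    simpa using (tendsto_inv_natCast hn).const_mul (2 * m.decayNorm ^ 2)

theorem BoundedInProb.sqrt {X : ι → Ω → ℝ} (hX : BoundedInProb P l X) :
    BoundedInProb P l fun i ω => √(X i ω) := by
  have habs : BoundedInProb P l fun i ω => |X i ω| :=
    hX.of_abs_le (Eventually.of_forall fun i ω => by simp)
  refine ((boundedInProb_const (P := P) (l := l) 1).add habs).of_abs_le
    (Eventually.of_forall fun i ω => ?_)
  rw [abs_of_nonneg (Real.sqrt_nonneg _), abs_of_nonneg (by positivity)]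
  refine Real.sqrt_le_iff.2 ⟨by positivity, ?_⟩
  nlinarith [le_abs_self (X i ω), abs_nonneg (X i ω)]

/-- Products with an asymptotically vanishing factor have vanishing sample moments. -/
theorem tendsto_sampleMoment_mul {F G : ι → Ω → ℤ → ℝ}
    (hF : TendstoInMeasure P (fun i ω => sampleMoment p q (n i + (p + q)) fun t => F i ω t ^ 2) l
      fun _ => 0)
    (hG : BoundedInProb P l fun i ω => sampleMoment p q (n i + (p + q)) fun t => G i ω t ^ 2) :
    TendstoInMeasure P (fun i ω => sampleMoment p q (n i + (p + q)) fun t => F i ω t * G i ω t) l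
      fun _ => 0 := by
  have hF' : TendstoInMeasure P (fun i ω =>
      √(sampleMoment p q (n i + (p + q)) fun t => F i ω t ^ 2)) l fun _ => 0 := by
    have := tendstoInMeasure_continuousAt (α := Unit) (x := fun _ => 0) (fun _ => hF)
      (F := fun v => √(v ())) (Real.continuous_sqrt.comp (continuous_apply ())).continuousAt
    simpa using this
  refine tendstoInMeasure_zero_of_abs_le (hG.sqrt.mul_tendsto_zero hF')
    (Eventually.of_forall fun i ω => ?_)
  rw [abs_of_nonneg (mul_nonneg (Real.sqrt_nonneg _) (Real.sqrt_nonneg _)), mul_comm]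
  exact abs_sampleMoment_mul_le _ _ _

theorem tendsto_inv_sqrt_natCast (hn : Tendsto n l atTop) :
    Tendsto (fun i => (√(n i : ℝ))⁻¹) l (𝓝 0) :=
  tendsto_inv_sqrt_nat.comp hn

theorem boundedInProb_sampleMoment_sq_of_abs_le {w : ℤ → Ω → ℝ} {B : ℝ}
    (hB : ∀ t, 1 ≤ t → ∀ ω, |w t ω| ≤ B) :
    BoundedInProb P l fun i ω => sampleMoment p q (n i + (p + q)) fun t => w t ω ^ 2 := by
  refine (boundedInProb_const (B ^ 2)).of_abs_le (Eventually.of_forall fun i ω => ?_)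
  rw [sampleMoment_add_lag, abs_of_nonneg (by positivity), abs_of_nonneg (by positivity)]
  calc _ ≤ ((n i : ℝ))⁻¹ * (n i * B ^ 2) := by
        refine mul_le_mul_of_nonneg_left ?_ (by positivity)
        refine (Finset.sum_le_card_nsmul _ _ (B ^ 2) fun k _ => ?_).trans_eq ?_
        · exact sq_le_sq' (neg_le_of_abs_le (hB _ (by omega) ω))
            (le_of_abs_le (hB _ (by omega) ω))
        · rw [Finset.card_range, nsmul_eq_mul]
    _ = (((n i : ℝ))⁻¹ * n i) * B ^ 2 := by ring
    _ ≤ 1 * B ^ 2 := mul_le_mul_of_nonneg_right inv_mul_le_one (sq_nonneg _)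
    _ = B ^ 2 := one_mul _

/-- Lagged outcomes are asymptotically uncorrelated with bounded functions of the treatments. -/
theorem tendsto_sampleMoment_mul_observed (m : Params p q) (hroot : m.NoUnitRoot)
    (hε : IsWhiteNoise P σ ε) (hU : IsGeneratedBy P π U ε y0) (hy0 : ∀ t, Integrable (y0 t) P)
    (hn : Tendsto n l atTop) (hb : Tendsto b l (𝓝 0)) {h : ℕ} (hh : h ≤ p + q)
    {w : ℤ → Ω → ℝ} (hw : ∀ t, 1 ≤ t → Measurable[treatmentInfo U] (w t)) {B : ℝ} (hB0 : 0 ≤ B)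
    (hB : ∀ t, 1 ≤ t → ∀ ω, |w t ω| ≤ B) :
    TendstoInMeasure P (fun i ω => sampleMoment p q (n i + (p + q)) fun t =>
      w t ω * (observed m (b i) y0 U ε ω (t - h) - m.mean)) l fun _ => 0 := by
  have h1 : TendstoInMeasure P (fun i ω => sampleMoment p q (n i + (p + q)) fun t =>
      w t ω * armaNoise m ε (t - h) ω) l fun _ => 0 := by
    refine tendstoInMeasure_of_integral_le
      (C := fun i => m.psiNorm * (√(σ ^ 2 * B ^ 2) * (√(n i : ℝ))⁻¹)) ?_
      (Eventually.of_forall fun i =>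
        integral_abs_sampleMoment_mul_armaNoise_le m hroot hε hU hw hB0 hB h (n i))
    simpa using ((tendsto_inv_sqrt_natCast hn).const_mul (√(σ ^ 2 * B ^ 2))).const_mul m.psiNorm
  have h2 := tendsto_sampleMoment_mul (tendsto_sampleMoment_effect_sq m hroot hε hU hy0 hn hb hh)
    (boundedInProb_sampleMoment_sq_of_abs_le (n := n) (p := p) (q := q) (l := l) (P := P) hB)
  refine (h1.add_zero_limits h2).congr_left fun i => Eventually.of_forall fun ω => ?_
  dsimp only
  rw [← sampleMoment_add]
  congr 1
  funext t
  rw [observed_eq m hroot]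
  ring

/-- The sample autocovariances of the outcome converge to the stationary ones. -/
theorem tendsto_sampleMoment_observed_mul (m : Params p q) (hroot : m.NoUnitRoot)
    (hε : IsWhiteNoise P σ ε) (hU : IsGeneratedBy P π U ε y0) (hy0 : ∀ t, Integrable (y0 t) P)
    (hn : Tendsto n l atTop) (hb : Tendsto b l (𝓝 0)) {h h' : ℕ} (hh : h ≤ p + q)
    (hh' : h' ≤ p + q) :
    TendstoInMeasure P (fun i ω => sampleMoment p q (n i + (p + q)) fun t =>
      (observed m (b i) y0 U ε ω (t - h) - m.mean) *
        (observed m (b i) y0 U ε ω (t - h') - m.mean)) l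
      fun _ => m.autocov σ ((h : ℤ) - h') := by
  have hXX : ∀ h h' : ℕ, TendstoInMeasure P (fun i ω => sampleMoment p q (n i + (p + q)) fun t =>
      armaNoise m ε (t - h) ω * armaNoise m ε (t - h') ω) l
      fun _ => m.autocov σ ((h : ℤ) - h') := by
    intro h h'
    have h1 : TendstoInMeasure P (fun i ω => (sampleMoment p q (n i + (p + q)) fun t =>
        armaNoise m ε (t - h) ω * armaNoise m ε (t - h') ω) - m.autocov σ ((h : ℤ) - h')) l
        fun _ => 0 := by
      refine tendstoInMeasure_of_integral_le
        ((tendsto_sampleMoment_armaNoise m hroot hε hU h h').comp hn)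
        (Eventually.of_forall fun i => ⟨?_, le_rfl⟩)
      refine Integrable.sub ?_ (integrable_const _)
      unfold sampleMoment
      exact (integrable_finsetSum _ fun t _ =>
        (memLp_armaNoise m hε _).integrable_mul (memLp_armaNoise m hε _)).const_mul _
    have h2 := h1.add_const_limits (tendstoInMeasure_of_tendsto_real
      (tendsto_const_nhds (x := m.autocov σ ((h : ℤ) - h'))))
    simpa using h2
  have hE : ∀ h, h ≤ p + q → _ := fun h hh =>
    tendsto_sampleMoment_effect_sq m hroot hε hU hy0 hn hb (h := h) hh
  have hX2 : ∀ h : ℕ, BoundedInProb P l fun i ω => sampleMoment p q (n i + (p + q)) fun t =>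
      armaNoise m ε (t - h) ω ^ 2 := by
    intro h
    simpa only [pow_two] using (hXX h h).boundedInProb
  have h1 := tendsto_sampleMoment_mul (hE h hh) (hX2 h')
  have h2 := tendsto_sampleMoment_mul (hE h' hh') (hX2 h)
  have h3 := tendsto_sampleMoment_mul (hE h hh) (hE h' hh').boundedInProb
  have h4 := (hXX h h').add_const_limits ((h1.add_zero_limits h2).add_zero_limits h3)
  rw [add_zero] at h4
  refine h4.congr_left fun i => Eventually.of_forall fun ω => ?_
  dsimp only
  rw [← sampleMoment_add, ← sampleMoment_add, ← sampleMoment_add]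
  congr 1
  funext t
  rw [observed_eq m hroot, observed_eq m hroot]
  ring

/-- The treatment frequency over the sample window. -/
theorem tendsto_sampleMoment_treatment (hU : IsGeneratedBy P π U ε y0)
    (hfreq : TendstoInMeasure P
      (fun (T : ℕ) ω => (T : ℝ)⁻¹ * ∑ t ∈ Finset.Icc (1 : ℤ) T, U t ω) atTop (fun _ => ξ))
    (hn : Tendsto n l atTop) :
    TendstoInMeasure P (fun i ω => sampleMoment p q (n i + (p + q)) fun t => U t ω) l
      fun _ => ξ := by
  have h1 : TendstoInMeasure P (fun i ω => (((n i + (p + q) : ℕ) : ℝ)⁻¹ *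
        ∑ t ∈ Finset.Icc (1 : ℤ) ((n i + (p + q) : ℕ) : ℤ), U t ω)) l fun _ => ξ :=
    hfreq.comp (tendsto_atTop_mono (fun i => Nat.le_add_right (n i) (p + q)) hn)
  have h2 : TendstoInMeasure P (fun i (_ : Ω) => 1 + ((p + q : ℕ) : ℝ) * (n i : ℝ)⁻¹) l
      fun _ => 1 := by
    refine tendstoInMeasure_of_tendsto_real ?_
    simpa using ((tendsto_inv_natCast hn).const_mul ((p + q : ℕ) : ℝ)).const_add 1
  have h3 : TendstoInMeasure P (fun i ω => -((n i : ℝ)⁻¹ *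
      ∑ t ∈ Finset.Icc (1 : ℤ) ((p + q : ℕ) : ℤ), U t ω)) l fun _ => 0 := by
    refine tendstoInMeasure_zero_of_abs_le (Y := fun i _ => (n i : ℝ)⁻¹ * ((p + q : ℕ) : ℝ))
      (tendstoInMeasure_of_tendsto_real ?_) (Eventually.of_forall fun i ω => ?_)
    · simpa using (tendsto_inv_natCast hn).mul_const ((p + q : ℕ) : ℝ)
    · rw [abs_neg, abs_mul, abs_mul]
      refine mul_le_mul_of_nonneg_left ?_ (abs_nonneg _)
      refine (Finset.abs_sum_le_sum_abs _ _).trans ?_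
      rw [Finset.sum_congr rfl fun t ht => abs_treatment hU (Finset.mem_Icc.1 ht).1 ω,
        Finset.sum_const, Int.card_Icc, nsmul_eq_mul, mul_one, add_sub_cancel_right,
        Int.toNat_natCast]
      exact le_abs_self _
  have h4 := (h2.mul_const_limits h1).add_const_limits h3
  rw [one_mul, add_zero] at h4
  refine h4.congr' ?_ EventuallyEq.rfl
  filter_upwards [hn.eventually_gt_atTop 0] with i hi
  refine Eventually.of_forall fun ω => ?_
  dsimp only
  rw [sampleMoment_eq_average hi]
  ring

end Limits

/-! ### The limiting moment matrix -/

section LimitMatrix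

variable {p q : ℕ}

/-- The limiting means of the regressors, which are also those of the instruments. -/
def limitMean (m : Params p q) (ξ : ℝ) : Fin 2 ⊕ Fin p → ℝ :=
  Sum.elim ![ξ, 1] fun _ => m.mean

/-- The limiting covariances of the instruments (rows) with the regressors (columns). -/
def limitCov (m : Params p q) (σ ξ : ℝ) : Matrix (Fin 2 ⊕ Fin p) (Fin 2 ⊕ Fin p) ℝ :=
  Matrix.fromBlocks (Matrix.diagonal ![1 - ξ ^ 2, 0]) 0 0 (m.yuleWalkerMatrix σ)

/-- The limit of the moment matrix as `b → 0`. -/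
def limitMatrix (m : Params p q) (σ ξ : ℝ) : Matrix (Fin 2 ⊕ Fin p) (Fin 2 ⊕ Fin p) ℝ :=
  Matrix.vecMulVec (limitMean m ξ) (limitMean m ξ) + limitCov m σ ξ

theorem limitMatrix_mulVec (m : Params p q) (σ ξ : ℝ) (v : Fin 2 ⊕ Fin p → ℝ)
    (r : Fin 2 ⊕ Fin p) : (limitMatrix m σ ξ).mulVec v r =
      limitMean m ξ r * (limitMean m ξ ⬝ᵥ v) + (limitCov m σ ξ).mulVec v r := by
  rw [limitMatrix, Matrix.add_mulVec, Matrix.vecMulVec_mulVec]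
  simp [mul_comm]

theorem limitMatrix_mulVec_treatment (m : Params p q) (σ ξ : ℝ) (v : Fin 2 ⊕ Fin p → ℝ) :
    (limitMatrix m σ ξ).mulVec v (Sum.inl 0) =
      ξ * (limitMean m ξ ⬝ᵥ v) + (1 - ξ ^ 2) * v (Sum.inl 0) := by
  rw [limitMatrix_mulVec]
  simp [limitCov, limitMean, Matrix.mulVec, Matrix.fromBlocks, dotProduct]

theorem limitMatrix_mulVec_one (m : Params p q) (σ ξ : ℝ) (v : Fin 2 ⊕ Fin p → ℝ) :
    (limitMatrix m σ ξ).mulVec v (Sum.inl 1) = limitMean m ξ ⬝ᵥ v := by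
  rw [limitMatrix_mulVec]
  simp [limitCov, limitMean, Matrix.mulVec, Matrix.fromBlocks, dotProduct]

theorem limitMatrix_mulVec_lag (m : Params p q) (σ ξ : ℝ) (v : Fin 2 ⊕ Fin p → ℝ) (i : Fin p) :
    (limitMatrix m σ ξ).mulVec v (Sum.inr i) = m.mean * (limitMean m ξ ⬝ᵥ v) +
      (m.yuleWalkerMatrix σ).mulVec (fun j => v (Sum.inr j)) i := by
  rw [limitMatrix_mulVec]
  simp [limitCov, limitMean, Matrix.mulVec, Matrix.fromBlocks, dotProduct]

/-- The first equation minus `ξ` times the second one isolates the control coefficient. -/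
theorem limitMatrix_mulVec_treatment_sub (m : Params p q) (σ ξ : ℝ) (v : Fin 2 ⊕ Fin p → ℝ) :
    (limitMatrix m σ ξ).mulVec v (Sum.inl 0) - ξ * (limitMatrix m σ ξ).mulVec v (Sum.inl 1) =
      (1 - ξ ^ 2) * v (Sum.inl 0) := by
  rw [limitMatrix_mulVec_treatment, limitMatrix_mulVec_one]
  ring

theorem det_limitMatrix_ne_zero (m : Params p q) {σ ξ : ℝ}
    (hident : (m.yuleWalkerMatrix σ).det ≠ 0) (hξ : ξ ^ 2 ≠ 1) :
    (limitMatrix m σ ξ).det ≠ 0 := by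
  intro hdet
  obtain ⟨v, hv, hv0⟩ := Matrix.exists_mulVec_eq_zero_iff.2 hdet
  have h0 : v (Sum.inl 0) = 0 := by
    have h := limitMatrix_mulVec_treatment_sub m σ ξ v
    rw [hv0] at h
    have h1 : 1 - ξ ^ 2 ≠ 0 := sub_ne_zero.2 hξ.symm
    simpa [h1] using h.symm
  have h1 : limitMean m ξ ⬝ᵥ v = 0 := by
    rw [← limitMatrix_mulVec_one m σ, hv0]
    rfl
  have h2 : (fun j => v (Sum.inr j)) = 0 := by
    refine Matrix.eq_zero_of_mulVec_eq_zero hident (funext fun i => ?_)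
    have h := limitMatrix_mulVec_lag m σ ξ v i
    rw [hv0, h1, mul_zero, zero_add] at h
    exact h.symm
  have h3 : v (Sum.inl 1) = 0 := by
    have h4 : ∀ j, v (Sum.inr j) = 0 := fun j => congrFun h2 j
    simpa [dotProduct, limitMean, h0, h4] using h1
  refine hv (funext fun r => ?_)
  rcases r with r | j
  · fin_cases r
    · exact h0
    · exact h3
  · exact congrFun h2 j

end LimitMatrix

section MatrixLimit

variable {Ω ι : Type*} [mΩ : MeasurableSpace Ω] {P : Measure Ω} [IsProbabilityMeasure P]
  {σ ξ : ℝ} {ε y0 U : ℤ → Ω → ℝ} {π : Design} {p q : ℕ} {l : Filter ι} {n : ι → ℕ} {b : ι → ℝ}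

theorem tendsto_sampleMoment_const (hn : Tendsto n l atTop) (c : ℝ) :
    TendstoInMeasure P (fun i (_ : Ω) => sampleMoment p q (n i + (p + q)) fun _ => c) l
      fun _ => c := by
  refine (tendstoInMeasure_of_tendsto_real (tendsto_const_nhds (x := c))).congr' ?_
    EventuallyEq.rfl
  filter_upwards [hn.eventually_gt_atTop 0] with i hi
  refine Eventually.of_forall fun ω => ?_
  have h := sampleMoment_const_mul (p := p) (q := q) (n i + (p + q)) c fun _ => 1
  rw [sampleMoment_one hi, mul_one] at h
  simpa using h.symm

/-- The sample moments of a product converge once those of the centered factors do. -/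
theorem tendsto_sampleMoment_centered_mul (hn : Tendsto n l atTop) {x z : ι → Ω → ℤ → ℝ}
    {c d e : ℝ}
    (hx : TendstoInMeasure P (fun i ω => sampleMoment p q (n i + (p + q)) fun t => x i ω t - c) l
      fun _ => 0)
    (hz : TendstoInMeasure P (fun i ω => sampleMoment p q (n i + (p + q)) fun t => z i ω t - d) l
      fun _ => 0)
    (hxz : TendstoInMeasure P (fun i ω => sampleMoment p q (n i + (p + q)) fun t =>
      (x i ω t - c) * (z i ω t - d)) l fun _ => e) :
    TendstoInMeasure P (fun i ω => sampleMoment p q (n i + (p + q)) fun t => x i ω t * z i ω t) l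
      fun _ => c * d + e := by
  have h := ((tendsto_sampleMoment_const (P := P) (p := p) (q := q) hn (c * d)).add_const_limits
    hxz).add_const_limits ((hx.const_mul_zero d).add_zero_limits (hz.const_mul_zero c))
  rw [add_zero] at h
  refine h.congr_left fun i => Eventually.of_forall fun ω => ?_
  dsimp only
  rw [← sampleMoment_const_mul, ← sampleMoment_const_mul, ← sampleMoment_add, ← sampleMoment_add,
    ← sampleMoment_add]
  congr 1
  funext t
  ring

/-- The moment matrix converges in probability, entry by entry. -/
theorem tendsto_momentMatrix (m : Params p q) (hroot : m.NoUnitRoot)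
    (hε : IsWhiteNoise P σ ε) (hU : IsGeneratedBy P π U ε y0) (hy0 : ∀ t, Integrable (y0 t) P)
    (hfreq : TendstoInMeasure P
      (fun (T : ℕ) ω => (T : ℝ)⁻¹ * ∑ t ∈ Finset.Icc (1 : ℤ) T, U t ω) atTop (fun _ => ξ))
    (hn : Tendsto n l atTop) (hb : Tendsto b l (𝓝 0)) (r c : Fin 2 ⊕ Fin p) :
    TendstoInMeasure P (fun i ω => momentMatrix p q (n i + (p + q))
      (observed m (b i) y0 U ε ω) (fun s => U s ω) r c) l fun _ => limitMatrix m σ ξ r c := by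
  have hUm : ∀ t, 1 ≤ t → Measurable[treatmentInfo U] fun ω => U t ω - ξ := fun t ht =>
    (measurable_treatment_info U ht).sub_const ξ
  have hUb : ∀ t, 1 ≤ t → ∀ ω, |U t ω - ξ| ≤ 1 + |ξ| := fun t ht ω =>
    (abs_sub _ _).trans (by rw [abs_treatment hU ht])
  have hzero : TendstoInMeasure P (fun (_ : ι) (_ : Ω) => (0 : ℝ)) l fun _ => 0 :=
    tendstoInMeasure_of_tendsto_real tendsto_const_nhds
  have hlagI : ∀ i : Fin p, q + 1 + (i : ℕ) ≤ p + q := fun i => by omega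
  have hlagR : ∀ j : Fin p, 1 + (j : ℕ) ≤ p + q := fun j => by omega
  have hcU : TendstoInMeasure P (fun i ω => sampleMoment p q (n i + (p + q)) fun t => U t ω - ξ) l
      fun _ => 0 := by
    have h := (tendsto_sampleMoment_treatment (p := p) (q := q) hU hfreq hn).add_const_limits
      (tendsto_sampleMoment_const (P := P) (p := p) (q := q) hn (-ξ))
    rw [add_neg_cancel] at h
    refine h.congr_left fun i => Eventually.of_forall fun ω => ?_
    dsimp only
    rw [← sampleMoment_add]
    rfl
  have hcY : ∀ h, h ≤ p + q → TendstoInMeasure P (fun i ω =>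
      sampleMoment p q (n i + (p + q)) fun t => observed m (b i) y0 U ε ω (t - (h : ℕ)) - m.mean) l
      fun _ => 0 := by
    intro h hh
    have := tendsto_sampleMoment_mul_observed m hroot hε hU hy0 hn hb hh (w := fun _ _ => 1)
      (fun _ _ => measurable_const) zero_le_one (fun _ _ _ => by simp)
    simpa only [one_mul] using this
  have hUY : ∀ h, h ≤ p + q → TendstoInMeasure P (fun i ω =>
      sampleMoment p q (n i + (p + q)) fun t =>
        (U t ω - ξ) * (observed m (b i) y0 U ε ω (t - (h : ℕ)) - m.mean)) l fun _ => 0 :=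
    fun h hh => tendsto_sampleMoment_mul_observed m hroot hε hU hy0 hn hb hh hUm (by positivity) hUb
  have hUU : TendstoInMeasure P (fun i ω => sampleMoment p q (n i + (p + q)) fun t =>
      (U t ω - ξ) * (U t ω - ξ)) l fun _ => 1 - ξ ^ 2 := by
    have h := (tendsto_sampleMoment_const (P := P) (p := p) (q := q) hn
      (1 - ξ ^ 2)).add_const_limits (hcU.const_mul_zero (-2 * ξ))
    rw [add_zero] at h
    refine h.congr_left fun i => Eventually.of_forall fun ω => ?_
    dsimp only
    rw [← sampleMoment_const_mul, ← sampleMoment_add]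
    refine sampleMoment_congr fun t ht => ?_
    have h1 : U t ω ^ 2 = 1 := by
      rw [← sq_abs, abs_treatment hU (by rw [Finset.mem_Icc] at ht; omega), one_pow]
    nlinarith
  have hinst : ∀ r : Fin 2 ⊕ Fin p, TendstoInMeasure P (fun i ω =>
      sampleMoment p q (n i + (p + q)) fun t =>
        instrument p q (observed m (b i) y0 U ε ω) (fun s => U s ω) t r - limitMean m ξ r) l
      fun _ => 0 := by
    rintro (r | i)
    · fin_cases r
      · exact hcU
      · simpa [instrument, limitMean, sampleMoment] using hzero
    · have := hcY (q + 1 + i) (hlagI i)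
      simpa [instrument, limitMean, sub_sub, add_assoc] using this
  have hregr : ∀ c : Fin 2 ⊕ Fin p, TendstoInMeasure P (fun i ω =>
      sampleMoment p q (n i + (p + q)) fun t =>
        regressor p (observed m (b i) y0 U ε ω) (fun s => U s ω) t c - limitMean m ξ c) l
      fun _ => 0 := by
    rintro (r | j)
    · fin_cases r
      · exact hcU
      · simpa [regressor, limitMean, sampleMoment] using hzero
    · have := hcY (1 + j) (hlagR j)
      simpa [regressor, limitMean, sub_sub] using this
  have hcov : TendstoInMeasure P (fun i ω => sampleMoment p q (n i + (p + q)) fun t =>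
      (instrument p q (observed m (b i) y0 U ε ω) (fun s => U s ω) t r - limitMean m ξ r) *
      (regressor p (observed m (b i) y0 U ε ω) (fun s => U s ω) t c - limitMean m ξ c)) l
      fun _ => limitCov m σ ξ r c := by
    rcases r with r | i <;> rcases c with c | j
    · fin_cases r <;> fin_cases c
      · simpa [instrument, regressor, limitMean, limitCov] using hUU
      · simpa [instrument, regressor, limitMean, limitCov, sampleMoment] using hzero
      · simpa [instrument, regressor, limitMean, limitCov, sampleMoment] using hzero
      · simpa [instrument, regressor, limitMean, limitCov, sampleMoment] using hzero
    · fin_cases r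
      · have := hUY (1 + j) (hlagR j)
        simpa [instrument, regressor, limitMean, limitCov, sub_sub] using this
      · simpa [instrument, regressor, limitMean, limitCov, sampleMoment] using hzero
    · fin_cases c
      · have := hUY (q + 1 + i) (hlagI i)
        simpa [instrument, regressor, limitMean, limitCov, sub_sub, mul_comm, add_assoc] using this
      · simpa [instrument, regressor, limitMean, limitCov, sampleMoment] using hzero
    · have := tendsto_sampleMoment_observed_mul m hroot hε hU hy0 hn hb (hlagI i) (hlagR j)
      have e1 : (((q + 1 + (i : ℕ) : ℕ) : ℤ) - ((1 + (j : ℕ) : ℕ) : ℤ)) =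
          (q : ℤ) + (i : ℕ) - (j : ℕ) := by
        push_cast
        ring
      rw [e1] at this
      simpa [instrument, regressor, limitMean, limitCov, sub_sub, add_assoc,
        Params.yuleWalkerMatrix] using this
  exact tendsto_sampleMoment_centered_mul hn (hinst r) (hregr c) hcov

end MatrixLimit

/-! ### Tightness of the normalized estimating equations at the true parameters -/

section Score

variable {Ω ι : Type*} [mΩ : MeasurableSpace Ω] {P : Measure Ω}
  {σ ξ : ℝ} {ε y0 U : ℤ → Ω → ℝ} {π : Design} {p q : ℕ} {l : Filter ι} {n : ι → ℕ} {b : ι → ℝ}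

theorem memLp_residual (m : Params p q) (hε : IsWhiteNoise P σ ε) (t : ℤ) :
    MemLp (fun ω => m.residual (fun s => ε s ω) t) 2 P := by
  unfold Params.residual
  exact memLp_finsetSum _ fun j _ => (hε.memLp _).const_mul _

variable [IsProbabilityMeasure P]

theorem boundedInProb_sampleMoment_mul_residual (m : Params p q) (hε : IsWhiteNoise P σ ε)
    (hU : IsGeneratedBy P π U ε y0) {V : ℤ → Ω → ℝ}
    (hVm : ∀ t, (p : ℤ) + q + 1 ≤ t → Measurable[infoBefore U ε (t - q)] (V t))
    (hV2 : ∀ t, (p : ℤ) + q + 1 ≤ t → MemLp (V t) 2 P) {B : ℝ}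
    (hB : ∀ t, (p : ℤ) + q + 1 ≤ t → ∫ ω, V t ω ^ 2 ∂P ≤ B) :
    BoundedInProb P l fun i ω => √(n i : ℝ) * sampleMoment p q (n i + (p + q)) fun t =>
      V t ω * m.residual (fun s => ε s ω) t := by
  refine boundedInProb_of_integral_le ((∑ j, |m.θ j|) * √(σ ^ 2 * B))
    (Eventually.of_forall fun i => ?_)
  have h := integral_abs_sampleMoment_mul_residual_le m hε hU hVm hV2 hB (n i)
  refine ⟨h.1.const_mul _, ?_⟩
  simp only [abs_mul, abs_of_nonneg (Real.sqrt_nonneg _)]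
  rw [integral_const_mul]
  have hθ : 0 ≤ ∑ j, |m.θ j| := Finset.sum_nonneg fun _ _ => abs_nonneg _
  calc _ ≤ √(n i : ℝ) * ((∑ j, |m.θ j|) * (√(σ ^ 2 * B) * (√(n i : ℝ))⁻¹)) :=
        mul_le_mul_of_nonneg_left h.2 (Real.sqrt_nonneg _)
    _ = (∑ j, |m.θ j|) * √(σ ^ 2 * B) * (√(n i : ℝ) * (√(n i : ℝ))⁻¹) := by ring
    _ ≤ (∑ j, |m.θ j|) * √(σ ^ 2 * B) * 1 :=
        mul_le_mul_of_nonneg_left mul_inv_le_one (by positivity)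
    _ = _ := mul_one _

theorem integral_abs_residual_le (m : Params p q) (hε : IsWhiteNoise P σ ε) (t : ℤ) :
    ∫ ω, |m.residual (fun s => ε s ω) t| ∂P ≤ (∑ j, |m.θ j|) * √(σ ^ 2) := by
  have hI : ∀ s, Integrable (fun ω => |ε s ω|) P := fun s =>
    ((hε.memLp s).integrable (by norm_num)).abs
  calc _ ≤ ∫ ω, ∑ j : Fin (q + 1), |m.θ j| * |ε (t - (j : ℕ)) ω| ∂P := by
        refine integral_mono ((memLp_residual m hε t).integrable (by norm_num)).abs
          (integrable_finsetSum _ fun j _ => (hI _).const_mul _) fun ω => ?_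
        refine (Finset.abs_sum_le_sum_abs _ _).trans_eq ?_
        simp only [abs_mul]
    _ = ∑ j : Fin (q + 1), |m.θ j| * ∫ ω, |ε (t - (j : ℕ)) ω| ∂P := by
        rw [integral_finsetSum _ fun j _ => (hI _).const_mul _]
        simp only [integral_const_mul]
    _ ≤ ∑ j : Fin (q + 1), |m.θ j| * √(σ ^ 2) := by
        refine Finset.sum_le_sum fun j _ => mul_le_mul_of_nonneg_left ?_ (abs_nonneg _)
        rw [← integral_sq_noise hε (t - (j : ℕ))]
        exact integral_abs_le_sqrt (hε.memLp _)
    _ = _ := by rw [Finset.sum_mul]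

/-- The contribution of the transient to the estimating equations is small because its profile is
summable; no independence of the residuals is needed. -/
theorem boundedInProb_sampleMoment_transient_mul_residual (m : Params p q) (hroot : m.NoUnitRoot)
    (hε : IsWhiteNoise P σ ε) (hy0 : ∀ t, Integrable (y0 t) P) {h : ℕ} (hh : h ≤ p + q) :
    BoundedInProb P l fun i ω => √(n i : ℝ) * sampleMoment p q (n i + (p + q)) fun t =>
      transientEffect m y0 ε (t - h) ω * m.residual (fun s => ε s ω) t := by
  set c : ℤ := p + q + 1 - h with hc
  have hS : BoundedInProb P l fun i ω => ∑ k ∈ Finset.range (n i),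
      m.decay ((k : ℤ) + c) * |m.residual (fun s => ε s ω) ((k : ℤ) + (p + q + 1))| := by
    have hI : ∀ t, Integrable (fun ω => |m.residual (fun s => ε s ω) t|) P := fun t =>
      ((memLp_residual m hε t).integrable (by norm_num)).abs
    refine boundedInProb_of_integral_le (m.decayNorm * ((∑ j, |m.θ j|) * √(σ ^ 2)))
      (Eventually.of_forall fun i =>
        ⟨integrable_finsetSum _ fun k _ => (hI _).const_mul _, ?_⟩)
    have habs : ∀ ω, |∑ k ∈ Finset.range (n i), (m.decay ((k : ℤ) + c) *
        |m.residual (fun s => ε s ω) ((k : ℤ) + (p + q + 1))|)| = ∑ k ∈ Finset.range (n i),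
          m.decay ((k : ℤ) + c) * |m.residual (fun s => ε s ω) ((k : ℤ) + (p + q + 1))| :=
      fun ω => abs_of_nonneg (Finset.sum_nonneg fun k _ =>
        mul_nonneg (m.decay_nonneg _) (abs_nonneg _))
    simp only [habs]
    rw [integral_finsetSum _ fun k _ => (hI _).const_mul _]
    simp only [integral_const_mul]
    have hθ : 0 ≤ ∑ j, |m.θ j| := Finset.sum_nonneg fun _ _ => abs_nonneg _
    calc _ ≤ ∑ k ∈ Finset.range (n i), m.decay ((k : ℤ) + c) * ((∑ j, |m.θ j|) * √(σ ^ 2)) :=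
          Finset.sum_le_sum fun k _ => mul_le_mul_of_nonneg_left
            (integral_abs_residual_le m hε _) (m.decay_nonneg _)
      _ ≤ _ := by
          rw [← Finset.sum_mul]
          exact mul_le_mul_of_nonneg_right (sum_decay_le m hroot _ (by omega)) (by positivity)
  refine ((boundedInProb_of_integrable (integrable_transientSize m hε hy0)).mul hS).of_abs_le
    (Eventually.of_forall fun i ω => ?_)
  rw [sampleMoment_add_lag, abs_mul, abs_mul, abs_mul, ← mul_assoc,
    abs_of_nonneg (Real.sqrt_nonneg _), abs_of_nonneg (transientSize_nonneg m y0 ε ω),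
    abs_of_nonneg (by positivity : (0 : ℝ) ≤ ((n i : ℝ))⁻¹)]
  have h1 : √(n i : ℝ) * ((n i : ℝ))⁻¹ ≤ 1 := by
    rcases Nat.eq_zero_or_pos (n i) with h0 | h0
    · simp [h0]
    · rw [← div_eq_mul_inv, div_le_one (by positivity), Real.sqrt_le_left (by positivity)]
      have : (1 : ℝ) ≤ n i := by exact_mod_cast h0
      nlinarith
  refine (mul_le_mul_of_nonneg_right h1 (abs_nonneg _)).trans ?_
  rw [one_mul]
  refine (Finset.abs_sum_le_sum_abs _ _).trans (le_trans ?_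
    (mul_le_mul_of_nonneg_left (le_abs_self _) (transientSize_nonneg m y0 ε ω)))
  rw [Finset.mul_sum]
  refine Finset.sum_le_sum fun k _ => ?_
  rw [abs_mul, ← mul_assoc, add_sub_assoc, ← hc]
  exact mul_le_mul_of_nonneg_right (m.abs_transient_le _ _ _ (by omega)) (abs_nonneg _)

/-- The estimating equations evaluated at the true parameters are of order `n^{-1/2}`: the
instruments are known before the innovations entering the residual. -/
theorem boundedInProb_sampleMoment_instrument_mul_residual (m : Params p q)
    (hroot : m.NoUnitRoot) (hε : IsWhiteNoise P σ ε) (hU : IsGeneratedBy P π U ε y0)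
    (hy0 : ∀ t, Integrable (y0 t) P) (hb : Tendsto b l (𝓝 0)) (r : Fin 2 ⊕ Fin p) :
    BoundedInProb P l fun i ω => √(n i : ℝ) * sampleMoment p q (n i + (p + q)) fun t =>
      instrument p q (observed m (b i) y0 U ε ω) (fun s => U s ω) t r *
        m.residual (fun s => ε s ω) t := by
  have hbdd : ∀ {w : ℤ → Ω → ℝ} {B : ℝ},
      (∀ t, (p : ℤ) + q + 1 ≤ t → Measurable[treatmentInfo U] (w t)) →
      (∀ t, (p : ℤ) + q + 1 ≤ t → ∀ ω, |w t ω| ≤ B) →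
      BoundedInProb P l fun i ω => √(n i : ℝ) * sampleMoment p q (n i + (p + q)) fun t =>
        w t ω * m.residual (fun s => ε s ω) t := by
    intro w B hw hB
    have hw2 : ∀ t, (p : ℤ) + q + 1 ≤ t → MemLp (w t) 2 P := fun t ht => MemLp.of_bound
      ((hw t ht).mono (treatmentInfo_le hU) le_rfl).aestronglyMeasurable B
      (Eventually.of_forall fun ω => hB t ht ω)
    refine boundedInProb_sampleMoment_mul_residual m hε hU
      (fun t ht => (hw t ht).mono (treatmentInfo_le_infoBefore U ε _) le_rfl) hw2 (B := B ^ 2)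
      fun t ht => ?_
    have := integral_mono (μ := P) (hw2 t ht).integrable_sq (integrable_const (B ^ 2)) fun ω =>
      sq_le_sq' (neg_le_of_abs_le (hB t ht ω)) (le_of_abs_le (hB t ht ω))
    simpa using this
  rcases r with r | i
  · fin_cases r
    · exact hbdd (w := U) (B := 1) (fun t ht => measurable_treatment_info U (by omega))
        fun t ht ω => (abs_treatment hU (by omega) ω).le
    · exact hbdd (w := fun _ _ => 1) (B := 1) (fun _ _ => measurable_const) fun _ _ _ => by simp
  · set h : ℕ := q + 1 + i with hh
    have hmean := hbdd (w := fun _ _ => m.mean) (B := |m.mean|) (fun _ _ => measurable_const)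
      fun _ _ _ => le_rfl
    have heff := hbdd (w := fun t => treatmentEffect m U (t - h)) (B := m.phiNorm)
      (fun _ _ => measurable_treatmentEffect m U _) fun _ _ ω =>
        abs_treatmentEffect_le m hroot hU _ ω
    have harma : BoundedInProb P l fun i ω =>
        √(n i : ℝ) * sampleMoment p q (n i + (p + q)) fun t =>
          armaNoise m ε (t - h) ω * m.residual (fun s => ε s ω) t :=
      boundedInProb_sampleMoment_mul_residual m hε hU (V := fun t => armaNoise m ε (t - h))
        (fun t _ => measurable_armaNoise m U ε (by omega)) (fun t _ => memLp_armaNoise m hε _)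
        fun t _ => integral_sq_armaNoise_le m hroot hε _
    have htrans := boundedInProb_sampleMoment_transient_mul_residual (n := n) (l := l) m hroot hε
      hy0 (show h ≤ p + q by omega)
    have hbB : BoundedInProb P l fun i (_ : Ω) => b i :=
      (tendstoInMeasure_of_tendsto_real hb).boundedInProb
    refine ((hmean.add harma).add ((hbB.mul heff).add htrans)).of_abs_le
      (Eventually.of_forall fun k ω => le_of_eq (congrArg abs ?_))
    have e : ∀ x y z w c : ℝ, c * x + c * y + (b k * (c * z) + c * w) =
        c * (x + y + (b k * z + w)) := fun x y z w c => by ring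
    rw [e, ← sampleMoment_const_mul _ (b k), ← sampleMoment_add, ← sampleMoment_add,
      ← sampleMoment_add]
    congr 2
    funext t
    have e2 : t - (q : ℤ) - 1 - ((i : ℕ) : ℤ) = t - (h : ℕ) := by
      rw [hh]
      push_cast
      ring
    simp only [instrument, Sum.elim_inr]
    rw [e2, observed_eq m hroot]
    ring

end Score

/-! ### The estimation error in terms of the estimating equations -/

section Algebra

variable {p q : ℕ}

/-- The true values of the estimated parameters. -/
def trueParameter (m : Params p q) (b : ℝ) : Fin 2 ⊕ Fin p → ℝ := Sum.elim ![b, m.μ] m.a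

theorem outcome_eq_regressor (m : Params p q) (b : ℝ) (y0 u e : ℤ → ℝ) {t : ℤ} (ht : 0 < t) :
    m.outcome b y0 u e t =
      ∑ j, regressor p (m.outcome b y0 u e) u t j * trueParameter m b j + m.residual e t := by
  rw [Params.outcome, if_pos ht]
  simp only [regressor, trueParameter, Fintype.sum_sum_type, Fin.sum_univ_two, Sum.elim_inl,
    Sum.elim_inr, Matrix.cons_val_zero, Matrix.cons_val_one, mul_comm (m.a _)]
  ring

theorem momentVector_eq (m : Params p q) (b : ℝ) (y0 u e : ℤ → ℝ) (T : ℕ) :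
    momentVector p q T (m.outcome b y0 u e) u =
      (momentMatrix p q T (m.outcome b y0 u e) u).mulVec (trueParameter m b) +
        fun r => sampleMoment p q T fun t =>
          instrument p q (m.outcome b y0 u e) u t r * m.residual e t := by
  funext r
  simp only [momentVector, momentMatrix, Matrix.mulVec, dotProduct, Matrix.of_apply, Pi.add_apply]
  simp only [mul_comm _ (trueParameter m b _), ← sampleMoment_const_mul]
  rw [← sampleMoment_sum, ← sampleMoment_add]
  refine sampleMoment_congr fun t ht => ?_
  rw [Finset.mem_Icc] at ht
  conv_lhs => rw [outcome_eq_regressor m b y0 u e (t := t) (by omega)]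
  rw [mul_add, Finset.mul_sum]
  congr 1
  exact Finset.sum_congr rfl fun j _ => by ring

theorem yuleWalker_eq (m : Params p q) (b : ℝ) (y0 u e : ℤ → ℝ) (T : ℕ)
    (hdet : (momentMatrix p q T (m.outcome b y0 u e) u).det ≠ 0) :
    yuleWalker p q T (m.outcome b y0 u e) u = trueParameter m b +
      (momentMatrix p q T (m.outcome b y0 u e) u)⁻¹.mulVec fun r => sampleMoment p q T fun t =>
        instrument p q (m.outcome b y0 u e) u t r * m.residual e t := by
  rw [yuleWalker, momentVector_eq, Matrix.mulVec_add, Matrix.mulVec_mulVec,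
    Matrix.nonsing_inv_mul _ (isUnit_iff_ne_zero.2 hdet), Matrix.one_mulVec]

end Algebra

/-! ### Linearization of the estimator -/

section Linearization

variable {Ω ι : Type*} {σ ξ : ℝ} {ε y0 U : ℤ → Ω → ℝ} {π : Design} {p q : ℕ} {l : Filter ι}
  {n : ι → ℕ} {b : ι → ℝ}

/-- The estimating equations evaluated at the true parameters. -/
def score (m : Params p q) (b : ℝ) (y0 U ε : ℤ → Ω → ℝ) (T : ℕ) (ω : Ω) : Fin 2 ⊕ Fin p → ℝ :=
  fun r => sampleMoment p q T fun t =>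
    instrument p q (observed m b y0 U ε ω) (fun s => U s ω) t r * m.residual (fun s => ε s ω) t

/-- The moment matrix along the random path. -/
def randomMatrix (m : Params p q) (b : ℝ) (y0 U ε : ℤ → Ω → ℝ) (T : ℕ) (ω : Ω) :
    Matrix (Fin 2 ⊕ Fin p) (Fin 2 ⊕ Fin p) ℝ :=
  momentMatrix p q T (observed m b y0 U ε ω) fun s => U s ω

/-- The normalized error of the parameter estimates, on the event that these are defined. -/
def parameterError (m : Params p q) (b : ℝ) (y0 U ε : ℤ → Ω → ℝ) (T : ℕ) (ω : Ω)
    (r : Fin 2 ⊕ Fin p) : ℝ :=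
  ∑ c, √(T : ℝ) * score m b y0 U ε T ω c * (randomMatrix m b y0 U ε T ω)⁻¹ r c

/-- The normalized total error of the autoregressive coefficients. -/
def arError (m : Params p q) (b : ℝ) (y0 U ε : ℤ → Ω → ℝ) (T : ℕ) (ω : Ω) : ℝ :=
  ∑ j : Fin p, parameterError m b y0 U ε T ω (Sum.inr j)

/-- The normalized estimation error when both divisions in the estimator are legitimate. -/
theorem scaledError_eq (m : Params p q) (ha : 1 - m.aSum ≠ 0) (b : ℝ) {T : ℕ} (hT : 0 < T) (ω : Ω)
    (hdet : (randomMatrix m b y0 U ε T ω).det ≠ 0)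
    (hD : 1 - m.aSum - (√(T : ℝ))⁻¹ * arError m b y0 U ε T ω ≠ 0) :
    scaledError m b (2 * b / (1 - m.aSum)) y0 U ε T ω =
      2 / (1 - m.aSum) * ((1 - m.aSum) / (1 - m.aSum - (√(T : ℝ))⁻¹ * arError m b y0 U ε T ω)) *
        (parameterError m b y0 U ε T ω (Sum.inl 0) +
          b / (1 - m.aSum) * arError m b y0 U ε T ω) := by
  have hs : √(T : ℝ) ≠ 0 := by positivity
  have hY : ∀ r, yuleWalker p q T (observed m b y0 U ε ω) (fun s => U s ω) r =
      trueParameter m b r + (√(T : ℝ))⁻¹ * parameterError m b y0 U ε T ω r := by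
    intro r
    have h := congrFun (yuleWalker_eq m b (fun s => y0 s ω) (fun s => U s ω) (fun s => ε s ω) T
      hdet) r
    refine h.trans ?_
    rw [Pi.add_apply, parameterError, Finset.mul_sum]
    refine congrArg (trueParameter m b r + ·) ?_
    change ∑ c, (randomMatrix m b y0 U ε T ω)⁻¹ r c * score m b y0 U ε T ω c = _
    refine Finset.sum_congr rfl fun c _ => ?_
    rw [← mul_assoc, ← mul_assoc, inv_mul_cancel₀ hs, one_mul, mul_comm]
  have hsum : 1 - ∑ j : Fin p, yuleWalker p q T (observed m b y0 U ε ω) (fun s => U s ω)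
      (Sum.inr j) = 1 - m.aSum - (√(T : ℝ))⁻¹ * arError m b y0 U ε T ω := by
    simp only [hY, Finset.sum_add_distrib, ← Finset.mul_sum, arError, Params.aSum, trueParameter,
      Sum.elim_inr]
    ring
  rw [scaledError, ateEstimator, hsum, hY]
  have hb : trueParameter m b (Sum.inl 0) = b := rfl
  rw [hb]
  generalize arError m b y0 U ε T ω = A at *
  generalize parameterError m b y0 U ε T ω (Sum.inl 0) = B at *
  generalize hD' : 1 - m.aSum - (√(T : ℝ))⁻¹ * A = D at *
  have hA : A = √(T : ℝ) * (1 - m.aSum - D) := by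
    rw [← hD', sub_sub_cancel, ← mul_assoc, mul_inv_cancel₀ hs, one_mul]
  rw [hA]
  field_simp
  ring

/-- Solving the limiting equations for the control coefficient. -/
theorem sum_score_mul_limitMatrix_inv (m : Params p q) (hident : (m.yuleWalkerMatrix σ).det ≠ 0)
    (hξ : ξ ^ 2 ≠ 1) (b : ℝ) (T : ℕ) (ω : Ω) :
    ∑ c, √(T : ℝ) * score m b y0 U ε T ω c * (limitMatrix m σ ξ)⁻¹ (Sum.inl 0) c =
      (1 - ξ ^ 2)⁻¹ * (√(T : ℝ) * sampleMoment p q T fun t =>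
        (U t ω - ξ) * m.residual (fun s => ε s ω) t) := by
  have h1 : 1 - ξ ^ 2 ≠ 0 := sub_ne_zero.2 hξ.symm
  set s := score m b y0 U ε T ω with hs
  have h := limitMatrix_mulVec_treatment_sub m σ ξ ((limitMatrix m σ ξ)⁻¹.mulVec s)
  rw [Matrix.mulVec_mulVec, Matrix.mul_nonsing_inv _
    (isUnit_iff_ne_zero.2 (det_limitMatrix_ne_zero m hident hξ)), Matrix.one_mulVec] at h
  have h2 : s (Sum.inl 0) - ξ * s (Sum.inl 1) = sampleMoment p q T fun t =>
      (U t ω - ξ) * m.residual (fun s => ε s ω) t := by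
    rw [hs, score, score, sub_eq_add_neg, ← neg_mul, ← sampleMoment_const_mul, ← sampleMoment_add]
    congr 1
    funext t
    simp [instrument]
    ring
  have h3 : (limitMatrix m σ ξ)⁻¹.mulVec s (Sum.inl 0) =
      ∑ c, (limitMatrix m σ ξ)⁻¹ (Sum.inl 0) c * s c := rfl
  rw [h2, h3] at h
  have key : ∀ x y z : ℝ, y = (1 - ξ ^ 2) * x → z * x = (1 - ξ ^ 2)⁻¹ * (z * y) := by
    rintro x y z rfl
    field_simp
  refine Eq.trans ?_ (key _ _ _ h)
  rw [Finset.mul_sum]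
  exact Finset.sum_congr rfl fun c _ => by ring

variable [mΩ : MeasurableSpace Ω] {P : Measure Ω} [IsProbabilityMeasure P]

theorem tendsto_sqrt_add_mul_inv_sqrt (hn : Tendsto n l atTop) (d : ℕ) :
    Tendsto (fun i => √((n i + d : ℕ) : ℝ) * (√(n i : ℝ))⁻¹) l (𝓝 1) := by
  have h := ((tendsto_inv_natCast hn).const_mul (d : ℝ)).const_add 1
  have h2 := (Real.continuous_sqrt.tendsto _).comp h
  rw [mul_zero, add_zero, Real.sqrt_one] at h2
  refine h2.congr' ?_
  filter_upwards [hn.eventually_gt_atTop 0] with i hi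
  have h0 : (n i : ℝ) ≠ 0 := by positivity
  rw [Function.comp_apply, ← Real.sqrt_inv, ← Real.sqrt_mul (by positivity)]
  congr 1
  push_cast
  field_simp

theorem boundedInProb_score (m : Params p q) (hroot : m.NoUnitRoot) (hε : IsWhiteNoise P σ ε)
    (hU : IsGeneratedBy P π U ε y0) (hy0 : ∀ t, Integrable (y0 t) P) (hn : Tendsto n l atTop)
    (hb : Tendsto b l (𝓝 0)) (r : Fin 2 ⊕ Fin p) :
    BoundedInProb P l fun i ω => √((n i + (p + q) : ℕ) : ℝ) *
      score m (b i) y0 U ε (n i + (p + q)) ω r := by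
  refine ((tendstoInMeasure_of_tendsto_real
    (tendsto_sqrt_add_mul_inv_sqrt hn (p + q))).boundedInProb.mul
    (boundedInProb_sampleMoment_instrument_mul_residual (n := n) m hroot hε hU hy0 hb
      r)).of_abs_le ?_
  filter_upwards [hn.eventually_gt_atTop 0] with i hi ω
  have hs : √(n i : ℝ) ≠ 0 := by positivity
  rw [score, mul_assoc, ← mul_assoc (√(n i : ℝ))⁻¹, inv_mul_cancel₀ hs, one_mul]

theorem tendsto_randomMatrix (m : Params p q) (hroot : m.NoUnitRoot)
    (hε : IsWhiteNoise P σ ε) (hU : IsGeneratedBy P π U ε y0) (hy0 : ∀ t, Integrable (y0 t) P)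
    (hfreq : TendstoInMeasure P
      (fun (T : ℕ) ω => (T : ℝ)⁻¹ * ∑ t ∈ Finset.Icc (1 : ℤ) T, U t ω) atTop (fun _ => ξ))
    (hn : Tendsto n l atTop) (hb : Tendsto b l (𝓝 0))
    {F : Matrix (Fin 2 ⊕ Fin p) (Fin 2 ⊕ Fin p) ℝ → ℝ} (hF : ContinuousAt F (limitMatrix m σ ξ)) :
    TendstoInMeasure P (fun i ω => F (randomMatrix m (b i) y0 U ε (n i + (p + q)) ω)) l
      fun _ => F (limitMatrix m σ ξ) := by
  have h := tendstoInMeasure_continuousAt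
    (α := (Fin 2 ⊕ Fin p) × (Fin 2 ⊕ Fin p)) (x := fun a => limitMatrix m σ ξ a.1 a.2)
    (fun a => tendsto_momentMatrix m hroot hε hU hy0 hfreq hn hb a.1 a.2)
    (F := fun v => F (Matrix.of fun r c => v (r, c)))
  refine h (ContinuousAt.comp (g := F)
    (f := fun v : (Fin 2 ⊕ Fin p) × (Fin 2 ⊕ Fin p) → ℝ => Matrix.of fun r c => v (r, c)) hF ?_)
  exact Continuous.continuousAt (by fun_prop)

theorem continuousAt_inv_entry {α : Type*} [Fintype α] [DecidableEq α] {G : Matrix α α ℝ}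
    (hG : G.det ≠ 0) (r c : α) : ContinuousAt (fun M : Matrix α α ℝ => M⁻¹ r c) G := by
  have h : ContinuousAt (fun M : Matrix α α ℝ => M⁻¹) G := continuousAt_matrix_inv G (by
    rw [Ring.inverse_eq_inv']
    exact continuousAt_inv₀ hG)
  exact ((continuous_apply c).comp (continuous_apply r)).continuousAt.comp h

/-- The leading term of the normalized estimation error: a normalized sum of residuals with bounded
weights depending on the treatments only. -/
def leadingTerm (m : Params p q) (ξ : ℝ) (U ε : ℤ → Ω → ℝ) (T : ℕ) (ω : Ω) : ℝ :=
  (√(T : ℝ))⁻¹ * ∑ t ∈ Finset.Icc (1 : ℤ) T,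
    2 / ((1 - m.aSum) * (1 - ξ ^ 2)) * (U t ω - ξ) * m.residual (fun s => ε s ω) t

theorem uniformlySqIntegrable_leadingTerm (m : Params p q) (hε : IsWhiteNoise P σ ε)
    (hU : IsGeneratedBy P π U ε y0) (ξ : ℝ) :
    UniformlySqIntegrable P (leadingTerm m ξ U ε) := by
  refine uniformlySqIntegrable_weighted_residual m hε hU
    (w := fun t ω => 2 / ((1 - m.aSum) * (1 - ξ ^ 2)) * (U t ω - ξ))
    (B := |2 / ((1 - m.aSum) * (1 - ξ ^ 2))| * (1 + |ξ|))
    (fun t ht => ((measurable_treatment_info U ht).sub_const ξ).const_mul _) (by positivity) ?_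
  intro t ht ω
  rw [abs_mul]
  refine mul_le_mul_of_nonneg_left ((abs_sub _ _).trans ?_) (abs_nonneg _)
  rw [abs_treatment hU ht]

theorem UniformlySqIntegrable.boundedInProb {Y : ℕ → Ω → ℝ} (hY : UniformlySqIntegrable P Y)
    (N : ι → ℕ) : BoundedInProb P l fun i => Y (N i) := by
  obtain ⟨K, hK⟩ := hY.excess 1 one_pos
  refine boundedInProb_of_integral_le (1 + (|K| + 1)) (Eventually.of_forall fun i => ?_)
  have hm := hY.memLp (N i)
  refine ⟨hm.integrable (by norm_num), ?_⟩
  have hI := integrable_excess hm |K|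
  calc ∫ ω, |Y (N i) ω| ∂P ≤ ∫ ω, (1 + |K|) + max (Y (N i) ω ^ 2 - |K|) 0 ∂P := by
        refine integral_mono (hm.integrable (by norm_num)).abs ((integrable_const _).add hI)
          fun ω => ?_
        dsimp only
        have h1 := le_max_left (Y (N i) ω ^ 2 - |K|) 0
        have h2 := sq_abs (Y (N i) ω)
        nlinarith [sq_nonneg (|Y (N i) ω| - 1)]
    _ = (1 + |K|) + ∫ ω, max (Y (N i) ω ^ 2 - |K|) 0 ∂P := by
        rw [integral_add (integrable_const _) hI]
        simp
    _ ≤ _ := by linarith [hK |K| (le_abs_self K) (N i)]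

end Linearization

/-! ### The leading term of the estimation error -/

section LeadingTerm

variable {Ω ι : Type*} [mΩ : MeasurableSpace Ω] {P : Measure Ω} [IsProbabilityMeasure P]
  {σ ξ : ℝ} {ε y0 U : ℤ → Ω → ℝ} {π : Design} {p q : ℕ} {l : Filter ι} {n : ι → ℕ} {b : ι → ℝ}

theorem boundedInProb_parameterError (m : Params p q) (hroot : m.NoUnitRoot)
    (hident : (m.yuleWalkerMatrix σ).det ≠ 0)
    (hε : IsWhiteNoise P σ ε) (hU : IsGeneratedBy P π U ε y0) (hy0 : ∀ t, Integrable (y0 t) P)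
    (hξ : ξ ^ 2 ≠ 1) (hfreq : TendstoInMeasure P
      (fun (T : ℕ) ω => (T : ℝ)⁻¹ * ∑ t ∈ Finset.Icc (1 : ℤ) T, U t ω) atTop (fun _ => ξ))
    (hn : Tendsto n l atTop) (hb : Tendsto b l (𝓝 0)) (r : Fin 2 ⊕ Fin p) :
    BoundedInProb P l fun i ω => parameterError m (b i) y0 U ε (n i + (p + q)) ω r :=
  BoundedInProb.sum fun c _ => (boundedInProb_score m hroot hε hU hy0 hn hb c).mul
    (tendsto_randomMatrix m hroot hε hU hy0 hfreq hn hb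
      (continuousAt_inv_entry (det_limitMatrix_ne_zero m hident hξ) r c)).boundedInProb

theorem tendsto_parameterError_treatment_sub (m : Params p q) (hroot : m.NoUnitRoot)
    (hident : (m.yuleWalkerMatrix σ).det ≠ 0)
    (hε : IsWhiteNoise P σ ε) (hU : IsGeneratedBy P π U ε y0) (hy0 : ∀ t, Integrable (y0 t) P)
    (hξ : ξ ^ 2 ≠ 1) (hfreq : TendstoInMeasure P
      (fun (T : ℕ) ω => (T : ℝ)⁻¹ * ∑ t ∈ Finset.Icc (1 : ℤ) T, U t ω) atTop (fun _ => ξ))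
    (hn : Tendsto n l atTop) (hb : Tendsto b l (𝓝 0)) :
    TendstoInMeasure P (fun i ω => parameterError m (b i) y0 U ε (n i + (p + q)) ω (Sum.inl 0) -
      (1 - ξ ^ 2)⁻¹ * (√((n i + (p + q) : ℕ) : ℝ) * sampleMoment p q (n i + (p + q)) fun t =>
        (U t ω - ξ) * m.residual (fun s => ε s ω) t)) l fun _ => 0 := by
  have h : TendstoInMeasure P (fun i ω => ∑ c, √((n i + (p + q) : ℕ) : ℝ) *
      score m (b i) y0 U ε (n i + (p + q)) ω c *
        ((randomMatrix m (b i) y0 U ε (n i + (p + q)) ω)⁻¹ (Sum.inl 0) c +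
          -(limitMatrix m σ ξ)⁻¹ (Sum.inl 0) c)) l fun _ => 0 := by
    refine TendstoInMeasure.sum_zero_limits fun c _ =>
      (boundedInProb_score m hroot hε hU hy0 hn hb c).mul_tendsto_zero ?_
    have := (tendsto_randomMatrix m hroot hε hU hy0 hfreq hn hb
      (continuousAt_inv_entry (det_limitMatrix_ne_zero m hident hξ) (Sum.inl 0) c)).add_const_limits
      (tendstoInMeasure_of_tendsto_real
        (tendsto_const_nhds (x := -(limitMatrix m σ ξ)⁻¹ (Sum.inl 0) c)))
    simpa using this
  refine h.congr_left fun i => Eventually.of_forall fun ω => ?_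
  dsimp only
  rw [← sum_score_mul_limitMatrix_inv m hident hξ (b i) (y0 := y0), parameterError,
    ← Finset.sum_sub_distrib]
  exact Finset.sum_congr rfl fun c _ => by ring

/-- Dropping the first `p + q` times does not matter in the leading term. -/
theorem tendsto_treatmentScore_sub_leadingTerm (m : Params p q) (hε : IsWhiteNoise P σ ε)
    (hU : IsGeneratedBy P π U ε y0) (hn : Tendsto n l atTop) :
    TendstoInMeasure P (fun i ω => 2 / (1 - m.aSum) * ((1 - ξ ^ 2)⁻¹ *
      (√((n i + (p + q) : ℕ) : ℝ) * sampleMoment p q (n i + (p + q)) fun t =>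
        (U t ω - ξ) * m.residual (fun s => ε s ω) t)) - leadingTerm m ξ U ε (n i + (p + q)) ω) l
      fun _ => 0 := by
  set κ : ℝ := 2 / ((1 - m.aSum) * (1 - ξ ^ 2)) with hκ
  set F : Ω → ℝ := fun ω => ∑ t ∈ Finset.Icc (1 : ℤ) ((p + q : ℕ) : ℤ),
    κ * (U t ω - ξ) * m.residual (fun s => ε s ω) t with hF
  have hFI : Integrable F P := by
    refine integrable_finsetSum _ fun t ht => ?_
    rw [Finset.mem_Icc] at ht
    refine ((memLp_residual m hε t).integrable (by norm_num)).bdd_mul (c := |κ| * (1 + |ξ|))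
      (((hU.measurable t ht.1).sub_const ξ).const_mul κ).aestronglyMeasurable
      (Eventually.of_forall fun ω => ?_)
    rw [Real.norm_eq_abs, abs_mul]
    refine mul_le_mul_of_nonneg_left ((abs_sub _ _).trans ?_) (abs_nonneg _)
    rw [abs_treatment hU ht.1]
  have hL := (uniformlySqIntegrable_leadingTerm m hε hU ξ).boundedInProb (l := l)
    fun i => n i + (p + q)
  have e1 : Tendsto (fun i => ((p + q : ℕ) : ℝ) * ((n i : ℝ))⁻¹) l (𝓝 0) := by
    simpa using (tendsto_inv_natCast hn).const_mul ((p + q : ℕ) : ℝ)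
  have e2 : Tendsto (fun i => -(√((n i + (p + q) : ℕ) : ℝ) * (√(n i : ℝ))⁻¹ * (√(n i : ℝ))⁻¹)) l
      (𝓝 0) := by
    simpa using ((tendsto_sqrt_add_mul_inv_sqrt hn (p + q)).mul (tendsto_inv_sqrt_natCast hn)).neg
  have h1 := hL.mul_tendsto_zero (tendstoInMeasure_of_tendsto_real e1)
  have h2 := (boundedInProb_of_integrable (l := l) hFI).mul_tendsto_zero
    (tendstoInMeasure_of_tendsto_real e2)
  refine (h1.add_zero_limits h2).congr' ?_ EventuallyEq.rfl
  filter_upwards [hn.eventually_gt_atTop 0] with i hi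
  refine Eventually.of_forall fun ω => ?_
  dsimp only
  set N := n i + (p + q) with hN
  have hn0 : (n i : ℝ) ≠ 0 := by positivity
  have hN0 : (N : ℝ) ≠ 0 := by positivity
  have hκ' : ∀ x : ℝ, 2 / (1 - m.aSum) * ((1 - ξ ^ 2)⁻¹ * x) = κ * x := fun x => by
    rw [hκ, div_mul_eq_div_div, div_eq_mul_inv (2 / (1 - m.aSum))]
    ring
  have hsm : κ * (√(N : ℝ) * sampleMoment p q N fun t =>
      (U t ω - ξ) * m.residual (fun s => ε s ω) t) = √(N : ℝ) * sampleMoment p q N fun t =>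
        κ * (U t ω - ξ) * m.residual (fun s => ε s ω) t := by
    rw [mul_left_comm, ← sampleMoment_const_mul]
    simp only [mul_assoc]
  rw [hκ', hsm, sampleMoment_eq_average hi, ← hN, leadingTerm, ← hκ, hF]
  dsimp only
  have hs1 : (√(n i : ℝ))⁻¹ * (√(n i : ℝ))⁻¹ = ((n i : ℝ))⁻¹ := by
    rw [← mul_inv, Real.mul_self_sqrt (by positivity)]
  have hs2 : √(N : ℝ) * ((N : ℝ))⁻¹ = (√(N : ℝ))⁻¹ := by
    rw [← div_eq_mul_inv, Real.sqrt_div_self]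
  rw [mul_assoc √(N : ℝ), hs1]
  generalize ∑ t ∈ Finset.Icc (1 : ℤ) ((p + q : ℕ) : ℤ),
    κ * (U t ω - ξ) * m.residual (fun s => ε s ω) t = A
  generalize ∑ t ∈ Finset.Icc (1 : ℤ) (N : ℤ),
    κ * (U t ω - ξ) * m.residual (fun s => ε s ω) t = B
  rw [← hs2]
  ring

/-- The normalized estimation error is asymptotically equivalent to its leading term. -/
theorem tendsto_scaledError_sub_leadingTerm (m : Params p q) (hroot : m.NoUnitRoot)
    (hident : (m.yuleWalkerMatrix σ).det ≠ 0)
    (hε : IsWhiteNoise P σ ε) (hU : IsGeneratedBy P π U ε y0) (hy0 : ∀ t, Integrable (y0 t) P)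
    (hξ : ξ ^ 2 ≠ 1) (hfreq : TendstoInMeasure P
      (fun (T : ℕ) ω => (T : ℝ)⁻¹ * ∑ t ∈ Finset.Icc (1 : ℤ) T, U t ω) atTop (fun _ => ξ))
    (hn : Tendsto n l atTop) (hb : Tendsto b l (𝓝 0)) :
    TendstoInMeasure P (fun i ω =>
      scaledError m (b i) (2 * b i / (1 - m.aSum)) y0 U ε (n i + (p + q)) ω -
        leadingTerm m ξ U ε (n i + (p + q)) ω) l fun _ => 0 := by
  have ha := m.one_sub_aSum_ne_zero hroot
  have hdet := det_limitMatrix_ne_zero m hident hξ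
  have hQ : ∀ r, _ := fun r : Fin 2 ⊕ Fin p =>
    boundedInProb_parameterError m hroot hident hε hU hy0 hξ hfreq hn hb r
  have hA : BoundedInProb P l fun i ω => arError m (b i) y0 U ε (n i + (p + q)) ω :=
    BoundedInProb.sum fun j _ => hQ (Sum.inr j)
  have hD : TendstoInMeasure P (fun i ω => (√((n i + (p + q) : ℕ) : ℝ))⁻¹ *
      arError m (b i) y0 U ε (n i + (p + q)) ω) l fun _ => 0 := by
    have := hA.mul_tendsto_zero (tendstoInMeasure_of_tendsto_real
      (tendsto_inv_sqrt_natCast (tendsto_atTop_mono (fun i => Nat.le_add_right (n i) (p + q)) hn)))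
    exact this.congr_left fun i => Eventually.of_forall fun ω => mul_comm _ _
  have hρ : TendstoInMeasure P (fun i ω => (1 - m.aSum) / (1 - m.aSum -
      (√((n i + (p + q) : ℕ) : ℝ))⁻¹ * arError m (b i) y0 U ε (n i + (p + q)) ω)) l
      fun _ => 1 := by
    have h := tendstoInMeasure_continuousAt (α := Unit) (x := fun _ => 0) (fun _ => hD)
      (F := fun v => (1 - m.aSum) / (1 - m.aSum - v ()))
      (continuousAt_const.div₀
        (continuousAt_const.sub (continuous_apply ()).continuousAt) (by simpa using ha))
    simpa [div_self ha] using h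
  have hρ0 : TendstoInMeasure P (fun i ω => (1 - m.aSum) / (1 - m.aSum -
      (√((n i + (p + q) : ℕ) : ℝ))⁻¹ * arError m (b i) y0 U ε (n i + (p + q)) ω) + -1) l
      fun _ => 0 := by
    simpa using hρ.add_const_limits
      (tendstoInMeasure_of_tendsto_real (tendsto_const_nhds (x := (-1 : ℝ))))
  -- the remainders left by the denominator, by the size of `b`, by the moment matrix and by the
  -- first `p + q` times
  have h1 := ((hQ (Sum.inl 0)).mul_tendsto_zero hρ0).const_mul_zero (2 / (1 - m.aSum))
  have h2 := ((hρ.boundedInProb.mul hA).mul_tendsto_zero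
    (tendstoInMeasure_of_tendsto_real (by simpa using hb.div_const (1 - m.aSum)))).const_mul_zero
    (2 / (1 - m.aSum))
  have h3 := (tendsto_parameterError_treatment_sub m hroot hident hε hU hy0 hξ hfreq hn
    hb).const_mul_zero (2 / (1 - m.aSum))
  have h4 := tendsto_treatmentScore_sub_leadingTerm (ξ := ξ) m hε hU hn
  have hdetlim := tendsto_randomMatrix m hroot hε hU hy0 hfreq hn hb
    (F := Matrix.det) continuous_id.matrix_det.continuousAt
  -- off the events below the moment matrix is invertible and the denominator does not vanish
  refine ((h1.add_zero_limits h2).add_zero_limits (h3.add_zero_limits h4)).congr_of_event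
    (B := fun i => {ω | |(limitMatrix m σ ξ).det| ≤
        ‖(randomMatrix m (b i) y0 U ε (n i + (p + q)) ω).det - (limitMatrix m σ ξ).det‖} ∪
      {ω | |1 - m.aSum| ≤ ‖(√((n i + (p + q) : ℕ) : ℝ))⁻¹ *
        arError m (b i) y0 U ε (n i + (p + q)) ω - 0‖}) ?_ ?_
  · have e1 := tendstoInMeasure_iff_measureReal_norm.1 hdetlim _ (abs_pos.2 hdet)
    have e2 := tendstoInMeasure_iff_measureReal_norm.1 hD _ (abs_pos.2 ha)
    exact squeeze_zero (fun _ => measureReal_nonneg) (fun _ => measureReal_union_le _ _)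
      (by simpa using e1.add e2)
  · filter_upwards [hn.eventually_gt_atTop 0] with i hi ω hω
    simp only [Set.mem_union, Set.mem_ofPred_eq, not_or, not_le, Real.norm_eq_abs, sub_zero] at hω
    rw [scaledError_eq m ha (b i) (by omega) ω]
    · ring
    · intro h0
      rw [h0, zero_sub, abs_neg] at hω
      exact lt_irrefl _ hω.1
    · intro h0
      rw [sub_eq_zero.1 h0] at hω
      exact lt_irrefl _ hω.2

end LeadingTerm

/-! ### The average treatment effect -/

section TreatmentEffect

variable {p q : ℕ}

/-- The model in which the constant treatment `c` has been absorbed into the intercept. -/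
def Params.absorb (m : Params p q) (b c : ℝ) : Params p q where
  μ := m.μ + b * c
  a := m.a
  θ := m.θ
  θ_zero := m.θ_zero

theorem Params.outcome_const (m : Params p q) (b c : ℝ) (y0 e : ℤ → ℝ)
    (t : ℤ) : m.outcome b y0 (fun _ => c) e t = (m.absorb b c).outcome 0 y0 (fun _ => c) e t := by
  induction hn : t.toNat using Nat.strong_induction_on generalizing t with
  | _ n ih =>
  rw [Params.outcome, Params.outcome]
  split_ifs with h
  · have h1 : ∀ j : Fin p, m.outcome b y0 (fun _ => c) e (t - 1 - (j : ℕ)) =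
        (m.absorb b c).outcome 0 y0 (fun _ => c) e (t - 1 - (j : ℕ)) :=
      fun j => ih _ (by omega) _ rfl
    simp only [h1]
    simp only [Params.absorb, Params.residual]
    ring
  · rfl

variable {Ω : Type*} [mΩ : MeasurableSpace Ω] {P : Measure Ω} {σ : ℝ} {ε y0 U : ℤ → Ω → ℝ}

theorem integrable_outcome_const [IsFiniteMeasure P] (m : Params p q) (hε : IsWhiteNoise P σ ε)
    (hy0 : ∀ t, Integrable (y0 t) P) (b c : ℝ) (t : ℤ) :
    Integrable (fun ω => m.outcome b (fun s => y0 s ω) (fun _ => c) (fun s => ε s ω) t) P := by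
  induction hn : t.toNat using Nat.strong_induction_on generalizing t with
  | _ n ih =>
  by_cases h : 0 < t
  · have h1 : (fun ω => m.outcome b (fun s => y0 s ω) (fun _ => c) (fun s => ε s ω) t) = fun ω =>
        m.μ + ∑ j : Fin p, m.a j * m.outcome b (fun s => y0 s ω) (fun _ => c) (fun s => ε s ω)
          (t - 1 - (j : ℕ)) + b * c + m.residual (fun s => ε s ω) t := by
      funext ω
      rw [Params.outcome, if_pos h]
    rw [h1]
    exact ((((integrable_const _).add (integrable_finsetSum _ fun j _ =>
      (ih _ (by omega) _ rfl).const_mul _)).add (integrable_const _)).add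
      ((memLp_residual m hε t).integrable (by norm_num)))
  · have h1 : (fun ω => m.outcome b (fun s => y0 s ω) (fun _ => c) (fun s => ε s ω) t) = y0 t := by
      funext ω
      rw [Params.outcome, if_neg h]
    rw [h1]
    exact hy0 t

variable [IsProbabilityMeasure P]

/-- Without control, the expected outcome differs from the stationary mean by the expected
transient. -/
theorem abs_integral_outcome_sub_mean_le (m : Params p q) (hroot : m.NoUnitRoot)
    (hε : IsWhiteNoise P σ ε) (hy0 : ∀ t, Integrable (y0 t) P) (c : ℝ) {t : ℤ} (ht : 0 < t) :
    |∫ ω, m.outcome 0 (fun s => y0 s ω) (fun _ => c) (fun s => ε s ω) t ∂P - m.mean| ≤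
      (∫ ω, transientSize m y0 ε ω ∂P) * m.decay t := by
  have hX := (memLp_armaNoise m hε t).integrable (by norm_num)
  have hO := integrable_outcome_const m hε hy0 0 c t
  have hO' : Integrable (fun ω => m.outcome 0 (fun s => y0 s ω) (fun _ => c) (fun s => ε s ω) t -
      m.mean) P := hO.sub (integrable_const _)
  have h1 : ∫ ω, m.outcome 0 (fun s => y0 s ω) (fun _ => c) (fun s => ε s ω) t ∂P - m.mean =
      ∫ ω, (m.outcome 0 (fun s => y0 s ω) (fun _ => c) (fun s => ε s ω) t - m.mean) -
        armaNoise m ε t ω ∂P := by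
    rw [integral_sub hO' hX, integral_armaNoise m hε, sub_zero,
      integral_sub hO (integrable_const _)]
    simp
  rw [h1, ← integral_mul_const, ← Real.norm_eq_abs]
  refine norm_integral_le_of_norm_le ((integrable_transientSize m hε hy0).mul_const _)
    (Eventually.of_forall fun ω => ?_)
  rw [Params.outcome_eq m hroot, Real.norm_eq_abs]
  refine le_trans (le_of_eq (congrArg abs ?_))
    (m.abs_transient_le (fun s => y0 s ω) (fun s => ε s ω) t ht)
  rw [armaNoise]
  ring

theorem tendsto_expectedAverage (m : Params p q) (hroot : m.NoUnitRoot)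
    (hε : IsWhiteNoise P σ ε) (hy0 : ∀ t, Integrable (y0 t) P) (b c : ℝ) :
    Tendsto (expectedAverage P m b ε y0 c) atTop (𝓝 ((m.μ + b * c) / (1 - m.aSum))) := by
  set m' := m.absorb b c with hm'
  have hroot' : m'.NoUnitRoot := hroot
  have hlim : Tendsto (fun k : ℕ => ∫ ω, m.outcome b (fun s => y0 s ω) (fun _ => c)
      (fun s => ε s ω) ((k : ℤ) + 1) ∂P) atTop (𝓝 m'.mean) := by
    have hd : Tendsto (fun k : ℕ => (∫ ω, transientSize m' y0 ε ω ∂P) * m'.decay ((k : ℤ) + 1))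
        atTop (𝓝 0) := by
      have := ((tendsto_add_atTop_iff_nat 1).2
        (m'.summable_decay hroot').tendsto_atTop_zero).const_mul (∫ ω, transientSize m' y0 ε ω ∂P)
      simpa using this
    rw [tendsto_iff_norm_sub_tendsto_zero]
    refine squeeze_zero (fun _ => norm_nonneg _) (fun k => ?_) hd
    simp only [Params.outcome_const m, Real.norm_eq_abs]
    exact abs_integral_outcome_sub_mean_le m' hroot' hε hy0 c (by omega)
  refine hlim.cesaro.congr fun T => ?_
  have h1 : ∀ f : ℤ → ℝ, (T : ℝ)⁻¹ * ∑ t ∈ Finset.Icc (1 : ℤ) T, f t =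
      (T : ℝ)⁻¹ * ∑ k ∈ Finset.range T, f ((k : ℤ) + 1) := fun f => by
    simpa [sampleMoment] using sampleMoment_add_lag (p := 0) (q := 0) T f
  rw [expectedAverage, integral_const_mul, integral_finsetSum _ fun t _ =>
    integrable_outcome_const m hε hy0 b c t, h1]

theorem isATE (m : Params p q) (hroot : m.NoUnitRoot) (hε : IsWhiteNoise P σ ε)
    (hy0 : ∀ t, Integrable (y0 t) P) (b : ℝ) :
    IsATE P m b ε y0 (2 * b / (1 - m.aSum)) :=
  ⟨_, _, tendsto_expectedAverage m hroot hε hy0 b 1, tendsto_expectedAverage m hroot hε hy0 b (-1),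
    by ring⟩

end TreatmentEffect

/-! ### Measurability of the estimation error -/

section Measurability

variable {Ω : Type*} [mΩ : MeasurableSpace Ω]

theorem measurable_det {α : Type*} [Fintype α] [DecidableEq α] {M : Ω → Matrix α α ℝ}
    (hM : ∀ r c, Measurable fun ω => M ω r c) : Measurable fun ω => (M ω).det := by
  simp only [Matrix.det_apply']
  exact Finset.measurable_fun_sum _ fun s _ =>
    (Finset.measurable_fun_prod _ fun i _ => hM _ _).const_mul _

theorem measurable_inv_entry {α : Type*} [Fintype α] [DecidableEq α] {M : Ω → Matrix α α ℝ}
    (hM : ∀ r c, Measurable fun ω => M ω r c) (r c : α) : Measurable fun ω => (M ω)⁻¹ r c := by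
  simp only [Matrix.inv_def, Ring.inverse_eq_inv', Matrix.smul_apply, Matrix.adjugate_apply,
    smul_eq_mul]
  refine (measurable_det hM).inv.mul (measurable_det fun i j => ?_)
  simp only [Matrix.updateRow_apply]
  split_ifs
  · exact measurable_const
  · exact hM i j

variable {P : Measure Ω} {σ : ℝ} {ε y0 U : ℤ → Ω → ℝ} {π : Design} {p q : ℕ}

theorem measurable_residual (m : Params p q) (hε : IsWhiteNoise P σ ε) (t : ℤ) :
    Measurable fun ω => m.residual (fun s => ε s ω) t := by
  unfold Params.residual
  exact Finset.measurable_fun_sum _ fun j _ => (hε.measurable _).const_mul _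

theorem measurable_observed (m : Params p q) (hε : IsWhiteNoise P σ ε)
    (hU : IsGeneratedBy P π U ε y0) (hy0 : ∀ t, Measurable (y0 t)) (b : ℝ) (t : ℤ) :
    Measurable fun ω => observed m b y0 U ε ω t := by
  induction hn : t.toNat using Nat.strong_induction_on generalizing t with
  | _ n ih =>
  unfold observed at ih ⊢
  by_cases h : 0 < t
  · have h1 : (fun ω => m.outcome b (fun s => y0 s ω) (fun s => U s ω) (fun s => ε s ω) t) =
        fun ω => m.μ + ∑ j : Fin p, m.a j * m.outcome b (fun s => y0 s ω) (fun s => U s ω)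
          (fun s => ε s ω) (t - 1 - (j : ℕ)) + b * U t ω + m.residual (fun s => ε s ω) t := by
      funext ω
      rw [Params.outcome, if_pos h]
    rw [h1]
    exact ((measurable_const.add (Finset.measurable_fun_sum _ fun j _ =>
      (ih _ (by omega) _ rfl).const_mul _)).add ((hU.measurable t (by omega)).const_mul b)).add
      (measurable_residual m hε t)
  · have h1 : (fun ω => m.outcome b (fun s => y0 s ω) (fun s => U s ω) (fun s => ε s ω) t) =
        y0 t := by
      funext ω
      rw [Params.outcome, if_neg h]
    rw [h1]
    exact hy0 t

theorem measurable_scaledError (m : Params p q) (hε : IsWhiteNoise P σ ε)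
    (hU : IsGeneratedBy P π U ε y0) (hy0 : ∀ t, Measurable (y0 t)) (b τ : ℝ) (T : ℕ) :
    Measurable (scaledError m b τ y0 U ε T) := by
  have hY := measurable_observed m hε hU hy0 b
  have hSM : ∀ f : ℤ → Ω → ℝ, (∀ t, 1 ≤ t → Measurable (f t)) →
      Measurable fun ω => sampleMoment p q T fun t => f t ω := by
    intro f hf
    unfold sampleMoment
    refine (Finset.measurable_fun_sum _ fun t ht => hf t ?_).const_mul _
    rw [Finset.mem_Icc] at ht
    omega
  have hinst : ∀ r t, 1 ≤ t → Measurable fun ω =>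
      instrument p q (observed m b y0 U ε ω) (fun s => U s ω) t r := by
    rintro (r | i) t ht
    · fin_cases r
      · exact hU.measurable t ht
      · exact measurable_const
    · exact hY _
  have hregr : ∀ r t, 1 ≤ t → Measurable fun ω =>
      regressor p (observed m b y0 U ε ω) (fun s => U s ω) t r := by
    rintro (r | i) t ht
    · fin_cases r
      · exact hU.measurable t ht
      · exact measurable_const
    · exact hY _
  have hYW : ∀ r, Measurable fun ω =>
      yuleWalker p q T (observed m b y0 U ε ω) (fun s => U s ω) r := by
    intro r
    unfold yuleWalker Matrix.mulVec dotProduct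
    exact Finset.measurable_fun_sum _ fun c _ => (measurable_inv_entry (fun r c =>
      hSM _ fun t ht => (hinst r t ht).mul (hregr c t ht)) r c).mul
        (hSM _ fun t ht => (hinst c t ht).mul (hY t))
  unfold scaledError ateEstimator
  exact ((((hYW _).const_mul 2).div (measurable_const.sub
    (Finset.measurable_fun_sum _ fun j _ => hYW _))).sub_const τ).const_mul _

end Measurability

/-! ### The second moment of the leading term -/

section LeadingVariance

variable {Ω : Type*} [mΩ : MeasurableSpace Ω] {P : Measure Ω} [IsProbabilityMeasure P]
  {σ : ℝ} {ε y0 U : ℤ → Ω → ℝ} {π : Design} {p q : ℕ}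

theorem integral_treatment_mul_residual (m : Params p q) (hε : IsWhiteNoise P σ ε)
    (hU : IsGeneratedBy P π U ε y0) (ξ : ℝ) {t : ℤ} (ht : 1 ≤ t) :
    Integrable (fun ω => (U t ω - ξ) * m.residual (fun s => ε s ω) t) P ∧
      ∫ ω, (U t ω - ξ) * m.residual (fun s => ε s ω) t ∂P = 0 := by
  have hI : ∀ s, IndepFun (fun ω => U t ω - ξ) (ε s) P := fun s =>
    indepFun_past (g := id) hε hU (((measurable_treatment_info U ht).sub_const ξ).mono
      (treatmentInfo_le_infoBefore U ε s) le_rfl) measurable_id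
  have hm : Measurable fun ω => U t ω - ξ := (hU.measurable t ht).sub_const ξ
  have hint : ∀ s, Integrable (fun ω => (U t ω - ξ) * ε s ω) P := fun s => by
    refine ((hε.memLp s).integrable (by norm_num)).bdd_mul (c := 1 + |ξ|) hm.aestronglyMeasurable
      (Eventually.of_forall fun ω => (abs_sub _ _).trans ?_)
    rw [abs_treatment hU ht]
  have hexp : (fun ω => (U t ω - ξ) * m.residual (fun s => ε s ω) t) = fun ω =>
      ∑ j : Fin (q + 1), m.θ j * ((U t ω - ξ) * ε (t - (j : ℕ)) ω) := by
    funext ω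
    rw [Params.residual, Finset.mul_sum]
    exact Finset.sum_congr rfl fun j _ => by ring
  rw [hexp]
  refine ⟨integrable_finsetSum _ fun j _ => (hint _).const_mul _, ?_⟩
  rw [integral_finsetSum _ fun j _ => (hint _).const_mul _]
  refine Finset.sum_eq_zero fun j _ => ?_
  rw [integral_const_mul, (hI _).integral_fun_mul_eq_mul_integral hm.aestronglyMeasurable
    (hε.memLp _).aestronglyMeasurable, hε.mean_zero, mul_zero, mul_zero]

theorem integral_sq_leadingTerm (m : Params p q) (hε : IsWhiteNoise P σ ε)
    (hU : IsGeneratedBy P π U ε y0) (ξ : ℝ) (T : ℕ) :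
    ∫ ω, leadingTerm m ξ U ε T ω ^ 2 ∂P = normalizedVariance P m ξ U ε T := by
  have h := fun t ht => integral_treatment_mul_residual m hε hU ξ
    (t := t) (Finset.mem_Icc.1 (ht : t ∈ Finset.Icc (1 : ℤ) T)).1
  have hmean : ∫ ω, ∑ t ∈ Finset.Icc (1 : ℤ) T,
      (U t ω - ξ) * m.residual (fun s => ε s ω) t ∂P = 0 := by
    rw [integral_finsetSum _ fun t ht => (h t ht).1]
    exact Finset.sum_eq_zero fun t ht => (h t ht).2
  rw [normalizedVariance, variance_of_integral_eq_zero
    (integrable_finsetSum _ fun t ht => (h t ht).1).aemeasurable hmean, ← integral_const_mul]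
  refine integral_congr_ae (Eventually.of_forall fun ω => ?_)
  simp only [leadingTerm, mul_assoc]
  rw [← Finset.mul_sum, mul_pow, mul_pow, inv_pow, Real.sq_sqrt (Nat.cast_nonneg T), div_pow,
    mul_pow]
  simp only [div_eq_mul_inv, mul_inv]
  ring

/-- The error of the estimator has the asymptotic mean squared error of its leading term. -/
theorem hasAsymptoticMSE_scaledError_iff {ξ : ℝ} (m : Params p q) (hroot : m.NoUnitRoot)
    (hident : (m.yuleWalkerMatrix σ).det ≠ 0) (hε : IsWhiteNoise P σ ε)
    (hU : IsGeneratedBy P π U ε y0) (hy0m : ∀ t, Measurable (y0 t))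
    (hy0 : ∀ t, Integrable (y0 t) P) (hξ : ξ ^ 2 ≠ 1) (hfreq : TendstoInMeasure P
      (fun (T : ℕ) ω => (T : ℝ)⁻¹ * ∑ t ∈ Finset.Icc (1 : ℤ) T, U t ω) atTop (fun _ => ξ))
    {ate : ℝ → ℝ} (hate : ∀ b, ate b = 2 * b / (1 - m.aSum)) (v : ℝ) :
    HasAsymptoticMSE P (atTop ×ˢ comap ate (𝓝 0))
        (fun i : ℕ × ℝ => scaledError m i.2 (ate i.2) y0 U ε i.1) v ↔
      Tendsto (normalizedVariance P m ξ U ε) atTop (𝓝 v) := by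
  have ha := m.one_sub_aSum_ne_zero hroot
  -- since `ate 0 = 0`, the filter of vanishing effects is proper
  have hne : NeBot (comap ate (𝓝 0)) := comap_neBot fun t ht => ⟨0, by
    simpa [hate] using mem_of_mem_nhds ht⟩
  have hfst : Tendsto Prod.fst (atTop ×ˢ comap ate (𝓝 0)) (atTop : Filter ℕ) := tendsto_fst
  have hn : Tendsto (fun i : ℕ × ℝ => i.1 - (p + q)) (atTop ×ˢ comap ate (𝓝 0)) atTop :=
    (tendsto_sub_atTop_nat (p + q)).comp hfst
  have hb : Tendsto (fun i : ℕ × ℝ => i.2) (atTop ×ˢ comap ate (𝓝 0)) (𝓝 0) := by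
    have hsnd : Tendsto (fun i : ℕ × ℝ => ate i.2) (atTop ×ˢ comap ate (𝓝 0)) (𝓝 0) :=
      tendsto_comap.comp tendsto_snd
    have h := (hsnd.mul_const (1 - m.aSum)).div_const 2
    rw [zero_mul, zero_div] at h
    refine h.congr fun i => ?_
    rw [hate]
    field_simp
  have hlim := tendsto_scaledError_sub_leadingTerm m hroot hident hε hU hy0 hξ hfreq hn hb
  have hlim' : TendstoInMeasure P (fun i ω => scaledError m i.2 (ate i.2) y0 U ε i.1 ω -
      leadingTerm m ξ U ε i.1 ω) (atTop ×ˢ comap ate (𝓝 0)) fun _ => 0 := by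
    refine hlim.congr' ?_ EventuallyEq.rfl
    filter_upwards [hfst.eventually_ge_atTop (p + q)] with i hi
    rw [Nat.sub_add_cancel hi, hate]
  have hmeas : ∀ T, Measurable (leadingTerm m ξ U ε T) := fun T => by
    unfold leadingTerm
    exact (Finset.measurable_fun_sum _ fun t ht =>
      (((hU.measurable t (Finset.mem_Icc.1 ht).1).sub_const ξ).const_mul _).mul
        (measurable_residual m hε t)).const_mul _
  rw [hasAsymptoticMSE_iff_tendsto (map_fst_prod _ _)
    (fun i => measurable_scaledError m hε hU hy0m _ _ _) hmeas
    (uniformlySqIntegrable_leadingTerm m hε hU ξ) hlim' v]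
  simp only [integral_sq_leadingTerm m hε hU ξ]

end LeadingVariance

end ControlledARMA

end

theorem theorem1 {Ω : Type*} [MeasurableSpace Ω] (P : Measure Ω) [IsProbabilityMeasure P]
    {p q : ℕ} (m : ControlledARMA.Params p q) (hroot : m.NoUnitRoot)
    (σ : ℝ) (hident : (m.yuleWalkerMatrix σ).det ≠ 0)
    (ε : ℤ → Ω → ℝ) (hε : ControlledARMA.IsWhiteNoise P σ ε)
    (y0 : ℤ → Ω → ℝ) (hy0m : ∀ t, Measurable (y0 t)) (hy0 : ∀ t, Integrable (y0 t) P)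
    (π : ControlledARMA.Design) (U : ℤ → Ω → ℝ) (hU : ControlledARMA.IsGeneratedBy P π U ε y0)
    (ξ : ℝ) (hξ : Tendsto (fun t : ℕ => ∫ ω, U (t : ℤ) ω ∂P) atTop (𝓝 ξ)) (hξ1 : ξ ^ 2 ≠ 1)
    (hfreq : TendstoInMeasure P
      (fun (T : ℕ) ω => (T : ℝ)⁻¹ * ∑ t ∈ Finset.Icc (1 : ℤ) T, U t ω) atTop (fun _ => ξ)) :
    ∃ ate : ℝ → ℝ, (∀ b, ControlledARMA.IsATE P m b ε y0 (ate b)) ∧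
      ∀ v : ℝ,
        ControlledARMA.HasAsymptoticMSE P (atTop ×ˢ comap ate (𝓝 0))
            (fun i : ℕ × ℝ => ControlledARMA.scaledError m i.2 (ate i.2) y0 U ε i.1) v ↔
          Tendsto (ControlledARMA.normalizedVariance P m ξ U ε) atTop (𝓝 v) := by
  exact ⟨fun b => 2 * b / (1 - m.aSum), ControlledARMA.isATE m hroot hε hy0, fun v =>
    ControlledARMA.hasAsymptoticMSE_scaledError_iff m hroot hident hε hU hy0m hy0 hξ1 hfreq
      (fun _ => rfl) v⟩
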